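/- A parameterized problem is a set $L\subseteq\Sigma^*\times\mathbb N$ with $\Sigma$ a finite alphabet. An fpt-reduction from $L\subseteq\Sigma^*\times\mathbb N$ to $L'\subseteq\Sigma'^*\times\mathbb N$ is a map $R:\Sigma^*\times\mathbb N\to\Sigma'^*\times\mathbb N$ such that $(I,k)\in L\iff R(I,k)\in L'$ for all $(I,k)$; the parameter of $R(I,k)$ is at most $g(k)$ for some computable function $g$; and $R$ is computable by a Turing machine in time $f(k)\cdot(|I|+1)^{c}$ for some computable function $f$ and some constant $c$. The problem $\exists^*\forall^k\text{-WSat}(\Gamma)$ has as instances pairs $(C,k)$ of a Boolean circuit $C$ (an arbitrary circuit with AND and OR gates of arbitrary fan-in, NOT gates, and a single output) over two disjoint sets $X$ and $Y$ of variables, and an integer $k\ge 0$, which is the parameter. The question is whether there is a truth assignment $\alpha$ to $X$ such that for all truth assignments $\beta$ to $Y$ that set exactly $k$ variables to true, $\alpha\cup\beta$ satisfies $C$. The class $\exists^*\forall^k\text{-W}[\mathrm P]$ consists of all parameterized problems (over arbitrary finite alphabets) that have an fpt-reduction to $\exists^*\forall^k\text{-WSat}(\Gamma)$. A disjunctive logic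 program $P$ is a finite set of rules $a_1\vee\dots\vee a_s\leftarrow b_1,\dots,b_m,\mathrm{not}\,c_1,\dots,\mathrm{not}\,c_n$ with $s,m,n\ge 0$ and $a_i,b_i,c_i$ atoms; a rule is disjunctive if $s>1$. For a set $M$ of atoms, the reduct $P^M$ is obtained from $P$ by removing all rules with some $c_i\in M$ and removing the literals $\mathrm{not}\,c_i$ from all other rules. An answer set of $P$ is a set $M$ of atoms that is a subset-minimal model of $P^M$. The parameterized problem ASP-consistency(#disj.rules) asks whether a given disjunctive logic program has an answer set; its parameter is the number of disjunctive rules of the program. **Theorem.** ASP-consistency(#disj.rules) is $\exists^*\forall^k\text{-W}[\mathrm P]$-complete: it belongs to $\exists^*\forall^k\text{-W}[\mathrm P]$, and every problem in $\exists^*\forall^k\text{-W}[\mathrm P]$ has an fpt-reduction to it. -/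

import Mathlib

namespace ParamASP

/-! ### Parameterized problems, fpt-reductions, completeness -/

/-- A parameterized problem: a subset of `S* × ℕ` for a finite alphabet `S`. -/
structure ParamProblem where
  /-- the alphabet -/
  Alphabet : Type
  /-- the alphabet is finite -/
  finite_alphabet : Finite Alphabet
  /-- the set of yes-instances `(I, k)`, with main part `I` and parameter `k` -/
  yes : Set (List Alphabet × ℕ)

/-- The word that is handed to a machine for the instance `(I, k)`: the symbols of `I`, followed by
`k` in unary, written with symbols that are not in the alphabet of `I`. -/
def instanceWord {S : Type} (p : List S × ℕ) : List (S ⊕ Bool) :=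
  (Computability.encodingProd (Computability.encodingList S)
    Computability.unaryEncodingNat).encode p

/-- `R` is computable in fpt-time: some (multi-stack) Turing machine computes `R(I, k)` within
`f(k) · (|I| + 1) ^ c` steps on every input `(I, k)`, for a computable function `f` and
a constant `c`. -/
def FptTimeComputable {S T : Type} (R : List S × ℕ → List T × ℕ) : Prop :=
  ∃ (M : Turing.TM2ComputableAux (S ⊕ Bool) (T ⊕ Bool)) (f : ℕ → ℕ) (c : ℕ), Computable f ∧
    ∀ (I : List S) (k : ℕ),
      Nonempty (Turing.TM2OutputsInTime M.tm
        ((instanceWord (I, k)).map M.inputAlphabet.invFun)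
        (some ((instanceWord (R (I, k))).map M.outputAlphabet.invFun))
        (f k * (I.length + 1) ^ c))

/-- There is an fpt-reduction from `L` to `L'`. -/
def FptReducible (L L' : ParamProblem) : Prop :=
  ∃ R : List L.Alphabet × ℕ → List L'.Alphabet × ℕ,
    (∀ p, p ∈ L.yes ↔ R p ∈ L'.yes) ∧
    (∃ g : ℕ → ℕ, Computable g ∧ ∀ I k, (R (I, k)).2 ≤ g k) ∧
    FptTimeComputable R

/-- The closure of a class of parameterized problems under fpt-reductions. -/
def fptClosure (K : Set ParamProblem) : Set ParamProblem :=
  {L | ∃ L' ∈ K, FptReducible L L'}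

/-- Hardness for a class of parameterized problems, under fpt-reductions. -/
def IsHardFor (K : Set ParamProblem) (L : ParamProblem) : Prop :=
  ∀ L' ∈ K, FptReducible L' L

/-- Completeness for a class of parameterized problems, under fpt-reductions. -/
def IsCompleteFor (K : Set ParamProblem) (L : ParamProblem) : Prop :=
  L ∈ K ∧ IsHardFor K L

/-! ### Quantified Boolean circuits and the weighted satisfiability problem -/

/-- The nodes of a quantified Boolean circuit: input nodes, that is, existential or universal
variables, and gates of arbitrary fan-in. The inputs of a gate are given by their positions in
the list of all nodes of the circuit. -/
inductive Node where
  | ex : Node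
  | all : Node
  | and (inputs : List ℕ) : Node
  | or (inputs : List ℕ) : Node
  | not (input : ℕ) : Node
  deriving DecidableEq

/-- The positions of the inputs of a node. -/
def Node.inputs : Node → List ℕ
  | .ex => []
  | .all => []
  | .and l => l
  | .or l => l
  | .not i => [i]

/-- A quantified Boolean circuit: a nonempty list of nodes in a topological order, so that every
gate has only earlier nodes as inputs. The last node is the output. -/
structure Circuit where
  /-- the nodes, in a topological order -/
  nodes : List Node
  /-- there is an output node -/
  nonempty : nodes ≠ []
  /-- all edges go from earlier to later nodes -/
  acyclic : ∀ (i : ℕ) (h : i < nodes.length), ∀ j ∈ (nodes[i]).inputs, j < i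

/-- The truth value of a node, given its value `a` if it is a variable, and the values `v` of the
nodes before it. -/
def Node.eval (a : Bool) (v : ℕ → Bool) : Node → Bool
  | .ex => a
  | .all => a
  | .and l => l.all v
  | .or l => l.any v
  | .not i => !(v i)

/-- The truth values of a list of nodes, computed from left to right, under the assignment that
makes true exactly the variables with position in `A`. -/
def nodeValues (A : Finset ℕ) (l : List Node) : List Bool :=
  l.foldl (fun vs nd => vs ++ [nd.eval (decide (vs.length ∈ A)) (fun j => vs.getD j false)]) []

namespace Circuit

/-- The (positions of the) existential variables of a circuit. -/
def exVars (C : Circuit) : Finset ℕ :=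
  (Finset.range C.nodes.length).filter (fun i => C.nodes[i]? = some Node.ex)

/-- The (positions of the) universal variables of a circuit. -/
def allVars (C : Circuit) : Finset ℕ :=
  (Finset.range C.nodes.length).filter (fun i => C.nodes[i]? = some Node.all)

/-- The assignment that makes true exactly the variables in `A` satisfies the circuit. -/
def Satisfies (C : Circuit) (A : Finset ℕ) : Prop :=
  (nodeValues A C.nodes).getLast? = some true

/-- There is a truth assignment to the existential variables such that for all truth assignments
of weight `k` to the universal variables the circuit is satisfied. A truth assignment is given by
the set of variables that it makes true, and its weight is the size of this set. -/
def ExistsForallWeight (C : Circuit) (k : ℕ) : Prop :=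
  ∃ A ⊆ C.exVars, ∀ B ⊆ C.allVars, B.card = k → C.Satisfies (A ∪ B)

end Circuit

/-- The alphabet in which circuits are written. -/
inductive CircuitSymbol where
  | ex | all | and | or | not | one | sep
  deriving DecidableEq

instance : Fintype CircuitSymbol :=
  ⟨{.ex, .all, .and, .or, .not, .one, .sep}, fun s => by cases s <;> decide⟩

/-- A position, in unary, with an end marker. -/
def positionWord (i : ℕ) : List CircuitSymbol :=
  List.replicate i .one ++ [.sep]

/-- The word for a node: its kind, followed by the positions of its inputs. -/
def Node.word : Node → List CircuitSymbol
  | .ex => [.ex]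
  | .all => [.all]
  | .and l => .and :: l.flatMap positionWord
  | .or l => .or :: l.flatMap positionWord
  | .not i => .not :: positionWord i

/-- The word for a circuit. -/
def Circuit.word (C : Circuit) : List CircuitSymbol :=
  C.nodes.flatMap Node.word

/-- The parameterized problem `∃*∀ᵏ-WSat(𝒞)`, for a class `𝒞` of circuits. -/
def existsForallWSat (𝒞 : Set Circuit) : ParamProblem where
  Alphabet := CircuitSymbol
  finite_alphabet := inferInstance
  yes := {p | ∃ C ∈ 𝒞, p.1 = C.word ∧ C.ExistsForallWeight p.2}

/-- The class `∃*∀ᵏ-W[P]`: the closure under fpt-reductions of `∃*∀ᵏ-WSat(Γ)`, where `Γ` is the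
class of all circuits. -/
def existsForallWP : Set ParamProblem :=
  fptClosure {existsForallWSat Set.univ}

/-! ### Disjunctive logic programs -/

/-- Atoms are given by their names, which are bit strings. -/
abbrev Atom := List Bool

/-- The rule `a₁ ∨ ⋯ ∨ aₖ ← b₁, …, bₘ, not c₁, …, not cₙ`. -/
structure Rule where
  /-- the disjuncts `a₁, …, aₖ` of the head -/
  head : List Atom
  /-- the atoms `b₁, …, bₘ` of the body -/
  pos : List Atom
  /-- the negated atoms `c₁, …, cₙ` of the body -/
  neg : List Atom
  deriving DecidableEq

namespace Rule

/-- A rule is disjunctive if it has strictly more than one disjunct in the head. -/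
def IsDisjunctive (r : Rule) : Prop := 1 < r.head.length

instance : DecidablePred IsDisjunctive := fun r => inferInstanceAs (Decidable (1 < r.head.length))

/-- The rule without the negated atoms of its body. -/
def negationFree (r : Rule) : Rule := { r with neg := [] }

/-- The set `M` of atoms satisfies the rule. -/
def Satisfied (r : Rule) (M : Finset Atom) : Prop :=
  (∀ b ∈ r.pos, b ∈ M) → (∀ c ∈ r.neg, c ∉ M) → ∃ a ∈ r.head, a ∈ M

end Rule

/-- A disjunctive logic program is a finite set of rules. -/
abbrev Program := Finset Rule

namespace Program

/-- The number of disjunctive rules of a program. -/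
def numDisjunctive (P : Program) : ℕ := (P.filter Rule.IsDisjunctive).card

/-- `M` is a model of the program. -/
def IsModel (P : Program) (M : Finset Atom) : Prop := ∀ r ∈ P, r.Satisfied M

/-- The Gelfond–Lifschitz reduct `P^M`: the rules with a negated atom from `M` in the body are
removed, and all negated atoms are removed from the other rules. -/
def reduct (P : Program) (M : Finset Atom) : Program :=
  (P.filter (fun r => ∀ c ∈ r.neg, c ∉ M)).image Rule.negationFree

/-- An answer set is a subset-minimal model of the reduct of the program with respect to it. -/
def IsAnswerSet (P : Program) (M : Finset Atom) : Prop :=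
  Minimal (fun N => IsModel (reduct P M) N) M

end Program

/-- The alphabet in which programs are written. -/
inductive ProgramSymbol where
  | bit (b : Bool) | head | pos | neg | ruleEnd
  deriving DecidableEq, Fintype

/-- The word for an atom: its name, followed by a symbol `s` that tells where it occurs. -/
def atomWord (s : ProgramSymbol) (a : Atom) : List ProgramSymbol :=
  a.map .bit ++ [s]

/-- The word for a rule. -/
def Rule.word (r : Rule) : List ProgramSymbol :=
  r.head.flatMap (atomWord .head) ++ r.pos.flatMap (atomWord .pos) ++
    r.neg.flatMap (atomWord .neg) ++ [.ruleEnd]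

/-- The word for a list of rules. -/
def rulesWord (l : List Rule) : List ProgramSymbol := l.flatMap Rule.word

/-- ASP-consistency, parameterized by the number of disjunctive rules. A program is written
as a list of its rules, in any order. -/
def aspConsistencyDisjRules : ParamProblem where
  Alphabet := ProgramSymbol
  finite_alphabet := inferInstance
  yes := {p | ∃ l : List Rule, p.1 = rulesWord l ∧
    Program.numDisjunctive l.toFinset = p.2 ∧ ∃ M, Program.IsAnswerSet l.toFinset M}

end ParamASP

/-! Membership. Fix a candidate `M` and select one head atom from each disjunctive rule. The reduct
then behaves like a program without disjunctions, and the atoms it derives are found by forward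
chaining, in as many rounds as there are atoms. A model `M` of the reduct is minimal iff no
selection derives a proper subset of `M`. Indeed, every model `N` of the reduct contains all atoms
derived for a selection that prefers atoms of `N` (`exists_selection`), and conversely a derived set
that lies inside `M` is itself a model (`leastModel_isModel`). A circuit guesses `M` with its
existential variables, reads the selection from universal variables whose weight is the number of
disjunctive rules, and unrolls the rounds of the derivation (`aspCircuit_iff`).

Hardness. The values of the existential variables are guessed by rules with negation. For each `j <
k` one disjunctive rule chooses the universal variable with number `j`, so there are exactly `k`
disjunctive rules. The remaining rules compute the value of every node. An atom `W` is derived if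
the output is true or if the choice is not valid, and `W` in turn derives all other atoms except the
guessed ones (saturation). The rule `W ← not W` forces `W` into every answer set. The saturated set
is minimal iff no smaller model avoids `W`, and such a smaller model is the same as a weight-`k`
assignment that falsifies the circuit (`not_satisfies_of_isReductModel`,
`exists_isAnswerSet_of_existsForallWeight`, `existsForallWeight_of_exists_isAnswerSet`).

Running time. Neither reduction increases the parameter, and both are polynomial-time functions. To
prove the latter without writing machines by hand, data are coded as binary trees, and `PolyFun` is
shown to be closed under case distinction, bounded folds and the usual list operations. Each such
function is computed by a structured stack program, and `compMachine` runs such a program after a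
given machine. Since the running time of a machine bounds its output length, fpt-time followed by
polynomial time is again fpt-time (`FptTimeComputable.comp_polyFun`). -/

namespace ParamASP

open Turing Function

/-! ### Structured programs over stacks -/

/-- The stacks of a structured program: an input stack, an output stack, a data stack, and three
auxiliary stacks. -/
inductive Stk where
  | inp | out | d | a | b | c
  deriving DecidableEq

instance : Fintype Stk :=
  ⟨{.inp, .out, .d, .a, .b, .c}, fun k => by cases k <;> decide⟩

/-- The alphabets of the stacks. -/
abbrev Sym (S T : Type) : Stk → Type
  | .inp => S
  | .out => T
  | _ => Bool

/-- The contents of the stacks. -/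
structure Store (S T : Type) where
  inp : List S
  out : List T
  d : List Bool
  a : List Bool
  b : List Bool
  c : List Bool

namespace Store
variable {S T : Type}

/-- The content of a stack. -/
@[simp] def get (s : Store S T) : ∀ k, List (Sym S T k)
  | .inp => s.inp
  | .out => s.out
  | .d => s.d
  | .a => s.a
  | .b => s.b
  | .c => s.c

/-- Replace the content of a stack. -/
@[simp] def set (s : Store S T) : ∀ k, List (Sym S T k) → Store S T
  | .inp, l => { s with inp := l }
  | .out, l => { s with out := l }
  | .d, l => { s with d := l }
  | .a, l => { s with a := l }
  | .b, l => { s with b := l }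
  | .c, l => { s with c := l }

theorem get_set (s : Store S T) (k : Stk) (l : List (Sym S T k)) :
    (s.set k l).get = update s.get k l := by
  funext j
  cases k <;> cases j <;> rfl

end Store

/-- Structured programs. `pop k f` removes the top symbol of the stack `k` and continues depending
on this symbol; `loop k f` removes symbols `x` from the stack `k` until it is empty, and executes
`f x` each time. -/
inductive Prog (S T : Type) where
  | skip : Prog S T
  | push (k : Stk) (x : Sym S T k) : Prog S T
  | pop (k : Stk) (f : Option (Sym S T k) → Prog S T) : Prog S T
  | seq (p q : Prog S T) : Prog S T
  | loop (k : Stk) (f : Sym S T k → Prog S T) : Prog S T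

/-- `Exec p s n s'`: started on `s`, the program `p` terminates on `s'` after `n` steps. -/
inductive Exec {S T : Type} : Prog S T → Store S T → ℕ → Store S T → Prop
  | skip {s} : Exec .skip s 1 s
  | push {s k x} : Exec (.push k x) s 1 (s.set k (x :: s.get k))
  | pop {s k f n s'} : Exec (f (s.get k).head?) (s.set k (s.get k).tail) n s' →
      Exec (.pop k f) s (n + 1) s'
  | seq {p q s m s' n s''} : Exec p s m s' → Exec q s' n s'' → Exec (.seq p q) s (m + n + 1) s''
  | loop_nil {s k f} : s.get k = [] → Exec (.loop k f) s 1 s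
  | loop_cons {s k f x l m s' n s''} : s.get k = x :: l → Exec (f x) (s.set k l) m s' →
      Exec (.loop k f) s' n s'' → Exec (.loop k f) s (m + n + 1) s''

/-! ### Counted computations -/

/-- `f` leads from `a` to `b` in exactly `n` steps. -/
def Steps {σ : Type*} (f : σ → Option σ) (n : ℕ) (a b : σ) : Prop :=
  (flip bind f)^[n] (some a) = some b

namespace Steps
variable {σ : Type*} {f : σ → Option σ} {a b c : σ} {m n : ℕ}

theorem single (h : f a = some b) : Steps f 1 a b := by
  simpa [Steps, flip] using h

theorem trans (h₁ : Steps f m a b) (h₂ : Steps f n b c) : Steps f (m + n) a c := by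
  unfold Steps at *
  rw [add_comm, iterate_add_apply, h₁, h₂]

theorem iterate_none : (flip bind f)^[n] none = none := by
  induction n with
  | zero => rfl
  | succ n ih => rw [iterate_succ_apply]; exact ih

theorem head (h : Steps f (n + 1) a c) : ∃ b, f a = some b ∧ Steps f n b c := by
  unfold Steps at h
  rw [iterate_succ_apply] at h
  change (flip bind f)^[n] (f a) = some c at h
  cases hb : f a with
  | none => rw [hb, iterate_none] at h; cases h
  | some b => exact ⟨b, rfl, by rw [hb] at h; exact h⟩

/-- Only successful steps have to be mirrored. Where `f` halts, `g` may go on, so that a larger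
machine can take over after the simulated one has finished. -/
theorem map {τ : Type*} {g : τ → Option τ} (e : σ → τ)
    (he : ∀ x y, f x = some y → g (e x) = some (e y)) :
    ∀ {n a b}, Steps f n a b → Steps g n (e a) (e b)
  | 0, a, b, h => by cases h; rfl
  | n + 1, a, b, h => by
    obtain ⟨c, hc, h⟩ := h.head
    have := (single (he _ _ hc)).trans (map e he h)
    rwa [add_comm] at this

end Steps

/-! ### The number of symbols on the stacks of a machine -/

/-- The number of symbols that a statement pushes. -/
def stmtGrowth {K : Type} {Γ : K → Type} {Λ σ : Type} : TM2.Stmt Γ Λ σ → ℕ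
  | .push _ _ q => stmtGrowth q + 1
  | .peek _ _ q => stmtGrowth q
  | .pop _ _ q => stmtGrowth q
  | .load _ q => stmtGrowth q
  | .branch _ p q => stmtGrowth p + stmtGrowth q
  | .goto _ => 0
  | .halt => 0

/-- The number of symbols on the stacks. -/
def stackSize {K : Type} [Fintype K] {Γ : K → Type} (s : ∀ k, List (Γ k)) : ℕ :=
  ∑ k, (s k).length

theorem stackSize_update_le {K : Type} [Fintype K] [DecidableEq K] {Γ : K → Type}
    (s : ∀ k, List (Γ k)) (k : K) (l : List (Γ k)) (n : ℕ) (h : l.length ≤ (s k).length + n) :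
    stackSize (update s k l) ≤ stackSize s + n := by
  unfold stackSize
  rw [← Finset.add_sum_erase _ _ (Finset.mem_univ k),
    ← Finset.add_sum_erase _ (fun k => (s k).length) (Finset.mem_univ k)]
  have : ∑ x ∈ Finset.univ.erase k, (update s k l x).length =
      ∑ x ∈ Finset.univ.erase k, (s x).length :=
    Finset.sum_congr rfl fun x hx => by rw [update_of_ne (Finset.ne_of_mem_erase hx)]
  rw [this, update_self]
  omega

theorem stackSize_stepAux {K : Type} [Fintype K] [DecidableEq K] {Γ : K → Type} {Λ σ : Type}
    (q : TM2.Stmt Γ Λ σ) (v : σ) (s : ∀ k, List (Γ k)) :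
    stackSize (TM2.stepAux q v s).stk ≤ stackSize s + stmtGrowth q := by
  induction q generalizing v s with
  | push k f q ih =>
    have := stackSize_update_le s k (f v :: s k) 1 (by simp)
    have := ih v (update s k (f v :: s k))
    simp only [TM2.stepAux, stmtGrowth]
    omega
  | peek k f q ih => exact ih _ _
  | pop k f q ih =>
    have := stackSize_update_le s k (s k).tail 0 (by simp)
    have := ih (f v (s k).head?) (update s k (s k).tail)
    simp only [TM2.stepAux, stmtGrowth]
    omega
  | load f q ih => exact ih _ _
  | branch f p q ihp ihq =>
    have := ihp v s
    have := ihq v s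
    simp only [TM2.stepAux, stmtGrowth]
    cases f v <;> simp only [cond] <;> omega
  | goto f => exact le_rfl
  | halt => exact le_rfl

/-- A bound for the number of symbols that a machine pushes in one step. -/
def machineGrowth (M : FinTM2) : ℕ :=
  haveI := M.ΛFin
  ∑ l, stmtGrowth (M.m l)

theorem stackSize_step (M : FinTM2) {x y : M.Cfg} (h : M.step x = some y) :
    (haveI := M.kFin; stackSize y.stk ≤ stackSize x.stk + machineGrowth M) := by
  let _ := M.kFin
  let _ := M.ΛFin
  obtain ⟨l, v, s⟩ := x
  cases l with
  | none => cases h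
  | some l =>
    cases h
    refine (stackSize_stepAux _ _ _).trans (Nat.add_le_add_left ?_ _)
    exact Finset.single_le_sum (f := fun l => stmtGrowth (M.m l)) (fun _ _ => Nat.zero_le _)
      (Finset.mem_univ l)

theorem stackSize_steps (M : FinTM2) {n : ℕ} {x y : M.Cfg} (h : Steps M.step n x y) :
    (haveI := M.kFin; stackSize y.stk ≤ stackSize x.stk + n * machineGrowth M) := by
  let _ := M.kFin
  induction n generalizing x with
  | zero => cases h; simp
  | succ n ih =>
    obtain ⟨z, hz, h⟩ := h.head
    have h1 := stackSize_step M hz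
    have h2 := ih h
    rw [Nat.succ_mul]
    exact h2.trans ((Nat.add_le_add_right h1 _).trans (by omega))

theorem stackSize_single {K : Type} [Fintype K] [DecidableEq K] {Γ : K → Type}
    (s : ∀ k, List (Γ k)) (k : K) (h : ∀ j, j ≠ k → s j = []) :
    stackSize s = (s k).length := by
  unfold stackSize
  exact Finset.sum_eq_single k (fun j _ hj => by rw [h j hj]; rfl) (by simp)

theorem initList_self (M : FinTM2) (l) : (initList M l).stk M.k₀ = l := by simp [initList]
theorem initList_of_ne (M : FinTM2) (l) {k} (h : k ≠ M.k₀) : (initList M l).stk k = [] := by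
  simp [initList, h]
theorem haltList_self (M : FinTM2) (l) : (haltList M l).stk M.k₁ = l := by simp [haltList]
theorem haltList_of_ne (M : FinTM2) (l) {k} (h : k ≠ M.k₁) : (haltList M l).stk k = [] := by
  simp [haltList, h]

/-- At the beginning and at the end only one stack is nonempty, and each step pushes a bounded
number of symbols. This is how a time bound becomes a bound for the input length of whatever runs
next. -/
theorem length_output_le (M : FinTM2) {n : ℕ} {v w}
    (h : Steps M.step n (initList M v) (haltList M w)) :
    w.length ≤ v.length + n * machineGrowth M := by
  let _ := M.kFin
  have := stackSize_steps M h
  rw [stackSize_single _ M.k₀ fun _ => initList_of_ne M v,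
    stackSize_single _ M.k₁ fun _ => haltList_of_ne M w] at this
  rwa [initList_self, haltList_self] at this

/-! ### Running a structured program after a machine -/

section Compile

variable {S T : Type}

/-- The control lists that a program visits before it continues with `k`. -/
def ctlReach : Prog S T → List (Prog S T) → Set (List (Prog S T))
  | .skip, k => {.skip :: k}
  | .push i x, k => {.push i x :: k}
  | .pop i f, k => {.pop i f :: k} ∪ ⋃ o, ctlReach (f o) k
  | .seq p q, k => {.seq p q :: k} ∪ ctlReach p (q :: k) ∪ ctlReach q k
  | .loop i f, k => {.loop i f :: k} ∪ ⋃ x, ctlReach (f x) (.loop i f :: k)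

instance [Finite S] [Finite T] (k : Stk) : Finite (Sym S T k) := by
  cases k <;> simp only [Sym] <;> infer_instance

/-- Control lists serve as machine labels, so there must be finitely many. Induction on the program
suffices: a loop body is entered with one fixed longer list, and the branches range over finite
alphabets. -/
theorem finite_ctlReach [Finite S] [Finite T] (p : Prog S T) (k : List (Prog S T)) :
    (ctlReach p k).Finite := by
  induction p generalizing k with
  | skip => exact Set.finite_singleton _
  | push => exact Set.finite_singleton _
  | pop i f ih => exact (Set.finite_singleton _).union (Set.finite_iUnion fun o => ih o k)
  | seq p q ihp ihq => exact ((Set.finite_singleton _).union (ihp _)).union (ihq _)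
  | loop i f ih => exact (Set.finite_singleton _).union (Set.finite_iUnion fun o => ih o _)

theorem cons_mem_ctlReach (p : Prog S T) (k : List (Prog S T)) : p :: k ∈ ctlReach p k := by
  cases p <;> simp [ctlReach]

/-- The labels of the machine that runs a program `p` after the machine `M`. -/
abbrev CompLabel (M : FinTM2) (p : Prog S T) : Type :=
  M.Λ ⊕ Option ↥(insert [] (ctlReach p []))

/-- The label for a control list. -/
noncomputable def ctlLabel (M : FinTM2) (p : Prog S T) (l : List (Prog S T)) : CompLabel M p :=
  open Classical in
  -- `[]` is a default for lists that are not reachable; it is never used in a simulated run.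
  .inr (some (if h : l ∈ insert [] (ctlReach p []) then ⟨l, h⟩ else ⟨[], Set.mem_insert _ _⟩))

/-- The alphabets of the composed machine. -/
abbrev CompStack (M : FinTM2) (S T : Type) : M.K ⊕ Stk → Type
  | .inl k => M.Γ k
  | .inr k => Sym S T k

/-- The internal state: that of `M`, and the symbols read last. -/
abbrev CompVar (M : FinTM2) (S T : Type) : Type := M.σ × ∀ k, Option (Sym S T k)

abbrev CompStmt (M : FinTM2) (p : Prog S T) : Type :=
  TM2.Stmt (CompStack M S T) (CompLabel M p) (CompVar M S T)

abbrev CompCfg (M : FinTM2) (p : Prog S T) : Type :=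
  TM2.Cfg (CompStack M S T) (CompLabel M p) (CompVar M S T)

/-- A statement of `M` as a statement of the composed machine. -/
def liftStmt (M : FinTM2) (p : Prog S T) : TM2.Stmt M.Γ M.Λ M.σ → CompStmt M p
  | .push k f q => .push (.inl k) (fun v => f v.1) (liftStmt M p q)
  | .peek k f q => .peek (.inl k) (fun v o => (f v.1 o, v.2)) (liftStmt M p q)
  | .pop k f q => .pop (.inl k) (fun v o => (f v.1 o, v.2)) (liftStmt M p q)
  | .load f q => .load (fun v => (f v.1, v.2)) (liftStmt M p q)
  | .branch f q r => .branch (fun v => f v.1) (liftStmt M p q) (liftStmt M p r)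
  | .goto f => .goto fun v => .inl (f v.1)
  -- Instead of halting, control passes to the loop that transfers the output.
  | .halt => .goto fun _ => .inr none

/-- The statement that executes the first step of a control list. -/
noncomputable def ctlStmt (M : FinTM2) (p : Prog S T) : List (Prog S T) → CompStmt M p
  -- A halting configuration must carry the initial internal state, so the symbols read last are
  -- erased.
  | [] => .load (fun v => (v.1, fun _ => none)) .halt
  | .skip :: l => .goto fun _ => ctlLabel M p l
  | .push k x :: l => .push (.inr k) (fun _ => x) (.goto fun _ => ctlLabel M p l)
  | .pop k f :: l => .pop (.inr k) (fun v o => (v.1, update v.2 k o))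
      (.goto fun v => ctlLabel M p (f (v.2 k) :: l))
  | .seq q r :: l => .goto fun _ => ctlLabel M p (q :: r :: l)
  | .loop k f :: l => .pop (.inr k) (fun v o => (v.1, update v.2 k o))
      (.goto fun v => ctlLabel M p
        ((v.2 k).elim l fun x => f x :: .loop k f :: l))

/-- The statements of the composed machine: it runs `M`, moves the output of `M` to the input stack
of `p`, and runs `p`. -/
noncomputable def compStmt {U : Type} (M : TM2ComputableAux U S) [Inhabited S] (p : Prog S T) :
    CompLabel M.tm p → CompStmt M.tm p
  | .inl l => liftStmt M.tm p (M.tm.m l)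
  -- Moving symbols from one stack to the other reverses the word; the program that follows has to
  -- expect this.
  | .inr none => .pop (.inl M.tm.k₁)
      (fun v o => (v.1, update v.2 .inp (o.map M.outputAlphabet)))
      (.branch (fun v => (v.2 .inp).isSome)
        (.push (.inr .inp) (fun v => (v.2 .inp).getD default) (.goto fun _ => .inr none))
        (.goto fun _ => ctlLabel M.tm p [p]))
  | .inr (some l) => ctlStmt M.tm p l.1

/-- Stack contents of the composed machine. -/
def joinStk {M : FinTM2} (t : ∀ k, List (M.Γ k)) (s : Store S T) : ∀ k, List (CompStack M S T k)
  | .inl k => t k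
  | .inr k => s.get k

@[simp] theorem joinStk_inl {M : FinTM2} (t : ∀ k, List (M.Γ k)) (s : Store S T) (k) :
    joinStk t s (.inl k) = t k := rfl

@[simp] theorem joinStk_inr {M : FinTM2} (t : ∀ k, List (M.Γ k)) (s : Store S T) (k) :
    joinStk t s (.inr k) = s.get k := rfl

theorem update_joinStk_inr {M : FinTM2} (t : ∀ k, List (M.Γ k)) (s : Store S T) (k)
    (x : List (Sym S T k)) : update (joinStk t s) (.inr k) x = joinStk t (s.set k x) := by
  funext j
  rcases j with j | j
  · rw [update_of_ne (by simp)]; rfl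
  · rw [joinStk_inr, Store.get_set]
    by_cases h : j = k
    · subst h; rw [update_self, update_self]
    · rw [update_of_ne (by simpa using h), update_of_ne h, joinStk_inr]

theorem update_joinStk_inl {M : FinTM2} (t : ∀ k, List (M.Γ k)) (s : Store S T) (k)
    (x : List (M.Γ k)) : update (joinStk t s) (.inl k) x = joinStk (update t k x) s := by
  funext j
  rcases j with j | j
  · rw [joinStk_inl]
    by_cases h : j = k
    · subst h; rw [update_self, update_self]
    · rw [update_of_ne (by simpa using h), update_of_ne h, joinStk_inl]
  · rw [update_of_ne (by simp)]; rfl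

/-- A configuration of `M` as a configuration of the composed machine. -/
def liftCfg (M : FinTM2) (p : Prog S T) (x : TM2.Cfg M.Γ M.Λ M.σ) : CompCfg M p where
  l := some (x.l.elim (.inr none) .inl)
  var := (x.var, fun _ => none)
  stk := joinStk x.stk ⟨[], [], [], [], [], []⟩

theorem stepAux_liftStmt (M : FinTM2) (p : Prog S T) (q : TM2.Stmt M.Γ M.Λ M.σ) (v s) :
    TM2.stepAux (liftStmt M p q) (v, fun _ => none) (joinStk s ⟨[], [], [], [], [], []⟩) =
      liftCfg M p (TM2.stepAux q v s) := by
  induction q generalizing v s with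
  | push k f q ih =>
    simp only [liftStmt, TM2.stepAux]; rw [update_joinStk_inl]; exact ih _ _
  | peek k f q ih => exact ih _ _
  | pop k f q ih =>
    simp only [liftStmt, TM2.stepAux]; rw [update_joinStk_inl]; exact ih _ _
  | load f q ih => exact ih _ _
  | branch f q r ihq ihr =>
    simp only [liftStmt, TM2.stepAux]
    cases f v
    · exact ihr _ _
    · exact ihq _ _
  | goto f => rfl
  | halt => rfl

variable {U : Type} (M : TM2ComputableAux U S) [Inhabited S] (p : Prog S T)

theorem step_liftCfg (x y : M.tm.Cfg) (h : M.tm.step x = some y) :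
    TM2.step (compStmt M p) (liftCfg M.tm p x) = some (liftCfg M.tm p y) := by
  obtain ⟨l, v, s⟩ := x
  cases l with
  | none => cases h
  | some l =>
    cases h
    exact congrArg some (stepAux_liftStmt M.tm p (M.tm.m l) v s)

/-- The configuration of the composed machine with label `l` and store `s`. -/
def storeCfg (l : CompLabel M.tm p) (v : ∀ k, Option (Sym S T k)) (t : ∀ k, List (M.tm.Γ k))
    (s : Store S T) : CompCfg M.tm p :=
  { l := some l
    var := (M.tm.initialState, v)
    stk := joinStk t s }

/-- The statements of the composed machine at a control list. -/
theorem step_ctl {l : List (Prog S T)} (hl : l ∈ insert [] (ctlReach p [])) (v t s) :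
    TM2.step (compStmt M p) (storeCfg M p (ctlLabel M.tm p l) v t s) =
      some (TM2.stepAux (ctlStmt M.tm p l) (M.tm.initialState, v) (joinStk t s)) := by
  rw [ctlLabel, dif_pos hl]
  rfl

/-- Every rule of `Exec` costs exactly one machine step, so the simulation keeps the running time.
The continuation `l` is arbitrary because the induction enters sequences and loop bodies with a
longer control list; the symbols read last are irrelevant afterwards and are quantified away. -/
theorem steps_exec {q : Prog S T} {s s' : Store S T} {n : ℕ} (h : Exec q s n s') :
    ∀ l v t, ctlReach q l ⊆ insert [] (ctlReach p []) →
      ∃ v', Steps (TM2.step (compStmt M p)) n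
        (storeCfg M p (ctlLabel M.tm p (q :: l)) v t s)
        (storeCfg M p (ctlLabel M.tm p l) v' t s') := by
  have hq : ∀ {q : Prog S T} {l}, ctlReach q l ⊆ insert [] (ctlReach p []) →
      q :: l ∈ insert [] (ctlReach p []) := fun h => h (cons_mem_ctlReach _ _)
  induction h with
  | skip =>
    intro l v t hl
    exact ⟨v, Steps.single (step_ctl M p (hq hl) v t _)⟩
  | @push s k x =>
    intro l v t hl
    refine ⟨v, Steps.single ((step_ctl M p (hq hl) v t _).trans ?_)⟩
    simp only [ctlStmt, TM2.stepAux, joinStk_inr, update_joinStk_inr]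
    rfl
  | @pop s k f n s' _ ih =>
    intro l v t hl
    obtain ⟨v', h'⟩ := ih l (update v k (s.get k).head?) t fun x hx =>
      hl (Or.inr (Set.mem_iUnion.2 ⟨_, hx⟩))
    refine ⟨v', ?_⟩
    rw [add_comm]
    refine (Steps.single ((step_ctl M p (hq hl) v t _).trans ?_)).trans h'
    simp only [ctlStmt, TM2.stepAux, joinStk_inr, update_joinStk_inr, update_self]
    rfl
  | @seq p' q s m s' n s'' _ _ ih1 ih2 =>
    intro l v t hl
    obtain ⟨v', h1⟩ := ih1 (q :: l) v t fun x hx => hl (Or.inl (Or.inr hx))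
    obtain ⟨v'', h2⟩ := ih2 l v' t fun x hx => hl (Or.inr hx)
    refine ⟨v'', ?_⟩
    rw [add_comm (m + n)]
    exact (Steps.single (step_ctl M p (hq hl) v t _)).trans (h1.trans h2)
  | @loop_nil s k f hk =>
    intro l v t hl
    refine ⟨update v k none, Steps.single ((step_ctl M p (hq hl) v t _).trans ?_)⟩
    have : s.set k [] = s := by
      cases k <;> simp only [Store.get] at hk <;> simp [← hk]
    simp only [ctlStmt, TM2.stepAux, joinStk_inr, update_joinStk_inr, update_self, hk, List.tail_nil,
      this]
    rfl
  | @loop_cons s k f x l' m s' n s'' hk _ _ ih1 ih2 =>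
    intro l v t hl
    obtain ⟨v', h1⟩ := ih1 (.loop k f :: l) (update v k (some x)) t fun y hy =>
      hl (Or.inr (Set.mem_iUnion.2 ⟨_, hy⟩))
    obtain ⟨v'', h2⟩ := ih2 l v' t hl
    refine ⟨v'', ?_⟩
    rw [add_comm (m + n)]
    refine (Steps.single ((step_ctl M p (hq hl) v t _).trans ?_)).trans (h1.trans h2)
    simp only [ctlStmt, TM2.stepAux, joinStk_inr, update_joinStk_inr, update_self, hk, List.tail_cons,
      List.head?_cons]
    rfl

/-- One step per symbol, and one more to notice that the stack is empty. The accumulator `u` is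
generalized for the induction. -/
theorem steps_transfer (w : List (M.tm.Γ M.tm.k₁)) : ∀ (u : List S) (v : ∀ k, Option (Sym S T k)),
    ∃ v', Steps (TM2.step (compStmt M p)) (w.length + 1)
      (storeCfg M p (.inr none) v (haltList M.tm w).stk ⟨u, [], [], [], [], []⟩)
      (storeCfg M p (ctlLabel M.tm p [p]) v' (fun _ => [])
        ⟨(w.map M.outputAlphabet).reverse ++ u, [], [], [], [], []⟩) := by
  have hup : ∀ w : List (M.tm.Γ M.tm.k₁),
      update (haltList M.tm w).stk M.tm.k₁ w.tail = (haltList M.tm w.tail).stk := by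
    intro w
    funext j
    by_cases h : j = M.tm.k₁
    · subst h; rw [update_self, haltList_self]
    · rw [update_of_ne h, haltList_of_ne _ _ h, haltList_of_ne _ _ h]
  have hnil : (haltList M.tm []).stk = fun _ => [] := by
    funext j
    by_cases h : j = M.tm.k₁
    · subst h; rw [haltList_self]
    · rw [haltList_of_ne _ _ h]
  induction w with
  | nil =>
    intro u v
    refine ⟨update v .inp none, Steps.single (congrArg some ?_)⟩
    simp only [compStmt, TM2.stepAux, joinStk_inl, haltList_self, update_joinStk_inl, List.head?_nil,
      Option.map_none, update_self, Option.isSome_none, cond_false]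
    rw [hup, List.tail_nil, hnil]
    rfl
  | cons x w ih =>
    intro u v
    obtain ⟨v', h⟩ := ih (M.outputAlphabet x :: u) (update v .inp (some (M.outputAlphabet x)))
    refine ⟨v', ?_⟩
    rw [List.length_cons, add_comm]
    simp only [List.map_cons, List.reverse_cons, List.append_assoc, List.singleton_append]
    have h0 : TM2.step (compStmt M p) (storeCfg M p (.inr none) v (haltList M.tm (x :: w)).stk
        ⟨u, [], [], [], [], []⟩) = some (storeCfg M p (.inr none)
          (update v .inp (some (M.outputAlphabet x))) (haltList M.tm w).stk
          ⟨M.outputAlphabet x :: u, [], [], [], [], []⟩) := by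
      refine congrArg some ?_
      simp only [compStmt, TM2.stepAux, joinStk_inl, haltList_self, update_joinStk_inl,
        List.head?_cons, Option.map_some, update_self, Option.isSome_some, cond_true]
      rw [hup, update_joinStk_inr]
      rfl
    exact (Steps.single h0).trans h

/-- The machine that runs `M`, moves its output to the input stack of `p`, and runs `p`. -/
noncomputable def compMachine [Finite S] [Finite T] : FinTM2 :=
  haveI := M.tm.kFin
  haveI := M.tm.ΛFin
  haveI := M.tm.σFin
  haveI : Fintype (CompLabel M.tm p) :=
    haveI := ((finite_ctlReach p []).insert []).to_subtype
    Fintype.ofFinite _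
  haveI : Fintype (CompVar M.tm S T) := Fintype.ofFinite _
  haveI : Fintype (CompStack M.tm S T (.inl M.tm.k₀)) := M.tm.Γk₀Fin
  { K := M.tm.K ⊕ Stk
    k₀ := .inl M.tm.k₀
    k₁ := .inr .out
    Γ := CompStack M.tm S T
    Λ := CompLabel M.tm p
    main := .inl M.tm.main
    σ := CompVar M.tm S T
    initialState := (M.tm.initialState, fun _ => none)
    m := compStmt M p }

/-- Four phases are concatenated: the run of `M`, the transfer, the run of `p`, and a final reset.
The program has to clean up all stacks except its output, since a halting configuration has no other
nonempty stack. -/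
theorem steps_compMachine [Finite S] [Finite T] {u : List (M.tm.Γ M.tm.k₀)}
    {v : List (M.tm.Γ M.tm.k₁)} {o : List T} {m n : ℕ}
    (h₁ : Steps M.tm.step m (initList M.tm u) (haltList M.tm v))
    (h₂ : Exec p ⟨(v.map M.outputAlphabet).reverse, [], [], [], [], []⟩ n ⟨[], o, [], [], [], []⟩) :
    Steps (compMachine M p).step (m + (v.length + 1) + n + 1)
      (initList (compMachine M p) u) (haltList (compMachine M p) o) := by
  have h1 := Steps.map (liftCfg M.tm p) (step_liftCfg M p) h₁
  obtain ⟨v', h2⟩ := steps_transfer M p v [] fun _ => none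
  obtain ⟨v'', h3⟩ := steps_exec M p h₂ [] v' (fun _ => []) (Set.subset_insert _ _)
  have h4 := Steps.single (step_ctl M p (Set.mem_insert _ _) v'' (fun _ => []) ⟨[], o, [], [], [], []⟩)
  rw [List.append_nil] at h2
  have h := ((h1.trans h2).trans h3).trans h4
  have e1 : initList (compMachine M p) u = liftCfg M.tm p (initList M.tm u) := by
    refine congrArg (TM2.Cfg.mk _ _) ?_
    funext j
    rcases j with j | j
    · by_cases hj : j = M.tm.k₀
      · subst hj
        exact (initList_self (compMachine M p) u).trans (initList_self M.tm u).symm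
      · exact (initList_of_ne (compMachine M p) u fun e => hj (Sum.inl.inj e)).trans
          (initList_of_ne M.tm u hj).symm
    · refine (initList_of_ne (compMachine M p) u fun e => Sum.inr_ne_inl e).trans ?_
      cases j <;> rfl
  have e2 : haltList (compMachine M p) o =
      TM2.stepAux (ctlStmt M.tm p []) (M.tm.initialState, v'')
        (joinStk (fun _ => []) ⟨[], o, [], [], [], []⟩) := by
    refine congrArg (TM2.Cfg.mk _ _) ?_
    funext j
    rcases j with j | j
    · exact haltList_of_ne (compMachine M p) o fun e => Sum.inl_ne_inr e
    · by_cases hj : j = .out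
      · subst hj
        exact haltList_self (compMachine M p) o
      · refine (haltList_of_ne (compMachine M p) o fun e => hj (Sum.inr.inj e)).trans ?_
        cases j <;> first | rfl | exact absurd rfl hj
  rw [e1, e2]
  exact h

end Compile
end ParamASP

/-! ### Polynomial-time functions, computed on a stack of tree codes -/

namespace ParamASP

open Function

/-! ### Trees and their codes -/

/-- Binary trees, the universal data type of polynomial-time functions. -/
inductive DTree where
  | nil : DTree
  | cons (x y : DTree) : DTree
  deriving DecidableEq

namespace DTree

/-- The self-delimiting code of a tree. -/
def code : DTree → List Bool
  | nil => [false]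
  | cons x y => true :: (x.code ++ y.code)

/-- The length of the code of a tree. -/
def size : DTree → ℕ
  | nil => 1
  | cons x y => x.size + y.size + 1

@[simp] theorem length_code (x : DTree) : x.code.length = x.size := by
  induction x with
  | nil => rfl
  | cons x y hx hy => simp [code, size, hx, hy]

theorem size_pos (x : DTree) : 0 < x.size := by cases x <;> simp [size]

/-- The left subtree. -/
def hd : DTree → DTree
  | nil => nil
  | cons x _ => x

/-- The right subtree. -/
def tl : DTree → DTree
  | nil => nil
  | cons _ y => y

/-- The code is prefix-free: the first bit tells whether two further codes follow. Hence several
trees can lie on one stack without separators, and a tree can be recognised while it is read bit by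
bit. -/
theorem code_append_injective : ∀ {x y : DTree} {r s : List Bool},
    x.code ++ r = y.code ++ s → x = y ∧ r = s
  | nil, nil, r, s, h => by simpa [code] using h
  | nil, cons _ _, r, s, h => by simp [code] at h
  | cons _ _, nil, r, s, h => by simp [code] at h
  | cons x x', cons y y', r, s, h => by
    simp only [code, List.cons_append, List.append_assoc, List.cons.injEq, true_and] at h
    obtain ⟨h₁, h⟩ := code_append_injective h
    obtain ⟨h₂, h⟩ := code_append_injective h
    exact ⟨by rw [h₁, h₂], h⟩

theorem code_injective : Injective code := fun x y h =>
  (code_append_injective (r := []) (s := []) (by rw [h])).1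

/-- Booleans as trees. -/
def ofBool : Bool → DTree
  | false => nil
  | true => cons nil nil

end DTree

/-! ### Bounded executions -/

variable {S T : Type}

/-- The program `p` leads from `s` to `s'` in at most `n` steps. -/
def Within (p : Prog S T) (s : Store S T) (n : ℕ) (s' : Store S T) : Prop :=
  ∃ m ≤ n, Exec p s m s'

namespace Within
variable {p q : Prog S T} {s s' s'' : Store S T} {m n : ℕ}

theorem mono (h : Within p s m s') (hmn : m ≤ n) : Within p s n s' :=
  let ⟨k, hk, e⟩ := h
  ⟨k, hk.trans hmn, e⟩

theorem skip : Within .skip s 1 s := ⟨1, le_rfl, .skip⟩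

theorem push (k : Stk) (x : Sym S T k) : Within (.push k x) s 1 (s.set k (x :: s.get k)) :=
  ⟨1, le_rfl, .push⟩

theorem pop {k : Stk} {f : Option (Sym S T k) → Prog S T}
    (h : Within (f (s.get k).head?) (s.set k (s.get k).tail) n s') :
    Within (.pop k f) s (n + 1) s' :=
  let ⟨_, hk, e⟩ := h
  ⟨_, Nat.succ_le_succ hk, .pop e⟩

theorem seq (h₁ : Within p s m s') (h₂ : Within q s' n s'') :
    Within (.seq p q) s (m + n + 1) s'' :=
  let ⟨_, h, e⟩ := h₁
  let ⟨_, h', e'⟩ := h₂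
  ⟨_, Nat.succ_le_succ (Nat.add_le_add h h'), .seq e e'⟩

theorem loop_nil {k : Stk} {f : Sym S T k → Prog S T} (h : s.get k = []) :
    Within (.loop k f) s 1 s := ⟨1, le_rfl, .loop_nil h⟩

theorem loop_cons {k : Stk} {f : Sym S T k → Prog S T} {x l} (h : s.get k = x :: l)
    (h₁ : Within (f x) (s.set k l) m s') (h₂ : Within (.loop k f) s' n s'') :
    Within (.loop k f) s (m + n + 1) s'' :=
  let ⟨_, h', e⟩ := h₁
  let ⟨_, h'', e'⟩ := h₂
  ⟨_, Nat.succ_le_succ (Nat.add_le_add h' h''), .loop_cons h e e'⟩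

end Within

/-! ### Programs on the data stack -/

/-- Move as many trees from the data stack to the stack `k` as there are symbols on `c`. -/
def takeLoop (k : Stk) (e : Bool → Sym S T k) : Prog S T :=
  .loop .c fun _ => .pop .d fun
    | none => .skip
    | some true => .seq (.push k (e true)) (.seq (.push .c true) (.push .c true))
    | some false => .push k (e false)

/-- Move the top tree of the data stack to the stack `a`, in reverse. -/
def takeA : Prog S T := .seq (.push .c true) (takeLoop .a id)

/-- Move the top tree of the data stack to the stack `b`, in reverse. -/
def takeB : Prog S T := .seq (.push .c true) (takeLoop .b id)

/-- The stack `c` counts the trees that are still to be read: a bit `true` replaces one pending tree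
by its two children, a bit `false` completes one. The number of pending trees may grow, so the
induction is on the total length of their codes. -/
theorem takeLoop_a (i : List S) (o : List T) (r b : List Bool) : ∀ (n : ℕ) (ts : List DTree)
    (a : List Bool), (ts.flatMap DTree.code).length = n →
    Within (takeLoop .a id) ⟨i, o, ts.flatMap DTree.code ++ r, a, b, ts.map fun _ => true⟩
      (8 * n + 1) ⟨i, o, r, (ts.flatMap DTree.code).reverse ++ a, b, []⟩ := by
  intro n
  induction n using Nat.strong_induction_on with
  | _ n ih =>
    intro ts a hn
    match ts with
    | [] => exact (Within.loop_nil rfl).mono (by omega)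
    | .nil :: ts =>
      have := ih (n - 1) (by simp [DTree.size] at hn; omega) ts (false :: a)
        (by simp [DTree.size] at hn ⊢; omega)
      refine (Within.loop_cons (m := 2) rfl (Within.pop (Within.push _ _)) ?_).mono
        (n := 8 * n + 1) (m := 2 + (8 * (n - 1) + 1) + 1) (by simp [DTree.size] at hn; omega)
      change Within (takeLoop .a id) _ _ _
      simpa [DTree.code] using this
    | .cons x y :: ts =>
      have := ih (n - 1) (by simp [DTree.size] at hn; omega) (x :: y :: ts) (true :: a)
        (by simp [DTree.size] at hn ⊢; omega)
      refine (Within.loop_cons (m := 6) rfl (Within.pop (Within.seq (Within.push _ _)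
        (Within.seq (Within.push _ _) (Within.push _ _)))) ?_).mono
        (n := 8 * n + 1) (m := 6 + (8 * (n - 1) + 1) + 1) (by simp [DTree.size] at hn; omega)
      change Within (takeLoop .a id) _ _ _
      simpa [DTree.code] using this

theorem takeLoop_b (i : List S) (o : List T) (r a : List Bool) : ∀ (n : ℕ) (ts : List DTree)
    (b : List Bool), (ts.flatMap DTree.code).length = n →
    Within (takeLoop .b id) ⟨i, o, ts.flatMap DTree.code ++ r, a, b, ts.map fun _ => true⟩
      (8 * n + 1) ⟨i, o, r, a, (ts.flatMap DTree.code).reverse ++ b, []⟩ := by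
  intro n
  induction n using Nat.strong_induction_on with
  | _ n ih =>
    intro ts b hn
    match ts with
    | [] => exact (Within.loop_nil rfl).mono (by omega)
    | .nil :: ts =>
      have := ih (n - 1) (by simp [DTree.size] at hn; omega) ts (false :: b)
        (by simp [DTree.size] at hn ⊢; omega)
      refine (Within.loop_cons (m := 2) rfl (Within.pop (Within.push _ _)) ?_).mono
        (n := 8 * n + 1) (m := 2 + (8 * (n - 1) + 1) + 1) (by simp [DTree.size] at hn; omega)
      change Within (takeLoop .b id) _ _ _
      simpa [DTree.code] using this
    | .cons x y :: ts =>
      have := ih (n - 1) (by simp [DTree.size] at hn; omega) (x :: y :: ts) (true :: b)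
        (by simp [DTree.size] at hn ⊢; omega)
      refine (Within.loop_cons (m := 6) rfl (Within.pop (Within.seq (Within.push _ _)
        (Within.seq (Within.push _ _) (Within.push _ _)))) ?_).mono
        (n := 8 * n + 1) (m := 6 + (8 * (n - 1) + 1) + 1) (by simp [DTree.size] at hn; omega)
      change Within (takeLoop .b id) _ _ _
      simpa [DTree.code] using this

theorem within_takeA (i : List S) (o : List T) (x : DTree) (r a b : List Bool) :
    Within takeA ⟨i, o, x.code ++ r, a, b, []⟩ (8 * x.size + 3)
      ⟨i, o, r, x.code.reverse ++ a, b, []⟩ := by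
  have := takeLoop_a i o r b x.size [x] a (by simp)
  simp only [List.flatMap_cons, List.flatMap_nil, List.append_nil] at this
  exact ((Within.push _ _).seq this).mono (by omega)

theorem within_takeB (i : List S) (o : List T) (x : DTree) (r a b : List Bool) :
    Within takeB ⟨i, o, x.code ++ r, a, b, []⟩ (8 * x.size + 3)
      ⟨i, o, r, a, x.code.reverse ++ b, []⟩ := by
  have := takeLoop_b i o r a x.size [x] b (by simp)
  simp only [List.flatMap_cons, List.flatMap_nil, List.append_nil] at this
  exact ((Within.push _ _).seq this).mono (by omega)

theorem within_moveAD (i : List S) (o : List T) (a : List Bool) : ∀ (d b c : List Bool),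
    Within (.loop .a fun x => .push .d x) ⟨i, o, d, a, b, c⟩ (2 * a.length + 1)
      ⟨i, o, a.reverse ++ d, [], b, c⟩ := by
  induction a with
  | nil => exact fun d b c => Within.loop_nil rfl
  | cons x a ih =>
    intro d b c
    refine Within.mono (m := 1 + (2 * a.length + 1) + 1)
      (Within.loop_cons rfl (Within.push _ _) ?_) (by simp; omega)
    simpa using ih (x :: d) b c

theorem within_moveBD (i : List S) (o : List T) (b : List Bool) : ∀ (d a c : List Bool),
    Within (.loop .b fun x => .push .d x) ⟨i, o, d, a, b, c⟩ (2 * b.length + 1)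
      ⟨i, o, b.reverse ++ d, a, [], c⟩ := by
  induction b with
  | nil => exact fun d b c => Within.loop_nil rfl
  | cons x b ih =>
    intro d a c
    refine Within.mono (m := 1 + (2 * b.length + 1) + 1)
      (Within.loop_cons rfl (Within.push _ _) ?_) (by simp; omega)
    simpa using ih (x :: d) a c

theorem within_moveBA (i : List S) (o : List T) (b : List Bool) : ∀ (d a c : List Bool),
    Within (.loop .b fun x => .push .a x) ⟨i, o, d, a, b, c⟩ (2 * b.length + 1)
      ⟨i, o, d, b.reverse ++ a, [], c⟩ := by
  induction b with
  | nil => exact fun d b c => Within.loop_nil rfl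
  | cons x b ih =>
    intro d a c
    refine Within.mono (m := 1 + (2 * b.length + 1) + 1)
      (Within.loop_cons rfl (Within.push _ _) ?_) (by simp; omega)
    simpa using ih d (x :: a) c

theorem within_moveADB (i : List S) (o : List T) (a : List Bool) : ∀ (d b c : List Bool),
    Within (.loop .a fun x => .seq (.push .d x) (.push .b x)) ⟨i, o, d, a, b, c⟩
      (4 * a.length + 1) ⟨i, o, a.reverse ++ d, [], a.reverse ++ b, c⟩ := by
  induction a with
  | nil => exact fun d b c => Within.loop_nil rfl
  | cons x a ih =>
    intro d b c
    refine (Within.loop_cons rfl (Within.seq (Within.push _ _) (Within.push _ _))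
      (s'' := ⟨i, o, (x :: a).reverse ++ d, [], (x :: a).reverse ++ b, c⟩)
      (n := 4 * a.length + 1) ?_).mono (by simp; omega)
    simpa using ih (x :: d) (x :: b) c

theorem within_clearA (i : List S) (o : List T) (a : List Bool) : ∀ (d b c : List Bool),
    Within (.loop .a fun _ => .skip) ⟨i, o, d, a, b, c⟩ (2 * a.length + 1)
      ⟨i, o, d, [], b, c⟩ := by
  induction a with
  | nil => exact fun d b c => Within.loop_nil rfl
  | cons x a ih =>
    intro d b c
    exact (Within.loop_cons rfl Within.skip (ih d b c)).mono (by simp; omega)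

theorem within_clearC (i : List S) (o : List T) (c : List Bool) : ∀ (d a b : List Bool),
    Within (.loop .c fun _ => .skip) ⟨i, o, d, a, b, c⟩ (2 * c.length + 1)
      ⟨i, o, d, a, b, []⟩ := by
  induction c with
  | nil => exact fun d b c => Within.loop_nil rfl
  | cons x c ih =>
    intro d a b
    exact (Within.loop_cons rfl Within.skip (ih d a b)).mono (by simp; omega)

theorem within_markB (i : List S) (o : List T) (b : List Bool) : ∀ (d a c : List Bool),
    Within (.loop .b fun _ => .push .c true) ⟨i, o, d, a, b, c⟩ (2 * b.length + 1)
      ⟨i, o, d, a, [], List.replicate b.length true ++ c⟩ := by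
  induction b with
  | nil => exact fun d b c => Within.loop_nil rfl
  | cons x b ih =>
    intro d a c
    refine Within.mono (m := 1 + (2 * b.length + 1) + 1)
      (Within.loop_cons rfl (Within.push _ _) ?_) (by simp; omega)
    simpa [List.replicate_succ'] using ih d a (true :: c)

/-- Duplicate the top tree of the data stack. -/
def dup : Prog S T :=
  .seq takeA (.seq (.loop .a fun x => .seq (.push .d x) (.push .b x))
    (.seq (.loop .b fun x => .push .a x) (.loop .a fun x => .push .d x)))

theorem within_dup (i : List S) (o : List T) (x : DTree) (r : List Bool) :
    Within dup ⟨i, o, x.code ++ r, [], [], []⟩ (16 * x.size + 9)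
      ⟨i, o, x.code ++ (x.code ++ r), [], [], []⟩ := by
  have h1 := within_takeA i o x r [] []
  have h2 := within_moveADB i o (x.code.reverse ++ []) r [] []
  have h3 := within_moveBA i o ((x.code.reverse ++ []).reverse ++ [])
    ((x.code.reverse ++ []).reverse ++ r) [] []
  have h4 := within_moveAD i o (((x.code.reverse ++ []).reverse ++ []).reverse ++ [])
    ((x.code.reverse ++ []).reverse ++ r) [] []
  have := h1.seq (h2.seq (h3.seq h4))
  simp only [List.append_nil, List.reverse_reverse, List.length_reverse, DTree.length_code] at this
  exact this.mono (by omega)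

/-- Exchange the two top trees of the data stack. -/
def swap : Prog S T :=
  .seq takeA (.seq takeB (.seq (.loop .a fun x => .push .d x) (.loop .b fun x => .push .d x)))

theorem within_swap (i : List S) (o : List T) (x y : DTree) (r : List Bool) :
    Within swap ⟨i, o, x.code ++ (y.code ++ r), [], [], []⟩ (10 * (x.size + y.size) + 11)
      ⟨i, o, y.code ++ (x.code ++ r), [], [], []⟩ := by
  have h1 := within_takeA i o x (y.code ++ r) [] []
  have h2 := within_takeB i o y r (x.code.reverse ++ []) []
  have h3 := within_moveAD i o (x.code.reverse ++ []) r (y.code.reverse ++ []) []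
  have h4 := within_moveBD i o (y.code.reverse ++ []) ((x.code.reverse ++ []).reverse ++ r) [] []
  have := h1.seq (h2.seq (h3.seq h4))
  simp only [List.append_nil, List.reverse_reverse, List.length_reverse, DTree.length_code] at this
  exact this.mono (by omega)

/-- Remove the top tree of the data stack. -/
def drop : Prog S T := .seq takeA (.loop .a fun _ => .skip)

theorem within_drop (i : List S) (o : List T) (x : DTree) (r : List Bool) :
    Within drop ⟨i, o, x.code ++ r, [], [], []⟩ (10 * x.size + 5) ⟨i, o, r, [], [], []⟩ := by
  have h1 := within_takeA i o x r [] []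
  have h2 := within_clearA i o (x.code.reverse ++ []) r [] []
  have := h1.seq h2
  simp only [List.append_nil, List.length_reverse, DTree.length_code] at this
  exact this.mono (by omega)

/-- Compare the stack `a` with the stack `b`; differences are recorded on the stack `c`. -/
def compareAB : Prog S T :=
  .seq (.loop .a fun x => .pop .b fun y => if y = some x then .skip else .push .c true)
    (.loop .b fun _ => .push .c true)

/-- Two words differ iff some position disagrees, or one is exhausted first. Each disagreement,
including a missing symbol of `b`, leaves a mark on `c`, and so does each symbol of `b` that is left
over. -/
theorem within_compareAB (i : List S) (o : List T) (a : List Bool) : ∀ (d b c : List Bool),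
    ∃ c', (c' = [] ↔ c = [] ∧ a = b) ∧ c'.length ≤ c.length + a.length + b.length ∧
      Within compareAB ⟨i, o, d, a, b, c⟩ (4 * (a.length + b.length) + 3)
        ⟨i, o, d, [], [], c'⟩ := by
  suffices h : ∀ (d b c : List Bool), ∃ b' c', ((c' = [] ∧ b' = []) ↔ c = [] ∧ a = b) ∧
      c'.length + b'.length ≤ c.length + a.length + b.length ∧ b'.length ≤ b.length ∧
      Within (.loop .a fun x => .pop .b fun y => if y = some x then .skip else .push .c true)
        ⟨i, o, d, a, b, c⟩ (3 * a.length + 1) ⟨i, o, d, [], b', c'⟩ by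
    intro d b c
    obtain ⟨b', c', h1, h2, h3, h4⟩ := h d b c
    refine ⟨List.replicate b'.length true ++ c', ?_, by simp; omega, ?_⟩
    · rw [← h1]; simp [and_comm]
    · exact (h4.seq (within_markB i o b' d [] c')).mono (by omega)
  induction a with
  | nil =>
    exact fun d b c => ⟨b, c, by simp [eq_comm], by simp, le_rfl, Within.loop_nil rfl⟩
  | cons x a ih =>
    intro d b c
    match b with
    | [] =>
      obtain ⟨b', c', h1, h2, h3, h4⟩ := ih d [] (true :: c)
      refine ⟨b', c', by rw [h1]; simp, by simp at h2 ⊢; omega, h3, ?_⟩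
      exact (Within.loop_cons rfl (Within.pop (Within.push _ _)) h4).mono (by simp; omega)
    | y :: b =>
      by_cases hxy : y = x
      · subst hxy
        obtain ⟨b', c', h1, h2, h3, h4⟩ := ih d b c
        refine ⟨b', c', by rw [h1]; simp, by simp at h2 ⊢; omega, by simp; omega, ?_⟩
        refine (Within.loop_cons rfl (Within.pop (n := 1) ?_) h4).mono (by simp; omega)
        simpa using Within.skip
      · obtain ⟨b', c', h1, h2, h3, h4⟩ := ih d b (true :: c)
        refine ⟨b', c', by rw [h1]; simp [Ne.symm hxy], by simp at h2 ⊢; omega,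
          by simp; omega, ?_⟩
        refine (Within.loop_cons rfl (Within.pop (n := 1) ?_) h4).mono (by simp; omega)
        simpa [hxy] using Within.push _ _

/-- Replace the two top trees of the data stack by the truth value of their equality. -/
def eqProg : Prog S T :=
  .seq takeA (.seq takeB (.seq compareAB (.pop .c fun
    | none => .seq (.push .d false) (.seq (.push .d false) (.push .d true))
    | some _ => .seq (.loop .c fun _ => .skip) (.push .d false))))

theorem within_eqProg (i : List S) (o : List T) (x y : DTree) (r : List Bool) :
    Within eqProg ⟨i, o, x.code ++ (y.code ++ r), [], [], []⟩ (14 * (x.size + y.size) + 20)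
      ⟨i, o, (DTree.ofBool (decide (x = y))).code ++ r, [], [], []⟩ := by
  have h1 := within_takeA i o x (y.code ++ r) [] []
  have h2 := within_takeB i o y r (x.code.reverse ++ []) []
  obtain ⟨c', h3, h4, h5⟩ := within_compareAB i o (x.code.reverse ++ []) r (y.code.reverse ++ []) []
  simp only [List.append_nil, List.length_reverse, DTree.length_code, List.length_nil,
    List.reverse_inj, true_and, DTree.code_injective.eq_iff] at h1 h2 h3 h4 h5
  refine (h1.seq (h2.seq (h5.seq (Within.pop
    (n := 2 * (x.size + y.size) + 5) ?_)))).mono (by omega)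
  match c' with
  | [] =>
    rw [decide_eq_true (h3.1 rfl)]
    exact ((Within.push _ _).seq ((Within.push _ _).seq (Within.push _ _))).mono (by omega)
  | z :: c' =>
    rw [decide_eq_false (fun h => by simpa using h3.2 h)]
    exact ((within_clearC i o c' r [] []).seq (Within.push _ _)).mono (by simp at h4; omega)

/-! ### Polynomial-time functions on represented types -/

theorem eval_mono (q : Polynomial ℕ) {m n : ℕ} (h : m ≤ n) : q.eval m ≤ q.eval n := by
  induction q using Polynomial.induction_on' with
  | add p q hp hq => simp only [Polynomial.eval_add]; exact Nat.add_le_add hp hq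
  | monomial k a =>
    simp only [Polynomial.eval_monomial]
    exact Nat.mul_le_mul_left _ (Nat.pow_le_pow_left h _)

/-- A representation of a type by trees. -/
class TreeRep (α : Type) where
  /-- the tree that represents an element -/
  toTree : α → DTree
  /-- different elements are represented by different trees -/
  inj : Injective toTree

open TreeRep

instance : TreeRep DTree := ⟨id, injective_id⟩

instance {α : Type} [TreeRep α] {p : α → Prop} : TreeRep {x // p x} :=
  ⟨fun x => toTree x.1, fun _ _ h => Subtype.ext (inj h)⟩

/-- The code of an element. -/
def code {α : Type} [TreeRep α] (x : α) : List Bool := (toTree x).code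

/-- The length of the code of an element. -/
def size {α : Type} [TreeRep α] (x : α) : ℕ := (toTree x).size

/-- The program `p` computes the function `f` within time `q`, on the data stack. -/
def Computes {α β : Type} [TreeRep α] [TreeRep β] (p : Prog S T) (f : α → β) (q : Polynomial ℕ) :
    Prop :=
  ∀ (x : α) (r : List Bool) (i : List S) (o : List T),
    Within p ⟨i, o, code x ++ r, [], [], []⟩ (q.eval (size x)) ⟨i, o, code (f x) ++ r, [], [], []⟩

/-- The function `f` is computable in polynomial time. -/
@[fun_prop]
def PolyFun {α β : Type} [TreeRep α] [TreeRep β] (f : α → β) : Prop :=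
  -- One polynomial bounds the output size and the time. It does not depend on the alphabets of the
  -- input and output stacks, on which these programs do not act; so the function can later be used
  -- with any alphabets.
  ∃ q : Polynomial ℕ, (∀ x, size (f x) ≤ q.eval (size x)) ∧
    ∀ S T : Type, ∃ p : Prog S T, Computes p f q

namespace PolyFun
open DTree Polynomial

variable {α β γ δ : Type} [TreeRep α] [TreeRep β] [TreeRep γ] [TreeRep δ]

/-- Programs only see trees. Hence constructors and projections of a represented type cost nothing
beyond the corresponding operations on trees. -/
theorem congr_rep {f : α → β} {g : α → γ} (hf : PolyFun f) (h : ∀ x, toTree (f x) = toTree (g x)) :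
    PolyFun g := by
  obtain ⟨q, hq, hp⟩ := hf
  refine ⟨q, fun x => ?_, fun S T => ?_⟩
  · rw [size, ← h]; exact hq x
  · obtain ⟨p, hp⟩ := hp S T
    refine ⟨p, fun x r i o => ?_⟩
    rw [code, code, ← h]
    exact hp x r i o

/-- The intermediate value matters only through its tree. This is needed when `f'` is defined by
means of a proof, such as the head of a list known to be nonempty, while `f` is a plain function
into trees. -/
theorem comp_rep {f : α → β} {f' : α → γ} {g : γ → δ} (hg : PolyFun g) (hf : PolyFun f)
    (h : ∀ x, toTree (f x) = toTree (f' x)) : PolyFun fun x => g (f' x) := by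
  have hf := hf.congr_rep h
  obtain ⟨qg, hg, hg'⟩ := hg
  obtain ⟨qf, hf, hf'⟩ := hf
  refine ⟨qf + qg.comp qf + 1, fun x => ?_, fun S T => ?_⟩
  · have := (hg (f' x)).trans (eval_mono qg (hf x))
    simp only [eval_add, eval_comp, eval_one]; omega
  · obtain ⟨pg, hpg⟩ := hg' S T
    obtain ⟨pf, hpf⟩ := hf' S T
    refine ⟨.seq pf pg, fun x r i o => ((hpf x r i o).seq (hpg (f' x) r i o)).mono ?_⟩
    have := eval_mono qg (hf x)
    simp only [eval_add, eval_comp, eval_one]; omega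

@[fun_prop]
theorem comp (g : β → γ) (f : α → β) (hg : PolyFun g) (hf : PolyFun f) :
    PolyFun fun x => g (f x) :=
  comp_rep hg hf fun _ => rfl

@[fun_prop]
theorem id : PolyFun fun x : α => x :=
  ⟨X + 1, fun x => by simp, fun _ _ => ⟨.skip, fun _ _ _ _ => Within.skip.mono (by simp)⟩⟩

theorem tree : PolyFun fun x : α => toTree x := id.congr_rep fun _ => rfl

theorem const_nil : PolyFun fun _ : α => nil := by
  refine ⟨10 * X + 8, fun x => by simp [size, toTree, DTree.size],
    fun _ _ => ⟨.seq drop (.push .d false), ?_⟩⟩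
  exact fun x r i o => ((within_drop i o (toTree x) r).seq (Within.push _ _)).mono
    (by simp [size]; omega)

/-- Compute two functions, and continue with a program for the two results. -/
theorem binary {f : α → β} {g : α → γ} (hf : PolyFun f) (hg : PolyFun g) {h : β → γ → δ} {c : ℕ}
    (hh : ∀ x y, size (h x y) ≤ c * (size x + size y + 1))
    (hp : ∀ S T : Type, ∃ p : Prog S T, ∀ (x : β) (y : γ) (r : List Bool) (i : List S) (o : List T),
      Within p ⟨i, o, code x ++ (code y ++ r), [], [], []⟩ (c * (size x + size y + 1))
        ⟨i, o, code (h x y) ++ r, [], [], []⟩) :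
    PolyFun fun x => h (f x) (g x) := by
  obtain ⟨qg, hg, hg'⟩ := hg
  obtain ⟨qf, hf, hf'⟩ := hf
  refine ⟨(16 * X + 9) + qg + (10 * (X + qg) + 11) + qf + C c * (qf + qg + 1) + 4,
    fun x => ?_, fun S T => ?_⟩
  · have := (hh (f x) (g x)).trans (Nat.mul_le_mul_left c
      (Nat.add_le_add_right (Nat.add_le_add (hf x) (hg x)) 1))
    simp; omega
  · obtain ⟨pg, hpg⟩ := hg' S T
    obtain ⟨pf, hpf⟩ := hf' S T
    obtain ⟨p, hp⟩ := hp S T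
    refine ⟨.seq dup (.seq pg (.seq swap (.seq pf p))), fun x r i o => ?_⟩
    refine ((within_dup i o (toTree x) r).seq ((hpg x (code x ++ r) i o).seq
      ((within_swap i o (toTree (g x)) (toTree x) r).seq ((hpf x (code (g x) ++ r) i o).seq
        (hp (f x) (g x) r i o))))).mono ?_
    have h1 := Nat.mul_le_mul_left c
      (Nat.add_le_add_right (Nat.add_le_add (hf x) (hg x)) 1)
    have := hg x
    simp [size] at *
    omega

theorem cons_tree {f : α → β} {g : α → γ} (hf : PolyFun f) (hg : PolyFun g) :
    PolyFun fun x => cons (toTree (f x)) (toTree (g x)) := by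
  refine binary (h := fun x y => cons (toTree x) (toTree y)) (c := 1) hf hg
    (fun x y => by simp [size, toTree, DTree.size]) fun S T => ⟨.push .d true, ?_⟩
  intro x y r i o
  refine Within.mono (m := 1) ?_ (by omega)
  simpa [code, toTree, DTree.code] using
    Within.push (s := ⟨i, o, code x ++ (code y ++ r), [], [], []⟩) .d true

theorem eq_tree {f : α → β} {g : α → γ} (hf : PolyFun f) (hg : PolyFun g) :
    PolyFun fun x => ofBool (decide (toTree (f x) = toTree (g x))) := by
  refine binary (c := 20) (h := fun x y => ofBool (decide (toTree x = toTree y))) hf hg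
    (fun x y => ?_) fun S T => ⟨eqProg, fun x y r i o => (within_eqProg i o _ _ r).mono ?_⟩
  · by_cases h : toTree x = toTree y <;> simp [h, ofBool, size, toTree, DTree.size] <;> omega
  · simp [size]; omega

theorem hd : PolyFun hd := by
  refine ⟨20 * X + 20, fun x => ?_, fun S T => ⟨.pop .d fun
    | some true => .seq swap drop
    | _ => .push .d false, fun x r i o => ?_⟩⟩
  · cases x <;> simp [DTree.hd, size, toTree, DTree.size] ; omega
  · cases x with
    | nil => exact (Within.pop (Within.push _ _)).mono (by simp)
    | cons x y =>
      refine (Within.pop (n := 20 * x.size + 20 * y.size + 17) ?_).mono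
        (by simp [size, toTree, DTree.size]; omega)
      have := (within_swap i o x y r).seq (within_drop i o y (x.code ++ r))
      simpa [code, toTree, DTree.code, DTree.hd] using this.mono (by omega)

theorem tl : PolyFun tl := by
  refine ⟨20 * X + 20, fun x => ?_, fun S T => ⟨.pop .d fun
    | some true => drop
    | _ => .push .d false, fun x r i o => ?_⟩⟩
  · cases x <;> simp [DTree.tl, size, toTree, DTree.size] ; omega
  · cases x with
    | nil => exact (Within.pop (Within.push _ _)).mono (by simp)
    | cons x y =>
      refine (Within.pop (n := 20 * x.size + 20 * y.size + 17) ?_).mono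
        (by simp [size, toTree, DTree.size]; omega)
      simpa [code, toTree, DTree.code, DTree.tl] using
        (within_drop i o x (y.code ++ r)).mono (by omega)

/-- Remove the top tree of the data stack and continue depending on whether it was `nil`. -/
theorem exists_branch (p q : Prog S T) : ∃ b : Prog S T, ∀ (c : DTree) (r : List Bool) (i : List S)
    (o : List T) (n : ℕ) (s' : Store S T),
    Within (if c = nil then q else p) ⟨i, o, r, [], [], []⟩ n s' →
      Within b ⟨i, o, c.code ++ r, [], [], []⟩ (10 * c.size + n + 9) s' := by
  refine ⟨.pop .d fun
    | some true => .seq (.push .d true) (.seq drop p)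
    | _ => q, fun c r i o n s' h => ?_⟩
  cases c with
  | nil =>
    rw [if_pos rfl] at h
    exact (Within.pop h).mono (by omega)
  | cons x y =>
    rw [if_neg (by simp)] at h
    refine (Within.pop (n := 1 + (10 * (DTree.cons x y).size + 5 + n + 1) + 1) ?_).mono (by omega)
    exact (Within.push _ _).seq ((within_drop i o (.cons x y) r).seq h)

/-- Each branch has to be computable only where it is taken, which allows partial operations in the
branches. The argument is duplicated first, because the evaluation of the condition consumes it. -/
theorem dite_tree {c : α → DTree} {f : {x // c x ≠ nil} → β} {g : {x // c x = nil} → β}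
    (hc : PolyFun c) (hf : PolyFun f) (hg : PolyFun g) :
    PolyFun fun x => if h : c x = nil then g ⟨x, h⟩ else f ⟨x, h⟩ := by
  obtain ⟨qg, hg, hg'⟩ := hg
  obtain ⟨qf, hf, hf'⟩ := hf
  obtain ⟨qc, hc, hc'⟩ := hc
  refine ⟨(16 * X + 9) + qc + (10 * qc + qf + qg + 9) + 2, fun x => ?_, fun S T => ?_⟩
  · by_cases h : c x = nil
    · have := hg ⟨x, h⟩
      simp [h, size, toTree] at this ⊢; omega
    · have := hf ⟨x, h⟩
      simp [h, size, toTree] at this ⊢; omega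
  · obtain ⟨pg, hpg⟩ := hg' S T
    obtain ⟨pf, hpf⟩ := hf' S T
    obtain ⟨pc, hpc⟩ := hc' S T
    obtain ⟨b, hb⟩ := exists_branch pf pg
    refine ⟨.seq dup (.seq pc b), fun x r i o => ?_⟩
    have := hc x
    refine ((within_dup i o (toTree x) r).seq ((hpc x _ i o).seq
      (hb (c x) _ i o (qf.eval (size x) + qg.eval (size x)) _ ?_))).mono ?_
    · by_cases h : c x = nil
      · rw [if_pos h]; simp only [dif_pos h]
        exact Within.mono (hpg ⟨x, h⟩ r i o) (by simp [size, toTree])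
      · rw [if_neg h]; simp only [dif_neg h]
        exact Within.mono (hpf ⟨x, h⟩ r i o) (by simp [size, toTree])
    · simp [size, toTree] at *; omega

theorem val {p : α → Prop} : PolyFun fun x : {x // p x} => x.1 := id.congr_rep fun _ => rfl

theorem ite_tree {c : α → DTree} {f g : α → β} (hc : PolyFun c) (hf : PolyFun f) (hg : PolyFun g) :
    PolyFun fun x => if c x = nil then g x else f x := by
  simpa using dite_tree hc (hf.comp _ _ val) (hg.comp _ _ val)

/-- A while loop with condition `c`. Iterating a polynomial-time function can increase the size
exponentially, so polynomial bounds for the number of rounds and for all intermediate sizes are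
hypotheses. -/
theorem iterate {c : β → DTree} {f : β → β} {g : α → β} (hc : PolyFun c) (hf : PolyFun f)
    (hg : PolyFun g) (N : α → ℕ) (q : Polynomial ℕ) (hN : ∀ x, N x ≤ q.eval (size x))
    (hq : ∀ x, ∀ n ≤ N x, size (f^[n] (g x)) ≤ q.eval (size x))
    (hlt : ∀ x, ∀ n < N x, c (f^[n] (g x)) ≠ nil) (heq : ∀ x, c (f^[N x] (g x)) = nil) :
    PolyFun fun x => f^[N x] (g x) := by
  obtain ⟨qf, hf, hf'⟩ := hf
  obtain ⟨qc, hc, hc'⟩ := hc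
  obtain ⟨qg, hg, hg'⟩ := hg
  -- The cost of one round: duplicate the state, evaluate the condition, branch, and apply `f`.
  let t := (16 * q + 9) + qc.comp q + (10 * qc.comp q + (qf.comp q + 2) + 9) + 2
  refine ⟨qg + ((q + 1) * (t + 1) + q + 3) + 1, fun x => ?_, fun S T => ?_⟩
  · have := hq x _ le_rfl
    rw [eval_add, eval_add, eval_add, eval_add]
    exact this.trans (by omega)
  · obtain ⟨pf, hpf⟩ := hf' S T
    obtain ⟨pc, hpc⟩ := hc' S T
    obtain ⟨pg, hpg⟩ := hg' S T
    -- The loop on `c` consumes one mark per round, and the body puts a new mark there iff the loop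
    -- is to continue.
    obtain ⟨b, hb⟩ := exists_branch (.seq pf (.push .c true)) (.skip : Prog S T)
    let body : Prog S T := .seq dup (.seq pc b)
    refine ⟨.seq pg (.seq (.push .c true) (.loop .c fun _ => body)), fun x r i o => ?_⟩
    have hbody : ∀ n ≤ N x, Within body ⟨i, o, code (f^[n] (g x)) ++ r, [], [], []⟩
        (t.eval (size x))
        (if n = N x then ⟨i, o, code (f^[N x] (g x)) ++ r, [], [], []⟩
          else ⟨i, o, code (f^[n + 1] (g x)) ++ r, [], [], [true]⟩) := by
      intro n hn
      have h1 := hq x n hn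
      have h2 := (hc (f^[n] (g x))).trans (eval_mono qc h1)
      have h3 := eval_mono qf h1
      have h4 := eval_mono qc h1
      refine ((within_dup i o _ r).seq ((hpc _ _ i o).seq
        (hb (c (f^[n] (g x))) _ i o (qf.eval (q.eval (size x)) + 2) _ ?_))).mono ?_
      · by_cases h : n = N x
        · subst h
          rw [if_pos rfl, if_pos (heq x)]
          exact Within.skip.mono (by omega)
        · rw [if_neg h, if_neg (hlt x n (lt_of_le_of_ne hn h)), iterate_succ_apply']
          exact ((hpf _ r i o).seq (Within.push .c true)).mono (by omega)
      · simp [t, size, toTree] at *; omega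
    have hloop : ∀ m n, n + m = N x → Within (.loop .c fun _ => body)
        ⟨i, o, code (f^[n] (g x)) ++ r, [], [], [true]⟩ ((m + 1) * (t.eval (size x) + 1) + 1)
        ⟨i, o, code (f^[N x] (g x)) ++ r, [], [], []⟩ := by
      intro m
      induction m with
      | zero =>
        intro n hn
        obtain rfl : n = N x := hn
        have := hbody (N x) le_rfl
        rw [if_pos rfl] at this
        exact (Within.loop_cons rfl this (Within.loop_nil rfl)).mono (by omega)
      | succ m ih =>
        intro n hn
        have := hbody n (by omega)
        rw [if_neg (by omega)] at this
        refine (Within.loop_cons rfl this (ih (n + 1) (by omega))).mono ?_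
        rw [Nat.succ_mul (m + 1)]
        omega
    refine ((hpg x r i o).seq ((Within.push _ _).seq (hloop (N x) 0 (by simp)))).mono ?_
    have := Nat.mul_le_mul_right (t.eval (size x) + 1) (Nat.add_le_add_right (hN x) 1)
    simp only [eval_add, eval_mul, eval_one, eval_ofNat]
    omega

end PolyFun
end ParamASP

namespace ParamASP

open Function Polynomial TreeRep

/-! ### Representations of data types -/

namespace TreeRep

/-- A representation of a type that is embedded into a represented type. -/
@[reducible] def ofInjective {α β : Type} [TreeRep β] (f : α → β) (hf : Injective f) : TreeRep α :=
  ⟨fun x => toTree (f x), inj.comp hf⟩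

instance : TreeRep Bool := ⟨DTree.ofBool, by intro x y; cases x <;> cases y <;> simp [DTree.ofBool]⟩

instance : TreeRep Unit := ⟨fun _ => .nil, fun _ _ _ => rfl⟩

/-- Lists as trees. -/
def listTree {α : Type} [TreeRep α] : List α → DTree
  | [] => .nil
  | x :: l => .cons (toTree x) (listTree l)

theorem listTree_injective {α : Type} [TreeRep α] : ∀ {l m : List α}, listTree l = listTree m → l = m
  | [], [], _ => rfl
  | _ :: _, [], h => by cases h
  | [], _ :: _, h => by cases h
  | x :: l, y :: m, h => by
    simp only [listTree, DTree.cons.injEq] at h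
    rw [inj h.1, listTree_injective h.2]

instance {α : Type} [TreeRep α] : TreeRep (List α) := ⟨listTree, fun _ _ => listTree_injective⟩

/-- Unary numbers: the size is linear in the value, in accordance with the unary parameter and the
unary positions in the words of circuits. -/
instance : TreeRep ℕ :=
  ofInjective (fun n => List.replicate n ()) fun _ _ h => by simpa using congrArg List.length h

instance {α β : Type} [TreeRep α] [TreeRep β] : TreeRep (α × β) :=
  ⟨fun x => .cons (toTree x.1) (toTree x.2), fun x y h => by
    simp only [DTree.cons.injEq] at h
    exact Prod.ext (inj h.1) (inj h.2)⟩

instance {α : Type} [TreeRep α] : TreeRep (Option α) :=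
  ⟨fun x => x.elim .nil fun x => .cons (toTree x) .nil, fun x y h => by
    cases x <;> cases y <;> simp at h ⊢
    exact inj h⟩

variable {α β : Type} [TreeRep α] [TreeRep β]

theorem toTree_nil : toTree ([] : List α) = .nil := rfl
theorem toTree_cons (x : α) (l : List α) : toTree (x :: l) = .cons (toTree x) (toTree l) := rfl
theorem toTree_prod (x : α × β) : toTree x = .cons (toTree x.1) (toTree x.2) := rfl
theorem toTree_some (x : α) : toTree (some x) = .cons (toTree x) .nil := rfl

end TreeRep

section Size
variable {α β : Type} [TreeRep α] [TreeRep β]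

theorem size_pos (x : α) : 0 < size x := DTree.size_pos _
@[simp] theorem size_nil : size ([] : List α) = 1 := rfl
@[simp] theorem size_cons (x : α) (l : List α) : size (x :: l) = size x + size l + 1 := rfl
@[simp] theorem size_prod (x : α × β) : size x = size x.1 + size x.2 + 1 := rfl

theorem size_append (l m : List α) : size (l ++ m) + 1 = size l + size m := by
  induction l with
  | nil => simp; omega
  | cons x l ih => simp at ih ⊢; omega

theorem size_reverse (l : List α) : size l.reverse = size l := by
  induction l with
  | nil => rfl
  | cons x l ih =>
    have := size_append l.reverse [x]
    simp at this ⊢; omega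

theorem size_le_of_sublist {l m : List α} (h : l.Sublist m) : size l ≤ size m := by
  induction h with
  | slnil => exact le_rfl
  | cons x _ ih => simp; omega
  | cons_cons x _ ih => simp; omega

theorem size_le_of_mem {x : α} {l : List α} (h : x ∈ l) : size x ≤ size l := by
  have := size_le_of_sublist (List.singleton_sublist.2 h)
  simp at this; omega

theorem length_lt_size (l : List α) : l.length < size l := by
  induction l with
  | nil => simp
  | cons x l ih => simp; omega

theorem size_nat (n : ℕ) : size n = 2 * n + 1 := by
  induction n with
  | zero => rfl
  | succ n ih =>
    have : size (n + 1) = size () + size n + 1 := by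
      change size (List.replicate (n + 1) ()) = _
      rw [List.replicate_succ, size_cons]; rfl
    rw [this, ih, show size () = 1 from rfl]; omega

theorem size_flatMap_le {α : Type} (l : List α) (f : α → List β) (B : ℕ) (h : ∀ x ∈ l, size (f x) ≤ B) :
    size (l.flatMap f) ≤ l.length * B + 1 := by
  induction l with
  | nil => simp
  | cons x l ih =>
    have h1 := size_append (f x) (l.flatMap f)
    have h2 := ih fun y hy => h y (List.mem_cons_of_mem _ hy)
    have h3 := h x List.mem_cons_self
    rw [List.flatMap_cons, List.length_cons, Nat.succ_mul]
    omega

end Size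

/-! ### Closure properties -/

/-- Case distinction on lists. -/
def listElim {α β : Type} (l : List α) (b : β) (f : α → List α → β) : β :=
  match l with
  | [] => b
  | x :: l => f x l

@[simp] theorem listElim_nil {α β : Type} (b : β) (f : α → List α → β) : listElim [] b f = b := rfl

@[simp] theorem listElim_cons {α β : Type} (x : α) (l : List α) (b : β) (f : α → List α → β) :
    listElim (x :: l) b f = f x l := rfl

namespace PolyFun

variable {α β γ σ : Type} [TreeRep α] [TreeRep β] [TreeRep γ] [TreeRep σ]

theorem size_le {f : α → β} (hf : PolyFun f) : ∃ q : ℕ[X], ∀ x, size (f x) ≤ q.eval (size x) :=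
  let ⟨q, hq, _⟩ := hf
  ⟨q, hq⟩

@[fun_prop]
theorem fst : PolyFun fun x : α × β => x.1 := (hd.comp _ _ tree).congr_rep fun _ => rfl

@[fun_prop]
theorem snd : PolyFun fun x : α × β => x.2 := (tl.comp _ _ tree).congr_rep fun _ => rfl

@[fun_prop]
theorem prodMk (f : α → β) (g : α → γ) (hf : PolyFun f) (hg : PolyFun g) :
    PolyFun fun x => (f x, g x) := (cons_tree hf hg).congr_rep fun _ => rfl

theorem const_tree (t : DTree) : PolyFun fun _ : α => t := by
  induction t with
  | nil => exact const_nil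
  | cons x y hx hy => exact (cons_tree hx hy).congr_rep fun _ => rfl

@[fun_prop]
theorem const (b : β) : PolyFun fun _ : α => b := (const_tree (toTree b)).congr_rep fun _ => rfl

@[fun_prop]
theorem decide_eq [DecidableEq β] (f g : α → β) (hf : PolyFun f) (hg : PolyFun g) :
    PolyFun fun x => decide (f x = g x) :=
  (eq_tree hf hg).congr_rep fun x => by
    simp only [inj.eq_iff]
    rfl

@[fun_prop]
theorem ite (p : α → Prop) [DecidablePred p] (f g : α → β) (hp : PolyFun fun x => decide (p x))
    (hf : PolyFun f) (hg : PolyFun g) : PolyFun fun x => if p x then f x else g x :=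
  (ite_tree (tree.comp _ _ hp) hf hg).congr_rep fun x => by
    by_cases h : p x <;> simp [h, toTree, DTree.ofBool]

/-- A function on a finite type is a finite table, that is, a nested case distinction. It is built
up along a list of arguments, and finally along the list of all of them. -/
theorem of_finite [Finite α] (f : α → β) : PolyFun f := by
  classical
  rcases isEmpty_or_nonempty α with h | ⟨⟨a⟩⟩
  · exact (const_tree .nil).congr_rep fun x => h.elim x
  · have key : ∀ l : List α, ∃ g : α → β, PolyFun g ∧ ∀ x ∈ l, g x = f x := by
      intro l
      induction l with
      | nil => exact ⟨_, const (f a), by simp⟩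
      | cons y l ih =>
        obtain ⟨g, hg, h⟩ := ih
        refine ⟨fun x => if x = y then f y else g x, by fun_prop, fun x hx => ?_⟩
        by_cases hxy : x = y
        · simp [hxy]
        · simpa [hxy] using h x (by simpa [hxy] using hx)
    cases nonempty_fintype α
    obtain ⟨g, hg, h⟩ := key Finset.univ.toList
    rwa [← funext fun x => h x (by simp)]

@[fun_prop]
theorem not (f : α → Bool) (hf : PolyFun f) : PolyFun fun x => !f x := comp _ _ (of_finite _) hf

@[fun_prop]
theorem and (f g : α → Bool) (hf : PolyFun f) (hg : PolyFun g) : PolyFun fun x => f x && g x :=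
  comp (fun p : Bool × Bool => p.1 && p.2) _ (of_finite _) (prodMk _ _ hf hg)

@[fun_prop]
theorem or (f g : α → Bool) (hf : PolyFun f) (hg : PolyFun g) : PolyFun fun x => f x || g x :=
  comp (fun p : Bool × Bool => p.1 || p.2) _ (of_finite _) (prodMk _ _ hf hg)

@[fun_prop]
theorem decide_not (p : α → Prop) [DecidablePred p] (hp : PolyFun fun x => decide (p x)) :
    PolyFun fun x => decide (¬p x) := by
  simpa using not _ hp

@[fun_prop]
theorem decide_and (p q : α → Prop) [DecidablePred p] [DecidablePred q]
    (hp : PolyFun fun x => decide (p x)) (hq : PolyFun fun x => decide (q x)) :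
    PolyFun fun x => decide (p x ∧ q x) := by
  simpa using and _ _ hp hq

@[fun_prop]
theorem decide_or (p q : α → Prop) [DecidablePred p] [DecidablePred q]
    (hp : PolyFun fun x => decide (p x)) (hq : PolyFun fun x => decide (q x)) :
    PolyFun fun x => decide (p x ∨ q x) := by
  simpa using or _ _ hp hq

@[fun_prop]
theorem some (f : α → β) (hf : PolyFun f) : PolyFun fun x => some (f x) :=
  (cons_tree hf const_nil).congr_rep fun _ => rfl

@[fun_prop]
theorem cons (f : α → β) (l : α → List β) (hf : PolyFun f) (hl : PolyFun l) :
    PolyFun fun x => f x :: l x :=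
  (cons_tree hf hl).congr_rep fun _ => rfl

@[fun_prop]
-- The tree of `none` is `nil`, and the content of a `some` is the left subtree. The second branch
-- is computed on the subtype where this subtree exists.
theorem elim (o : α → Option β) (f : α → γ) (g : α → β → γ) (ho : PolyFun o) (hf : PolyFun f)
    (hg : PolyFun fun p : α × β => g p.1 p.2) : PolyFun fun x => (o x).elim (f x) (g x) := by
  have key : ∀ x : {x // toTree (o x) ≠ .nil}, (o x.1).isSome := by
    rintro ⟨x, hx⟩
    cases h : o x with
    | none => exact absurd (by rw [h]; rfl) hx
    | some b => rfl
  refine (dite_tree (c := fun x => toTree (o x)) (f := fun x => g x.1 ((o x.1).get (key x)))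
    (g := fun x => f x.1) (tree.comp _ _ ho)
    (comp_rep (f' := fun x => (x.1, (o x.1).get (key x))) hg
      (cons_tree val (hd.comp _ _ (tree.comp _ _ (ho.comp _ _ val)))) ?_)
    (hf.comp _ _ val)).congr_rep fun x => ?_
  · intro x
    obtain ⟨b, hb⟩ := Option.isSome_iff_exists.1 (key x)
    simp only [hb, toTree_prod, toTree_some, Option.get_some]
    rfl
  · split
    · next h =>
      cases ho : o x with
      | none => rfl
      | some b => rw [ho] at h; cases h
    · next h =>
      obtain ⟨b, hb⟩ := Option.isSome_iff_exists.1 (key ⟨x, h⟩)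
      simp only at hb
      simp [hb]

@[fun_prop]
theorem listElim (l : α → List β) (f : α → γ) (g : α → β → List β → γ) (hl : PolyFun l)
    (hf : PolyFun f) (hg : PolyFun fun p : α × β × List β => g p.1 p.2.1 p.2.2) :
    PolyFun fun x => ParamASP.listElim (l x) (f x) (g x) := by
  have key : ∀ x : {x // toTree (l x) ≠ .nil}, l x.1 ≠ [] := by
    rintro ⟨x, hx⟩ h
    exact hx (by rw [h]; rfl)
  refine (dite_tree (c := fun x => toTree (l x))
    (f := fun x => g x.1 ((l x.1).head (key x)) (l x.1).tail)
    (g := fun x => f x.1) (tree.comp _ _ hl)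
    (comp_rep (f' := fun x => (x.1, (l x.1).head (key x), (l x.1).tail)) hg
      (cons_tree val (cons_tree (hd.comp _ _ (tree.comp _ _ (hl.comp _ _ val)))
        (tl.comp _ _ (tree.comp _ _ (hl.comp _ _ val))))) ?_)
    (hf.comp _ _ val)).congr_rep fun x => ?_
  · intro x
    obtain ⟨b, m, h⟩ := List.exists_cons_of_ne_nil (key x)
    simp only [h, toTree_prod, toTree_cons, List.head_cons, List.tail_cons]
    rfl
  · split
    · next h =>
      cases hl : l x with
      | nil => rfl
      | cons b m => rw [hl] at h; cases h
    · next h =>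
      obtain ⟨b, m, hb⟩ := List.exists_cons_of_ne_nil (key ⟨x, h⟩)
      simp only at hb
      simp [hb]

/-- A loop whose state consists of the parameter, the accumulator and the rest of the list. The
accumulator after each prefix must be bounded by hypothesis, since a bound for `f` alone does not
give one. -/
theorem foldl (l : α → List β) (init : α → σ) (f : α → σ → β → σ) (hl : PolyFun l)
    (hi : PolyFun init) (hf : PolyFun fun p : α × σ × β => f p.1 p.2.1 p.2.2) (q : ℕ[X])
    (hq : ∀ x l', l' <+: l x → size (l'.foldl (f x) (init x)) ≤ q.eval (size x)) :
    PolyFun fun x => (l x).foldl (f x) (init x) := by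
  obtain ⟨ql, hql⟩ := hl.size_le
  let step : (α × σ) × List β → (α × σ) × List β := fun p =>
    ParamASP.listElim p.2 p fun b m => ((p.1.1, f p.1.1 p.1.2 b), m)
  have hstep : PolyFun step := by
    refine listElim (fun p : (α × σ) × List β => p.2) (fun p => p)
      (fun p b m => ((p.1.1, f p.1.1 p.1.2 b), m)) snd id ?_
    exact prodMk _ _ (prodMk _ _ (by fun_prop) (hf.comp (fun p : α × σ × β => f p.1 p.2.1 p.2.2)
      (fun p : ((α × σ) × List β) × β × List β => (p.1.1.1, p.1.1.2, p.2.1)) (by fun_prop)))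
      (by fun_prop)
  have hiter : ∀ x n, n ≤ (l x).length → step^[n] ((x, init x), l x) =
      ((x, ((l x).take n).foldl (f x) (init x)), (l x).drop n) := by
    intro x n hn
    induction n with
    | zero => simp
    | succ n ih =>
      rw [iterate_succ_apply', ih (by omega), List.drop_eq_getElem_cons (by omega)]
      simp only [step, ParamASP.listElim_cons]
      rw [← List.take_concat_get' _ _ (by omega), List.foldl_concat]
  have := iterate (c := fun p : (α × σ) × List β => toTree p.2) (f := step)
    (g := fun x => ((x, init x), l x)) (tree.comp _ _ snd) hstep (by fun_prop)
    (fun x => (l x).length) (X + q + ql + 2) (fun x => ?_) (fun x n hn => ?_) (fun x n hn => ?_)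
    (fun x => ?_)
  · refine ((snd.comp _ _ fst).comp _ _ this).congr_rep fun x => ?_
    rw [hiter x _ le_rfl]
    simp
  · have := length_lt_size (l x)
    have := hql x
    simp; omega
  · rw [hiter x n hn]
    have h1 := hq x _ (List.take_prefix n _)
    have h2 := size_le_of_sublist (List.drop_sublist n (l x))
    have := hql x
    simp; omega
  · rw [hiter x n hn.le, List.drop_eq_getElem_cons hn]
    exact nofun
  · rw [hiter x _ le_rfl]
    simp [toTree_nil]

@[fun_prop]
theorem reverse (l : α → List β) (hl : PolyFun l) : PolyFun fun x => (l x).reverse := by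
  obtain ⟨ql, hql⟩ := hl.size_le
  have e : ∀ m : List β, m.foldl (fun s b => b :: s) [] = m.reverse := fun m => by simp
  simp_rw [← e]
  refine foldl l (fun _ => []) (fun _ s b => b :: s) hl (by fun_prop) (by fun_prop) ql
    fun x l' h => ?_
  rw [e, size_reverse]
  exact (size_le_of_sublist h.sublist).trans (hql x)

theorem foldr (l : α → List β) (init : α → σ) (f : α → β → σ → σ) (hl : PolyFun l)
    (hi : PolyFun init) (hf : PolyFun fun p : α × β × σ => f p.1 p.2.1 p.2.2) (q : ℕ[X])
    (hq : ∀ x l', l' <:+ l x → size (l'.foldr (f x) (init x)) ≤ q.eval (size x)) :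
    PolyFun fun x => (l x).foldr (f x) (init x) := by
  have e : ∀ x, (l x).foldr (f x) (init x) =
      (l x).reverse.foldl (fun s b => f x b s) (init x) := fun x => by simp
  simp_rw [e]
  refine foldl (fun x => (l x).reverse) init (fun x s b => f x b s) (by fun_prop) hi
    (hf.comp (fun p : α × β × σ => f p.1 p.2.1 p.2.2)
      (fun p : α × σ × β => (p.1, p.2.2, p.2.1)) (by fun_prop)) q fun x l' h => ?_
  have := hq x l'.reverse (by rwa [← List.reverse_prefix, List.reverse_reverse])
  rwa [← List.foldl_reverse, List.reverse_reverse] at this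

@[fun_prop]
theorem append (l m : α → List β) (hl : PolyFun l) (hm : PolyFun m) :
    PolyFun fun x => l x ++ m x := by
  obtain ⟨ql, hql⟩ := hl.size_le
  obtain ⟨qm, hqm⟩ := hm.size_le
  have e : ∀ l m : List β, l.foldr (fun b s => b :: s) m = l ++ m := fun l m => by simp
  simp_rw [← e]
  refine foldr l m (fun _ b s => b :: s) hl hm (by fun_prop) (ql + qm) fun x l' h => ?_
  have h1 := hql x
  have h2 := hqm x
  have h3 := size_le_of_sublist h.sublist
  have h4 := size_append l' (m x)
  rw [e]
  simp; omega

@[fun_prop]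
-- The result has at most the number of elements times the largest piece as its size, so the bound
-- needed for the fold comes for free. Maps, filters and bounded quantifiers reduce to this
-- operation.
theorem flatMap (l : α → List β) (f : α → β → List γ) (hl : PolyFun l)
    (hf : PolyFun fun p : α × β => f p.1 p.2) : PolyFun fun x => (l x).flatMap (f x) := by
  obtain ⟨ql, hql⟩ := hl.size_le
  obtain ⟨qf, hqf⟩ := hf.size_le
  have e : ∀ (x : α) (m : List β), m.flatMap (f x) = m.foldr (fun b s => f x b ++ s) [] := by
    intro x m
    induction m with
    | nil => rfl
    | cons b m ih => simp [ih]
  simp_rw [e]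
  refine foldr l (fun _ => []) (fun x b s => f x b ++ s) hl (by fun_prop) (by fun_prop)
    (ql * qf.comp (X + ql + 1) + 1) fun x l' h => ?_
  rw [← e]
  have h1 := hql x
  have h2 := size_le_of_sublist h.sublist
  have h3 := length_lt_size l'
  refine (size_flatMap_le l' (f x) (qf.eval (size x + ql.eval (size x) + 1)) fun b hb => ?_).trans ?_
  · have h4 := size_le_of_mem hb
    refine (hqf (x, b)).trans (eval_mono qf ?_)
    simp; omega
  · simp only [eval_add, eval_mul, eval_comp, eval_X, eval_one]
    exact Nat.add_le_add_right (Nat.mul_le_mul_right _ (by omega)) 1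

@[fun_prop]
theorem map (l : α → List β) (f : α → β → γ) (hl : PolyFun l)
    (hf : PolyFun fun p : α × β => f p.1 p.2) : PolyFun fun x => (l x).map (f x) := by
  simp_rw [List.map_eq_flatMap]
  fun_prop

@[fun_prop]
theorem filter (l : α → List β) (p : α → β → Bool) (hl : PolyFun l)
    (hp : PolyFun fun q : α × β => p q.1 q.2) : PolyFun fun x => (l x).filter (p x) := by
  have e : ∀ (x : α) (m : List β), m.filter (p x) = m.flatMap fun b => if p x b then [b] else [] := by
    intro x m
    induction m with
    | nil => rfl
    | cons b m ih => by_cases h : p x b <;> simp [h, ih]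
  simp_rw [e]
  fun_prop

@[fun_prop]
theorem any (l : α → List β) (p : α → β → Bool) (hl : PolyFun l)
    (hp : PolyFun fun q : α × β => p q.1 q.2) : PolyFun fun x => (l x).any (p x) := by
  have e : ∀ (x : α) (m : List β), m.any (p x) =
      !decide ((m.flatMap fun b => if p x b then [()] else []) = []) := by
    intro x m
    rw [Bool.eq_iff_iff]
    simp
  simp_rw [e]
  fun_prop

@[fun_prop]
theorem all (l : α → List β) (p : α → β → Bool) (hl : PolyFun l)
    (hp : PolyFun fun q : α × β => p q.1 q.2) : PolyFun fun x => (l x).all (p x) := by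
  simp_rw [List.all_eq_not_any_not]
  fun_prop

@[fun_prop]
theorem decide_mem [DecidableEq β] (f : α → β) (l : α → List β) (hf : PolyFun f) (hl : PolyFun l) :
    PolyFun fun x => decide (f x ∈ l x) := by
  have e : ∀ (b : β) (m : List β), decide (b ∈ m) = m.any fun c => decide (c = b) := by
    intro b m
    rw [Bool.eq_iff_iff]
    simp
  simp_rw [e]
  fun_prop

@[fun_prop]
theorem length (l : α → List β) (hl : PolyFun l) : PolyFun fun x => (l x).length := by
  have : PolyFun fun x => (l x).map fun _ => () := by fun_prop
  exact this.congr_rep fun x => by rw [List.map_const']; rfl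

@[fun_prop]
theorem replicate (n : α → ℕ) (f : α → β) (hn : PolyFun n) (hf : PolyFun f) :
    PolyFun fun x => List.replicate (n x) (f x) := by
  have h : PolyFun fun x => List.replicate (n x) () := hn.congr_rep fun _ => rfl
  have : ∀ x, List.replicate (n x) (f x) = (List.replicate (n x) ()).map fun _ => f x := by simp
  simp_rw [this]
  fun_prop

@[fun_prop]
theorem add (f g : α → ℕ) (hf : PolyFun f) (hg : PolyFun g) : PolyFun fun x => f x + g x := by
  have : ∀ x, f x + g x = (List.replicate (f x) () ++ List.replicate (g x) ()).length := by simp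
  simp_rw [this]
  fun_prop

@[fun_prop]
theorem range (n : α → ℕ) (hn : PolyFun n) : PolyFun fun x => List.range (n x) := by
  obtain ⟨q, hq⟩ := hn.size_le
  have e : ∀ m, List.range m = (List.replicate m ()).foldl (fun s _ => s ++ [s.length]) [] := by
    intro m
    induction m with
    | zero => rfl
    | succ m ih => rw [List.replicate_succ', List.foldl_concat, ← ih, List.range_succ]; simp
  simp_rw [e]
  refine foldl (fun x => List.replicate (n x) ()) (fun _ => []) (fun _ s _ => s ++ [s.length])
    (by fun_prop) (by fun_prop) (by fun_prop) (q * (2 * q + 2) + 1) fun x l' h => ?_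
  obtain ⟨m, rfl⟩ : ∃ m, l' = List.replicate m () := ⟨l'.length, by rw [List.eq_replicate_iff]; simp⟩
  have hm : m ≤ n x := by simpa using h.sublist.length_le
  have h1 := hq x
  rw [size_nat] at h1
  have e' : List.range m = (List.range m).flatMap fun y => [y] := by simp
  rw [← e, e']
  refine (size_flatMap_le _ _ (2 * q.eval (size x) + 2) fun y hy => ?_).trans ?_
  · rw [List.mem_range] at hy
    simp [size_nat]; omega
  · simp only [eval_add, eval_mul, eval_one, eval_ofNat, List.length_range]
    exact Nat.add_le_add_right (Nat.mul_le_mul_right _ (by omega)) 1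

@[fun_prop]
theorem idxOf [DecidableEq β] (f : α → β) (l : α → List β) (hf : PolyFun f) (hl : PolyFun l) :
    PolyFun fun x => (l x).idxOf (f x) := by
  obtain ⟨q, hq⟩ := hl.size_le
  have e : ∀ (b : β) (m : List β),
      m.idxOf b = m.foldr (fun c s => if c = b then 0 else s + 1) 0 := by
    intro b m
    induction m with
    | nil => rfl
    | cons c m ih =>
      by_cases h : c = b
      · simp [h]
      · simp [h, List.idxOf_cons_ne _ h, ih]
  simp_rw [e]
  refine foldr l (fun _ => 0) (fun x c s => if c = f x then 0 else s + 1) hl (by fun_prop)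
    (by fun_prop) (2 * q + 1) fun x l' h => ?_
  rw [← e, size_nat]
  have h1 := hq x
  have h2 := size_le_of_sublist h.sublist
  have h3 := length_lt_size l'
  have h4 := List.idxOf_le_length (l := l') (a := f x)
  simp; omega

end PolyFun
end ParamASP

namespace ParamASP

open Function Polynomial TreeRep Turing

/-! ### Reading and writing words -/

section Input

variable {A B : Type}

theorem within_seq_snd {S T : Type} {p q : Prog S T} {s s' s'' : Store S T} {m n N : ℕ}
    (h₁ : Within p s m s') (h₂ : Within q s' n s'') (hN : m + n + 1 ≤ N) :
    Within (.seq p q) s N s'' := (h₁.seq h₂).mono hN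

/-- Push a word onto the data stack. -/
def pushWord : List Bool → Prog A B
  | [] => .skip
  | x :: l => .seq (pushWord l) (.push .d x)

theorem within_pushWord (i : List A) (o : List B) (l d : List Bool) :
    Within (pushWord l) ⟨i, o, d, [], [], []⟩ (2 * l.length + 1) ⟨i, o, l ++ d, [], [], []⟩ := by
  induction l with
  | nil => exact Within.skip
  | cons x l ih => exact within_seq_snd ih (Within.push .d x) (by simp; omega)

variable [TreeRep A]

/-- Move the input, in reverse, to the data stack, as the code of a list. -/
def readInput : Prog A B :=
  .seq (.push .d false) (.loop .inp fun x => .seq (pushWord (code x)) (.push .d true))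

/-- The transfer has reversed the word, so its last symbol is on top. This is the right order for
building the code of a list from its end: first `nil`, then for each symbol its code and a bit
`true` above it. -/
theorem within_readInput (v : List A) :
    Within (readInput : Prog A B) ⟨v.reverse, [], [], [], [], []⟩ (4 * size v + 3)
      ⟨[], [], code v, [], [], []⟩ := by
  have key : ∀ v w : List A, Within (.loop .inp fun x => .seq (pushWord (code x)) (.push .d true))
      (⟨v.reverse, [], code w, [], [], []⟩ : Store A B) (4 * size v + 1)
      ⟨[], [], code (v ++ w), [], [], []⟩ := by
    intro v
    induction v using List.reverseRecOn with
    | nil => exact fun w => (Within.loop_nil rfl).mono (by simp)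
    | append_singleton v x ih =>
      intro w
      have h1 := (within_pushWord (A := A) (B := B) v.reverse [] (code x) (code w)).seq
        (Within.push .d true)
      have h2 := ih (x :: w)
      have h3 : (code x).length = size x := DTree.length_code _
      have h4 := size_append v [x]
      rw [List.append_assoc]
      refine Within.mono (m := (2 * (code x).length + 1 + 1 + 1) + (4 * size v + 1) + 1) ?_
        (by simp at h4; omega)
      refine Within.loop_cons (x := x) (l := v.reverse) ?_ h1 h2
      simp
  have := key v []
  rw [List.append_nil] at this
  exact within_seq_snd (Within.push .d false) this (by omega)

end Input

section Output

variable {A B : Type} [TreeRep B]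

open Classical in
/-- Move a symbol, given by its code, from the data stack to the output. The word `w` is the part
of the code that has been read already. -/
noncomputable def writeSymbol : ℕ → List Bool → Prog A B
  | 0, _ => .skip
  | n + 1, w => .pop .d fun
    | none => .skip
    | some x =>
      if h : ∃ y : B, code y = w ++ [x] then .push .out h.choose else writeSymbol n (w ++ [x])

/-- By prefix-freeness, the first prefix that is the code of some symbol is the code of `y`. The
number `n` limits how many bits are tried, which keeps the program finite. -/
theorem within_writeSymbol (i : List A) (o : List B) (d : List Bool) (y : B) :
    ∀ (n : ℕ) (w r : List Bool), r ≠ [] → r.length ≤ n → code y = w ++ r →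
      Within (writeSymbol n w) ⟨i, o, r ++ d, [], [], []⟩ (r.length + 1)
        ⟨i, y :: o, d, [], [], []⟩ := by
  intro n
  induction n with
  | zero => intro w r hr hn; simp at hn; exact absurd hn hr
  | succ n ih =>
    intro w r hr hn h
    obtain ⟨x, r, rfl⟩ := List.exists_cons_of_ne_nil hr
    refine Within.pop (n := r.length + 1) ?_
    simp only [Store.get, List.cons_append, List.head?_cons]
    split
    · next hy =>
      have h1 := hy.choose_spec
      have h2 : code hy.choose ++ r = code y ++ [] := by rw [h1, h]; simp
      obtain ⟨h3, h4⟩ := DTree.code_append_injective h2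
      rw [inj h3, h4]
      exact Within.push _ _
    · next hy =>
      have hr : r ≠ [] := by
        rintro rfl
        exact hy ⟨y, h⟩
      simpa using ih (w ++ [x]) r hr (by simpa using hn) (by rw [h]; simp)

/-- Move the list on the data stack to the output, in reverse. -/
noncomputable def writeOutput (n : ℕ) : Prog A B :=
  .seq (.push .c true) (.loop .c fun _ => .pop .d fun
    | some true => .seq (writeSymbol n []) (.push .c true)
    | _ => .skip)

theorem code_ne_nil (x : B) : code x ≠ [] := by
  rw [← List.length_pos_iff, code, DTree.length_code]
  exact DTree.size_pos _

theorem within_writeOutput (n : ℕ) (hn : ∀ y : B, size y ≤ n) (l : List B) :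
    Within (writeOutput n : Prog A B) ⟨[], [], code l, [], [], []⟩ (6 * size l + 2)
      ⟨[], l.reverse, [], [], [], []⟩ := by
  have key : ∀ l o : List B, Within (.loop .c fun _ => .pop .d fun
      | some true => .seq (writeSymbol n []) (.push .c true)
      | _ => .skip) (⟨[], o, code l, [], [], [true]⟩ : Store A B) (6 * size l)
      ⟨[], l.reverse ++ o, [], [], [], []⟩ := by
    intro l
    induction l with
    | nil =>
      intro o
      exact (Within.loop_cons rfl (Within.pop Within.skip) (Within.loop_nil rfl)).mono (by simp)
    | cons y l ih =>
      intro o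
      have h3 : (code y).length = size y := DTree.length_code _
      have h1 := (within_writeSymbol (A := A) [] o (code l) y n [] (code y) (code_ne_nil y)
        (h3.trans_le (hn y)) rfl).seq (Within.push .c true)
      have h2 := ih (y :: o)
      have h4 := size_pos y
      refine Within.mono (m := ((code y).length + 1 + 1 + 1 + 1) + (6 * size l) + 1) ?_
        (by simp; omega)
      exact Within.loop_cons rfl (Within.pop h1) (by simpa using h2)
  have := key l []
  rw [List.append_nil] at this
  exact within_seq_snd (Within.push .c true) this (by omega)

end Output

theorem exists_size_le {A : Type} [TreeRep A] [Finite A] : ∃ n, ∀ x : A, size x ≤ n := by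
  cases nonempty_fintype A
  exact ⟨∑ x : A, size x, fun x =>
    Finset.single_le_sum (f := fun x : A => size x) (fun _ _ => Nat.zero_le _) (Finset.mem_univ x)⟩

/-- Read the word, compute on trees, write the result. Over a finite alphabet the size of the tree
is linear in the length of the word, so the bound is a polynomial in the length. -/
theorem exists_prog_of_polyFun {A B : Type} [TreeRep A] [TreeRep B] [Finite A] [Finite B] {G : List A → List B} (hG : PolyFun G) :
    ∃ (p : Prog A B) (q : ℕ[X]), ∀ v : List A,
      Within p ⟨v.reverse, [], [], [], [], []⟩ (q.eval v.length) ⟨[], G v, [], [], [], []⟩ := by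
  -- Writing reverses the list once more, so the reversed result is computed.
  obtain ⟨q, hq, hp⟩ := hG.reverse
  obtain ⟨p, hp⟩ := hp A B
  obtain ⟨a, ha⟩ := exists_size_le (A := A)
  obtain ⟨b, hb⟩ := exists_size_le (A := B)
  -- Every symbol contributes its own size and one list cell; the summand 1 is the empty list.
  let s : ℕ[X] := C (a + 1) * X + 1
  refine ⟨.seq readInput (.seq p (writeOutput b)), (4 * s + 3) + q.comp s + (6 * q.comp s + 2) + 2,
    fun v => ?_⟩
  have hv : size v ≤ s.eval v.length := by
    simp only [s, eval_add, eval_mul, eval_C, eval_X, eval_one]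
    induction v with
    | nil => simp
    | cons x v ih =>
      have := ha x
      simp only [size_cons, List.length_cons]
      rw [Nat.mul_succ]
      omega
  have h1 := within_readInput (B := B) v
  have h2 := hp v [] [] []
  have h3 := within_writeOutput (A := A) b hb (G v).reverse
  have h4 := hq v
  have h5 := eval_mono q hv
  rw [List.reverse_reverse] at h3
  rw [List.append_nil, List.append_nil] at h2
  refine (h1.seq (h2.seq h3)).mono ?_
  simp only [eval_add, eval_mul, eval_comp, eval_ofNat] at *
  omega

/-! ### Composition of fpt-time computable functions and polynomial-time functions -/

theorem unaryEncodeNat_eq (n : ℕ) : Computability.unaryEncodeNat n = List.replicate n true := by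
  induction n with
  | zero => rfl
  | succ n ih => rw [Computability.unaryEncodeNat, ih, List.replicate_succ]

theorem instanceWord_eq {S : Type} (p : List S × ℕ) :
    instanceWord p = p.1.map .inl ++ List.replicate p.2 (.inr true) := by
  rw [← List.map_replicate, ← unaryEncodeNat_eq]
  rfl

instance {α β : Type} [TreeRep α] [TreeRep β] : TreeRep (α ⊕ β) :=
  ⟨Sum.elim (fun x => .cons .nil (toTree x)) (fun y => .cons (.cons .nil .nil) (toTree y)),
    fun x y h => by
      cases x <;> cases y <;> simp at h ⊢ <;> exact inj h⟩

/-- This separates the dependence on the parameter from that on the input length, as the form of an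
fpt time bound demands: `a` will depend on `k` only, and `b` will be a power of the input length
plus one. -/
theorem eval_mul_le (q : ℕ[X]) (a b : ℕ) (hb : 1 ≤ b) :
    q.eval (a * b) ≤ q.eval a * b ^ q.natDegree := by
  rw [eval_eq_sum_range, eval_eq_sum_range, Finset.sum_mul]
  refine Finset.sum_le_sum fun i hi => ?_
  rw [mul_pow, ← mul_assoc]
  exact Nat.mul_le_mul_left _ (Nat.pow_le_pow_right hb (by simp at hi; omega))

/-- The factor of the new time bound that depends on `k` contains a polynomial, and it has to be
computable. -/
theorem primrec_eval (q : ℕ[X]) : Primrec fun n => q.eval n := by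
  have hpow : ∀ k : ℕ, Primrec fun n : ℕ => n ^ k := by
    intro k
    induction k with
    | zero => simpa using Primrec.const 1
    | succ k ih => simpa [pow_succ] using Primrec.nat_mul.comp ih Primrec.id
  induction q using Polynomial.induction_on' with
  | add p q hp hq => simpa using Primrec.nat_add.comp hp hq
  | monomial k a => simpa using Primrec.nat_mul.comp (Primrec.const a) (hpow k)

theorem length_instanceWord {S : Type} (p : List S × ℕ) :
    (instanceWord p).length = p.1.length + p.2 := by
  simp [instanceWord_eq]

/-- An instance word is split by the kind of its symbols: those of the alphabet form the main part,
and the others are counted to obtain the parameter. -/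
theorem polyFun_word {S T : Type} [Finite S] [Finite T] [TreeRep S] [TreeRep T]
    {R : List S × ℕ → List T × ℕ} (hR : PolyFun R) :
    ∃ G : List (S ⊕ Bool) → List (T ⊕ Bool), PolyFun G ∧
      ∀ p, G (instanceWord p) = instanceWord (R p) := by
  let l : S ⊕ Bool → List S := Sum.elim (fun s => [s]) fun _ => []
  let r : S ⊕ Bool → List Unit := Sum.elim (fun _ => []) fun _ => [()]
  let i : T → T ⊕ Bool := Sum.inl
  have hl : PolyFun l := PolyFun.of_finite _
  have hr : PolyFun r := PolyFun.of_finite _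
  have hi : PolyFun i := PolyFun.of_finite _
  refine ⟨fun w => (R (w.flatMap l, (w.flatMap r).length)).1.map i ++
    List.replicate (R (w.flatMap l, (w.flatMap r).length)).2 (Sum.inr true), by fun_prop,
    fun p => ?_⟩
  have h1 : (instanceWord p).flatMap l = p.1 := by
    simp [instanceWord_eq, l, List.flatMap_map]
  have h2 : ((instanceWord p).flatMap r).length = p.2 := by
    simp [instanceWord_eq, r, List.flatMap_map]
  rw [instanceWord_eq (R p)]
  simp only [h1, h2]
  rfl

/-- The machine for `R` leaves an output of length at most `a k * (|I| + 1) ^ (c + 1)`. A polynomial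
`q` of this quantity is at most `q (a k)` times a fixed power of `|I| + 1`, by `eval_mul_le`, which
is an fpt bound again. -/
theorem FptTimeComputable.comp_polyFun {S T U : Type} [Finite T] [Finite U] [TreeRep T] [TreeRep U]
    {R : List S × ℕ → List T × ℕ} {Q : List T × ℕ → List U × ℕ} (hR : FptTimeComputable R)
    (hQ : PolyFun Q) : FptTimeComputable fun p => Q (R p) := by
  obtain ⟨M, f, c, hf, hM⟩ := hR
  obtain ⟨G, hG, hGQ⟩ := polyFun_word hQ
  obtain ⟨p, q, hp⟩ := exists_prog_of_polyFun hG
  -- Chosen so that `a k * (|I| + 1) ^ (c + 1)` bounds both the time and the output length of the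
  -- first machine. The summands `k` and `1` account for the length of its input, and the exponent
  -- `c + 1` makes the power at least `|I| + 1`.
  let a : ℕ → ℕ := fun k => f k * (machineGrowth M.tm + 1) + k + 1
  refine ⟨⟨compMachine M p, M.inputAlphabet, Equiv.refl _⟩, fun k => 2 * a k + 2 + q.eval (a k),
    (c + 1) * (q.natDegree + 1), ?_, fun I k => ?_⟩
  · have ha : Computable a :=
      (Primrec.succ.to_comp).comp ((Primrec.nat_add.to_comp).comp
        ((Primrec.nat_mul.to_comp).comp hf (Computable.const _)) Computable.id)
    exact (Primrec.nat_add.to_comp).comp ((Primrec.nat_add.to_comp).comp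
      ((Primrec.nat_mul.to_comp).comp (Computable.const 2) ha) (Computable.const 2))
      ((primrec_eval q).to_comp.comp ha)
  · obtain ⟨⟨⟨m, hm⟩, hle⟩⟩ := hM I k
    simp only at hle
    have hv : ((instanceWord (R (I, k))).map M.outputAlphabet.invFun).map M.outputAlphabet =
        instanceWord (R (I, k)) := by simp
    obtain ⟨t, ht, he⟩ := hp (instanceWord (R (I, k)))
    rw [hGQ] at he
    have hlen := length_output_le M.tm hm
    rw [List.length_map, List.length_map, length_instanceWord (I, k)] at hlen
    rw [← hv] at he
    have hsteps := steps_compMachine M p hm he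
    rw [List.length_map] at hsteps
    refine ⟨⟨⟨m + ((instanceWord (R (I, k))).length + 1) + t + 1, ?_⟩, ?_⟩⟩
    · exact Eq.trans hsteps (congrArg (fun l => some (haltList _ l)) (List.map_id _).symm)
    · set n := I.length + 1
      set b := n ^ (c + 1)
      have hn : 1 ≤ n := by omega
      have hb : 1 ≤ b := Nat.one_le_pow _ _ hn
      have hnb : n ≤ b := Nat.le_self_pow (by omega) n
      have hcb : n ^ c ≤ b := Nat.pow_le_pow_right hn (by omega)
      have h1 : m ≤ f k * b := hle.trans (Nat.mul_le_mul_left _ hcb)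
      have h2 : (instanceWord (R (I, k))).length ≤ a k * b := by
        refine hlen.trans ?_
        have e1 : m * machineGrowth M.tm ≤ f k * b * machineGrowth M.tm := Nat.mul_le_mul_right _ h1
        have e2 : k ≤ k * b := Nat.le_mul_of_pos_right _ hb
        have e3 : a k * b = f k * b * machineGrowth M.tm + f k * b + k * b + b := by
          simp only [a]; ring
        simp only at *
        omega
      have h3 : m ≤ a k * b := h1.trans (Nat.mul_le_mul_right _ (by
        simp only [a]; rw [Nat.mul_succ]; omega))
      have h4 : t ≤ q.eval (a k) * b ^ q.natDegree :=
        ht.trans ((eval_mono q h2).trans (eval_mul_le q _ _ hb))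
      -- The exponent `q.natDegree + 1` is positive even if `q` is constant, so the terms linear in
      -- `b` are covered as well.
      have h5 : b ^ q.natDegree ≤ b ^ (q.natDegree + 1) := Nat.pow_le_pow_right hb (by omega)
      have h6 : b ≤ b ^ (q.natDegree + 1) := Nat.le_self_pow (by omega) b
      have h7 : 1 ≤ b ^ (q.natDegree + 1) := Nat.one_le_pow _ _ hb
      rw [pow_mul]
      change _ ≤ _ * b ^ (q.natDegree + 1)
      set B := b ^ (q.natDegree + 1)
      have h8 := h4.trans (Nat.mul_le_mul_left _ h5)
      have h9 := Nat.mul_le_mul_left (a k) h6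
      simp only [add_mul, mul_assoc]
      omega

/-- Composed with the identity, every polynomial-time map becomes fpt-time computable. -/
theorem fptTimeComputable_id {S : Type} [Finite S] :
    FptTimeComputable fun p : List S × ℕ => p := by
  cases nonempty_fintype S
  refine ⟨⟨idComputer (S ⊕ Bool), Equiv.refl _, Equiv.refl _⟩, fun _ => 1, 0, Computable.const _,
    fun I k => ⟨⟨⟨1, rfl⟩, by simp⟩⟩⟩

end ParamASP

/-! ### Representations of symbols and rules, and the decoding of words -/

namespace ParamASP

open Function Polynomial TreeRep

/-- A representation of a finite type. -/
@[reducible] noncomputable def TreeRep.ofFinite (α : Type) [Finite α] : TreeRep α :=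
  ofInjective (fun x => (Finite.equivFin α x : ℕ)) fun _ _ h =>
    (Finite.equivFin α).injective (Fin.ext h)

noncomputable instance : TreeRep CircuitSymbol := .ofFinite _
noncomputable instance : TreeRep ProgramSymbol := .ofFinite _

instance : TreeRep Rule :=
  ofInjective (fun r => (r.head, r.pos, r.neg)) fun r s h => by
    cases r; cases s; simpa using h

@[simp] theorem size_none {α : Type} [TreeRep α] : size (none : Option α) = 1 := rfl
@[simp] theorem size_some {α : Type} [TreeRep α] (x : α) : size (some x) = size x + 2 := rfl

theorem size_rule (r : Rule) : size r = size r.head + (size r.pos + size r.neg + 1) + 1 := rfl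

namespace PolyFun
variable {α : Type} [TreeRep α]

@[fun_prop]
theorem rule_head : PolyFun Rule.head :=
  (show PolyFun fun r : Rule => (r.head, r.pos, r.neg).1 from
    fst.comp _ (fun r : Rule => (r.head, r.pos, r.neg)) (id.congr_rep fun _ => rfl))

@[fun_prop]
theorem rule_pos : PolyFun Rule.pos :=
  (show PolyFun fun r : Rule => (r.head, r.pos, r.neg).2.1 from
    (fst.comp _ _ snd).comp _ (fun r : Rule => (r.head, r.pos, r.neg)) (id.congr_rep fun _ => rfl))

@[fun_prop]
theorem rule_neg : PolyFun Rule.neg :=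
  (show PolyFun fun r : Rule => (r.head, r.pos, r.neg).2.2 from
    (snd.comp _ _ snd).comp _ (fun r : Rule => (r.head, r.pos, r.neg)) (id.congr_rep fun _ => rfl))

@[fun_prop]
theorem rule_mk (f g h : α → List Atom) (hf : PolyFun f) (hg : PolyFun g) (hh : PolyFun h) :
    PolyFun fun x => Rule.mk (f x) (g x) (h x) :=
  (show PolyFun fun x => (f x, g x, h x) by fun_prop).congr_rep fun _ => rfl

end PolyFun

/-! ### Parsing circuits -/

/-- A node as a symbol and a list of inputs. -/
def Node.raw : Node → CircuitSymbol × List ℕ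
  | .ex => (.ex, [])
  | .all => (.all, [])
  | .and l => (.and, l)
  | .or l => (.or, l)
  | .not i => (.not, [i])

/-- Read a symbol of the word of a circuit, from right to left. The state consists of the positions
that have been read after the last complete node, and of the complete nodes. -/
def circuitStep (s : CircuitSymbol) (st : Option (List ℕ × List (CircuitSymbol × List ℕ))) :
    Option (List ℕ × List (CircuitSymbol × List ℕ)) :=
  st.elim none fun p =>
    -- From right to left, the end marker of a position comes first. It opens the position 0, which
    -- the symbols `one` then increase.
    if s = .sep then some (0 :: p.1, p.2)
    else if s = .one then
      listElim p.1 none fun n l => some ((n + 1) :: l, p.2)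
    -- The arity check: any number of inputs for conjunctions and disjunctions, none for variables,
    -- one for negations.
    else if (s = .and ∨ s = .or) ∨ ((s = .ex ∨ s = .all) ∧ p.1 = []) ∨ (s = .not ∧ p.1.length = 1) then
      some ([], (s, p.1) :: p.2)
    else none

/-- The nodes of the circuit with a given word. -/
def parseCircuit (w : List CircuitSymbol) : Option (List (CircuitSymbol × List ℕ)) :=
  (w.foldr circuitStep (some ([], []))).elim none fun p => if p.1 = [] then some p.2 else none

theorem foldr_circuitStep_positionWord (c : ℕ) (l ns) :
    (positionWord c).foldr circuitStep (some (l, ns)) = some (c :: l, ns) := by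
  rw [positionWord, List.foldr_append]
  induction c with
  | zero => rfl
  | succ c ih => rw [List.replicate_succ, List.foldr_cons, ih]; rfl

theorem foldr_circuitStep_positions (l m : List ℕ) (ns) :
    (l.flatMap positionWord).foldr circuitStep (some (m, ns)) = some (l ++ m, ns) := by
  induction l with
  | nil => rfl
  | cons c l ih =>
    rw [List.flatMap_cons, List.foldr_append, ih, foldr_circuitStep_positionWord]; rfl

theorem foldr_circuitStep_node (nd : Node) (ns) :
    nd.word.foldr circuitStep (some ([], ns)) = some ([], nd.raw :: ns) := by
  cases nd with
  | ex => rfl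
  | all => rfl
  | and l =>
    rw [Node.word, List.foldr_cons, foldr_circuitStep_positions]
    simp [circuitStep, Node.raw]
  | or l =>
    rw [Node.word, List.foldr_cons, foldr_circuitStep_positions]
    simp [circuitStep, Node.raw]
  | not i =>
    rw [Node.word, List.foldr_cons, foldr_circuitStep_positionWord]
    simp [circuitStep, Node.raw]

theorem parseCircuit_word (l : List Node) :
    parseCircuit (l.flatMap Node.word) = some (l.map Node.raw) := by
  have : (l.flatMap Node.word).foldr circuitStep (some ([], [])) = some ([], l.map Node.raw) := by
    induction l with
    | nil => rfl
    | cons nd l ih => rw [List.flatMap_cons, List.foldr_append, ih, foldr_circuitStep_node]; rfl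
  simp [parseCircuit, this]

/-- A state other than `none` determines the suffix that has been read: the words of the pending
positions, then those of the complete nodes. So the parser rejects everything that is not the word
of a list of nodes. -/
theorem foldr_circuitStep_eq_some : ∀ (w : List CircuitSymbol) (l ns),
    w.foldr circuitStep (some ([], [])) = some (l, ns) → ∃ nds : List Node, ns = nds.map Node.raw ∧
      w = l.flatMap positionWord ++ nds.flatMap Node.word
  | [], l, ns, h => by
    simp only [List.foldr_nil, Option.some.injEq, Prod.mk.injEq] at h
    exact ⟨[], by simp [← h.1, ← h.2]⟩
  | s :: w, l, ns, h => by
    rw [List.foldr_cons] at h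
    rcases hw : w.foldr circuitStep (some ([], [])) with _ | ⟨m, ns'⟩
    · rw [hw] at h; cases h
    · obtain ⟨nds, rfl, e⟩ := foldr_circuitStep_eq_some w m ns' hw
      rw [hw] at h
      subst e
      cases s with
      | sep =>
        simp [circuitStep] at h
        exact ⟨nds, h.2.symm, by simp [← h.1, positionWord]⟩
      | one =>
        cases m with
        | nil => simp [circuitStep] at h
        | cons n m =>
          simp [circuitStep] at h
          exact ⟨nds, h.2.symm, by simp [← h.1, positionWord, List.replicate_succ]⟩
      | ex =>
        simp [circuitStep] at h
        exact ⟨.ex :: nds, by simp [← h.2.2, h.1, Node.raw], by simp [h.2.1, h.1, Node.word]⟩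
      | all =>
        simp [circuitStep] at h
        exact ⟨.all :: nds, by simp [← h.2.2, h.1, Node.raw], by simp [h.2.1, h.1, Node.word]⟩
      | and =>
        simp [circuitStep] at h
        exact ⟨.and m :: nds, by simp [← h.2, Node.raw], by simp [h.1, Node.word]⟩
      | or =>
        simp [circuitStep] at h
        exact ⟨.or m :: nds, by simp [← h.2, Node.raw], by simp [h.1, Node.word]⟩
      | not =>
        simp [circuitStep] at h
        obtain ⟨i, rfl⟩ := List.length_eq_one_iff.1 h.1
        exact ⟨.not i :: nds, by simp [← h.2.2, Node.raw], by simp [h.2.1, Node.word]⟩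

theorem parseCircuit_eq_some {w : List CircuitSymbol} {ns} (h : parseCircuit w = some ns) :
    ∃ nds : List Node, ns = nds.map Node.raw ∧ w = nds.flatMap Node.word := by
  rcases hw : w.foldr circuitStep (some ([], [])) with _ | ⟨m, ns'⟩
  · simp [parseCircuit, hw] at h
  · obtain ⟨nds, e, e'⟩ := foldr_circuitStep_eq_some w m ns' hw
    simp [parseCircuit, hw] at h
    obtain ⟨rfl, rfl⟩ := h
    exact ⟨nds, e, by simpa using e'⟩

/-- Each symbol enlarges the state by a bounded amount only, which gives the linear size bound
required for the fold. -/
theorem polyFun_parseCircuit : PolyFun parseCircuit := by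
  obtain ⟨B, hB⟩ := exists_size_le (A := CircuitSymbol)
  have h1 : PolyFun fun w : List CircuitSymbol => w.foldr circuitStep (some ([], [])) := by
    refine PolyFun.foldr (fun w => w) (fun _ => some ([], [])) (fun _ => circuitStep) (by fun_prop)
      (by fun_prop) ?_ (C (B + 5) * X + 10) fun x l' h => ?_
    · unfold circuitStep
      fun_prop
    · have key : ∀ w : List CircuitSymbol, size (w.foldr circuitStep (some ([], []))) ≤
          (B + 5) * w.length + 10 := by
        intro w
        induction w with
        | nil => simp
        | cons s w ih =>
          rw [List.foldr_cons, List.length_cons, Nat.mul_succ]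
          rcases hw : w.foldr circuitStep (some ([], [])) with _ | ⟨m, ns⟩
          · simp [circuitStep]
          · rw [hw] at ih
            have := hB s
            have := size_nat 0
            simp only [size_some, size_prod] at ih
            rcases m with _ | ⟨n, m⟩ <;> simp only [circuitStep, Option.elim_some, listElim_nil,
              listElim_cons] <;> split_ifs <;> simp [size_nat] at * <;> omega
      have h3 := key l'
      have h4 := h.sublist.length_le
      have h5 := length_lt_size x
      simp only [eval_add, eval_mul, eval_C, eval_X, eval_ofNat]
      have := Nat.mul_le_mul_left (B + 5) (h4.trans h5.le)
      omega
  unfold parseCircuit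
  fun_prop

/-! ### Parsing programs -/

/-- Read a symbol of the word of a list of rules, from right to left. -/
def ruleStep (s : ProgramSymbol) (st : Option (List Rule)) : Option (List Rule) :=
  st.elim none fun l =>
    if s = .ruleEnd then some (⟨[], [], []⟩ :: l)
    else
      listElim l none fun r l =>
        if s = .head then some (⟨[] :: r.head, r.pos, r.neg⟩ :: l)
        else if s = .pos then
          -- From right to left, the atoms of a rule have to come in the order negative, positive,
          -- head; a marker that violates this order is rejected.
          if r.head = [] then some (⟨[], [] :: r.pos, r.neg⟩ :: l) else none
        else if s = .neg then
          if r.head = [] ∧ r.pos = [] then some (⟨[], [], [] :: r.neg⟩ :: l) else none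
        else
          -- A bit belongs to the atom opened last. This is the first head atom if there is one,
          -- else the first positive one, else the first negative one.
          listElim r.head
            (listElim r.pos
              (listElim r.neg none fun a as =>
                some (⟨[], [], (decide (s = .bit true) :: a) :: as⟩ :: l))
              fun a as => some (⟨[], (decide (s = .bit true) :: a) :: as, r.neg⟩ :: l))
            fun a as => some (⟨(decide (s = .bit true) :: a) :: as, r.pos, r.neg⟩ :: l)

/-- The list of rules with a given word. -/
def parseRules (w : List ProgramSymbol) : Option (List Rule) := w.foldr ruleStep (some [])

theorem foldr_ruleStep_neg (n : List Atom) (l : List Rule) :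
    (n.flatMap (atomWord .neg)).foldr ruleStep (some (⟨[], [], []⟩ :: l)) =
      some (⟨[], [], n⟩ :: l) := by
  induction n with
  | nil => rfl
  | cons a n ih =>
    rw [List.flatMap_cons, List.foldr_append, ih, atomWord, List.foldr_append]
    induction a with
    | nil => rfl
    | cons b a iha =>
      rw [List.map_cons, List.foldr_cons, iha]
      cases b <;> rfl

theorem foldr_ruleStep_pos (p n : List Atom) (l : List Rule) :
    (p.flatMap (atomWord .pos)).foldr ruleStep (some (⟨[], [], n⟩ :: l)) =
      some (⟨[], p, n⟩ :: l) := by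
  induction p with
  | nil => rfl
  | cons a p ih =>
    rw [List.flatMap_cons, List.foldr_append, ih, atomWord, List.foldr_append]
    induction a with
    | nil => rfl
    | cons b a iha =>
      rw [List.map_cons, List.foldr_cons, iha]
      cases b <;> rfl

theorem foldr_ruleStep_head (h p n : List Atom) (l : List Rule) :
    (h.flatMap (atomWord .head)).foldr ruleStep (some (⟨[], p, n⟩ :: l)) =
      some (⟨h, p, n⟩ :: l) := by
  induction h with
  | nil => rfl
  | cons a h ih =>
    rw [List.flatMap_cons, List.foldr_append, ih, atomWord, List.foldr_append]
    induction a with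
    | nil => rfl
    | cons b a iha =>
      rw [List.map_cons, List.foldr_cons, iha]
      cases b <;> rfl

theorem parseRules_rulesWord (l : List Rule) : parseRules (rulesWord l) = some l := by
  induction l with
  | nil => rfl
  | cons r l ih =>
    rw [parseRules, rulesWord, List.flatMap_cons, List.foldr_append]
    rw [parseRules, rulesWord] at ih
    rw [ih, Rule.word, List.foldr_append, List.foldr_append, List.foldr_append]
    have h := foldr_ruleStep_neg r.neg l
    have h' : List.foldr ruleStep (some l) [.ruleEnd] = some (⟨[], [], []⟩ :: l) := rfl
    rw [h', h, foldr_ruleStep_pos, foldr_ruleStep_head]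

theorem parseRules_eq_some : ∀ {w : List ProgramSymbol} {l : List Rule}, parseRules w = some l →
    w = rulesWord l
  | [], l, h => by
    simp only [parseRules, List.foldr_nil, Option.some.injEq] at h
    simp [← h, rulesWord]
  | s :: w, l, h => by
    rcases hw : parseRules w with _ | m
    · rw [parseRules, List.foldr_cons, ← parseRules, hw] at h; cases h
    · rw [parseRules, List.foldr_cons, ← parseRules, hw] at h
      rw [parseRules_eq_some hw]
      cases s with
      | ruleEnd =>
        simp [ruleStep] at h
        simp [← h, rulesWord, Rule.word]
      | head =>
        rcases m with _ | ⟨r, m⟩ <;> simp [ruleStep] at h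
        simp [← h, rulesWord, Rule.word, atomWord]
      | pos =>
        rcases m with _ | ⟨⟨h, p, n⟩, m⟩ <;> simp [ruleStep] at h
        simp [← h.2, h.1, rulesWord, Rule.word, atomWord]
      | neg =>
        rcases m with _ | ⟨⟨h, p, n⟩, m⟩ <;> simp [ruleStep] at h
        simp [← h.2, h.1.1, h.1.2, rulesWord, Rule.word, atomWord]
      | bit b =>
        rcases m with _ | ⟨⟨_ | ⟨a, h⟩, p, n⟩, m⟩
        · simp [ruleStep] at h
        · rcases p with _ | ⟨a, p⟩
          · rcases n with _ | ⟨a, n⟩ <;> simp [ruleStep] at h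
            simp [← h, rulesWord, Rule.word, atomWord]
          · simp [ruleStep] at h
            simp [← h, rulesWord, Rule.word, atomWord]
        · simp [ruleStep] at h
          simp [← h, rulesWord, Rule.word, atomWord]

theorem polyFun_parseRules : PolyFun parseRules := by
  unfold parseRules
  refine PolyFun.foldr (fun w => w) (fun _ => some []) (fun _ => ruleStep) (by fun_prop)
    (by fun_prop) ?_ (10 * X + 10) fun x l' h => ?_
  · unfold ruleStep
    fun_prop
  · have hsb : ∀ b : Bool, size b ≤ 3 := by intro b; cases b <;> decide
    have key : ∀ w : List ProgramSymbol, size (w.foldr ruleStep (some [])) ≤ 10 * w.length + 10 := by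
      intro w
      induction w with
      | nil => simp
      | cons s w ih =>
        rw [List.foldr_cons, List.length_cons, Nat.mul_succ]
        rcases hw : w.foldr ruleStep (some []) with _ | m
        · simp [ruleStep]
        · rw [hw] at ih
          have := hsb (decide (s = .bit true))
          simp only [ruleStep, Option.elim_some]
          simp only [size_some] at ih
          split
          · simp [size_rule]; omega
          · rcases m with _ | ⟨⟨h, p, n⟩, m⟩
            · simp
            · simp only [size_cons, size_rule] at ih
              rcases h with _ | ⟨a, h⟩ <;> rcases p with _ | ⟨a', p⟩ <;> rcases n with _ | ⟨a'', n⟩ <;>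
                simp only [listElim_nil, listElim_cons] <;> split_ifs <;>
                simp [size_rule] at * <;> omega
    have h3 := key l'
    have h4 := h.sublist.length_le
    have h5 := length_lt_size x
    simp only [eval_add, eval_mul, eval_X, eval_ofNat]
    omega

end ParamASP

namespace ParamASP

open Function Polynomial TreeRep

/-! ### Values of the nodes of a circuit -/

theorem Node.eval_congr {a : Bool} {v w : ℕ → Bool} {nd : Node} (h : ∀ j ∈ nd.inputs, v j = w j) :
    nd.eval a v = nd.eval a w := by
  cases nd with
  | ex => rfl
  | all => rfl
  | and l =>
    rw [Bool.eq_iff_iff, Node.eval, Node.eval, List.all_eq_true, List.all_eq_true]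
    exact forall₂_congr fun j hj => by rw [h j hj]
  | or l =>
    rw [Bool.eq_iff_iff, Node.eval, Node.eval, List.any_eq_true, List.any_eq_true]
    exact exists_congr fun j => and_congr_right fun hj => by rw [h j hj]
  | not i => simp [Node.eval, h i (by simp [Node.inputs])]

theorem nodeValues_concat (A : Finset ℕ) (l : List Node) (nd : Node) :
    nodeValues A (l ++ [nd]) = nodeValues A l ++
      [nd.eval (decide ((nodeValues A l).length ∈ A)) fun j => (nodeValues A l).getD j false] := by
  simp [nodeValues]

theorem length_nodeValues (A : Finset ℕ) (l : List Node) : (nodeValues A l).length = l.length := by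
  induction l using List.reverseRecOn with
  | nil => rfl
  | append_singleton l nd ih => simp [nodeValues_concat, ih]

/-- Values are appended at the end, so a value once computed never changes. By acyclicity a node
reads only such values, and hence the final list satisfies the local equation of every node. -/
theorem getD_nodeValues (A : Finset ℕ) (l : List Node)
    (hl : ∀ (i : ℕ) (h : i < l.length), ∀ j ∈ (l[i]).inputs, j < i) (i : ℕ) (h : i < l.length) :
    (nodeValues A l).getD i false =
      (l[i]).eval (decide (i ∈ A)) fun j => (nodeValues A l).getD j false := by
  induction l using List.reverseRecOn with
  | nil => simp at h
  | append_singleton l nd ih =>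
    have hlen := length_nodeValues A l
    have hold : ∀ j < l.length, (nodeValues A (l ++ [nd])).getD j false =
        (nodeValues A l).getD j false := by
      intro j hj
      rw [nodeValues_concat, List.getD_append _ _ _ _ (by omega)]
    have hin := hl i h
    rcases Nat.lt_or_ge i l.length with hi | hi
    · rw [List.getElem_append_left hi] at hin ⊢
      rw [hold i hi, ih (fun i h' => ?_) hi]
      · exact Node.eval_congr fun j hj => (hold j ((hin j hj).trans hi)).symm
      · have := hl i (by simp; omega)
        rwa [List.getElem_append_left h'] at this
    · obtain rfl : i = l.length := by simp at h; omega
      rw [List.getElem_concat_length] at hin ⊢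
      · conv_lhs => rw [nodeValues_concat, List.getD_append_right _ _ _ _ (by omega)]
        simp only [hlen, Nat.sub_self, List.getD_cons_zero]
        exact Node.eval_congr fun j hj => (hold j (hin j hj)).symm
      · rfl
      · rfl

namespace Circuit

theorem satisfies_iff_getD (C : Circuit) (A : Finset ℕ) :
    C.Satisfies A ↔ (nodeValues A C.nodes).getD (C.nodes.length - 1) false = true := by
  have := List.length_pos_iff.2 C.nonempty
  rw [Satisfies, List.getLast?_eq_getElem?, length_nodeValues, List.getD_eq_getElem?_getD]
  rw [List.getElem?_eq_getElem (by rw [length_nodeValues]; omega)]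
  simp

/-- In an acyclic circuit the local equations have only one solution on the nodes, so any solution
`f` gives the true value of the output. -/
theorem satisfies_iff (C : Circuit) (A : Finset ℕ) (f : ℕ → Bool)
    (hf : ∀ (i : ℕ) (h : i < C.nodes.length), f i = (C.nodes[i]).eval (decide (i ∈ A)) f) :
    C.Satisfies A ↔ f (C.nodes.length - 1) = true := by
  have key : ∀ i < C.nodes.length, (nodeValues A C.nodes).getD i false = f i := by
    intro i
    induction i using Nat.strong_induction_on with
    | _ i ih =>
      intro h
      rw [getD_nodeValues A C.nodes C.acyclic i h, hf i h]
      exact Node.eval_congr fun j hj =>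
        have hj := C.acyclic i h j hj
        ih j hj (hj.trans h)
  have := List.length_pos_iff.2 C.nonempty
  rw [satisfies_iff_getD, key _ (by omega)]

end Circuit

/-! ### Circuits with named nodes -/

/-- A gate of a circuit, with the names of its inputs. -/
inductive Gate (ν : Type) where
  | and (inputs : List ν) : Gate ν
  | or (inputs : List ν) : Gate ν
  | not (input : ν) : Gate ν

namespace Gate
variable {ν : Type}

/-- A gate as a symbol and a list of inputs. -/
def raw : Gate ν → CircuitSymbol × List ν
  | .and l => (.and, l)
  | .or l => (.or, l)
  | .not u => (.not, [u])

theorem raw_injective : Injective (raw (ν := ν)) := by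
  intro g h e
  cases g <;> cases h <;> simp_all [raw]

noncomputable instance [TreeRep ν] : TreeRep (Gate ν) := ofInjective raw raw_injective

/-- The names of the inputs of a gate. -/
def inputs (g : Gate ν) : List ν := g.raw.2

/-- The node for a gate, where inputs have the given positions. -/
def toNode (f : ν → ℕ) : Gate ν → Node
  | .and l => .and (l.map f)
  | .or l => .or (l.map f)
  | .not u => .not (f u)

theorem word_toNode (f : ν → ℕ) (g : Gate ν) :
    (g.toNode f).word = g.raw.1 :: g.raw.2.flatMap fun u => positionWord (f u) := by
  cases g <;> simp [toNode, raw, Node.word, List.flatMap_map]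

theorem inputs_toNode (f : ν → ℕ) (g : Gate ν) : (g.toNode f).inputs = g.inputs.map f := by
  cases g <;> rfl

/-- The value of a gate if the values of the inputs are given by `p`. -/
def Holds (p : ν → Prop) : Gate ν → Prop
  | .and l => ∀ u ∈ l, p u
  | .or l => ∃ u ∈ l, p u
  | .not u => ¬p u

open Classical in
theorem eval_toNode (f : ν → ℕ) (g : Gate ν) (a : Bool) (v : ℕ → Bool) (p : ν → Prop)
    (h : ∀ u ∈ g.inputs, v (f u) = decide (p u)) :
    (g.toNode f).eval a v = decide (g.Holds p) := by
  cases g with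
  | and l =>
    rw [Bool.eq_iff_iff, toNode, Node.eval, List.all_map, List.all_eq_true, decide_eq_true_iff]
    exact forall₂_congr fun j hj => by simp [h j hj]
  | or l =>
    rw [Bool.eq_iff_iff, toNode, Node.eval, List.any_map, List.any_eq_true, decide_eq_true_iff]
    exact exists_congr fun j => and_congr_right fun hj => by simp [h j hj]
  | not u =>
    rw [toNode, Node.eval, h u (by simp [inputs, raw]), Bool.eq_iff_iff, decide_eq_true_iff]
    simp [Holds]

end Gate

/-- The inputs of each gate are in `s` or names of earlier gates. -/
def Ordered {ν : Type} : Set ν → List (ν × Gate ν) → Prop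
  | _, [] => True
  | s, g :: l => (∀ u ∈ g.2.inputs, u ∈ s) ∧ Ordered (insert g.1 s) l

namespace Ordered
variable {ν : Type}

theorem append {s : Set ν} {l m : List (ν × Gate ν)} (hl : Ordered s l)
    (hm : Ordered (s ∪ {u | u ∈ l.map Prod.fst}) m) : Ordered s (l ++ m) := by
  induction l generalizing s with
  | nil => simpa using hm
  | cons g l ih =>
    refine ⟨hl.1, ih hl.2 ?_⟩
    convert hm using 1
    ext u
    simp only [Set.mem_union, Set.mem_insert_iff, Set.mem_ofPred_eq, List.map_cons, List.mem_cons]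
    tauto

theorem of_forall {s : Set ν} {l : List (ν × Gate ν)} (h : ∀ g ∈ l, ∀ u ∈ g.2.inputs, u ∈ s) :
    Ordered s l := by
  induction l generalizing s with
  | nil => trivial
  | cons g l ih =>
    exact ⟨h g (by simp), ih fun g' hg' u hu => Or.inr (h g' (by simp [hg']) u hu)⟩

theorem flatMap_range {s : Set ν} {f : ℕ → List (ν × Gate ν)} (n : ℕ)
    (h : ∀ t < n, Ordered (s ∪ {u | u ∈ ((List.range t).flatMap f).map Prod.fst}) (f t)) :
    Ordered s ((List.range n).flatMap f) := by
  induction n with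
  | zero => trivial
  | succ n ih =>
    rw [List.range_succ, List.flatMap_append]
    refine (ih fun t ht => h t (by omega)).append ?_
    simpa using h n (by omega)

theorem inputs_getElem {s : Set ν} {l : List (ν × Gate ν)} (hl : Ordered s l) (i : ℕ)
    (h : i < l.length) : ∀ u ∈ (l[i]).2.inputs, u ∈ s ∨ u ∈ (l.take i).map Prod.fst := by
  induction l generalizing s i with
  | nil => simp at h
  | cons g l ih =>
    intro u hu
    cases i with
    | zero => exact .inl (hl.1 u hu)
    | succ i =>
      rcases ih hl.2 i (by simpa using h) u hu with (h' | h') | h'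
      · simp [h']
      · exact .inl h'
      · right
        rw [List.take_succ_cons, List.map_cons]
        exact List.mem_cons_of_mem _ h'

end Ordered

/-- A circuit with named variables and gates. -/
structure NamedCircuit (ν : Type) where
  /-- the existential variables -/
  ex : List ν
  /-- the universal variables -/
  all : List ν
  /-- the gates, in a topological order -/
  gates : List (ν × Gate ν)
  /-- the output gate -/
  out : ν × Gate ν
  -- Only variables need distinct names. Repeated gate names are harmless: references go to the
  -- first occurrence, and correctness is stated through a predicate on names that satisfies the
  -- equations of all gates.
  nodup : (ex ++ all).Nodup
  ordered : Ordered {u | u ∈ ex ++ all} (gates ++ [out])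

/-- The word for a circuit with named variables and gates. -/
def gatesWord {ν : Type} [DecidableEq ν] (ex all : List ν) (gates : List (ν × Gate ν)) :
    List CircuitSymbol :=
  ex.map (fun _ => .ex) ++ (all.map (fun _ => .all) ++
    gates.flatMap fun g => g.2.raw.1 :: g.2.raw.2.flatMap fun u =>
      positionWord ((ex ++ all ++ gates.map fun g => g.1).idxOf u))

namespace NamedCircuit
variable {ν : Type} [DecidableEq ν] (C : NamedCircuit ν)

/-- The names of the nodes. -/
def names : List ν := C.ex ++ C.all ++ (C.gates ++ [C.out]).map fun g => g.1

/-- The nodes. -/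
def nodes : List Node :=
  C.ex.map (fun _ => .ex) ++ (C.all.map (fun _ => .all) ++
    (C.gates ++ [C.out]).map fun g => g.2.toNode C.names.idxOf)

theorem length_nodes : C.nodes.length = C.names.length := by
  simp [nodes, names]

theorem nodes_cases (i : ℕ) (h : i < C.nodes.length) :
    (∃ h' : i < C.ex.length, C.nodes[i] = .ex ∧ C.names[i]'(by rw [← length_nodes]; exact h) = C.ex[i]) ∨
    (∃ j, ∃ h' : j < C.all.length, i = C.ex.length + j ∧ C.nodes[i] = .all ∧
      C.names[i]'(by rw [← length_nodes]; exact h) = C.all[j]) ∨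
    (∃ j, ∃ h' : j < (C.gates ++ [C.out]).length, i = C.ex.length + C.all.length + j ∧
      C.nodes[i] = ((C.gates ++ [C.out])[j]).2.toNode C.names.idxOf ∧
      C.names[i]'(by rw [← length_nodes]; exact h) = ((C.gates ++ [C.out])[j]).1) := by
  rcases Nat.lt_or_ge i C.ex.length with h1 | h1
  · left
    refine ⟨h1, ?_, ?_⟩
    · simp only [nodes]
      rw [List.getElem_append_left (by simpa using h1)]
      simp
    · simp only [names]
      rw [List.getElem_append_left (by simp; omega), List.getElem_append_left (by simpa using h1)]
  · right
    rcases Nat.lt_or_ge i (C.ex.length + C.all.length) with h2 | h2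
    · left
      refine ⟨i - C.ex.length, by omega, by omega, ?_, ?_⟩
      · simp only [nodes]
        rw [List.getElem_append_right (by simpa using h1),
          List.getElem_append_left (by simp; omega)]
        simp
      · simp only [names]
        rw [List.getElem_append_left (by simp; omega), List.getElem_append_right (by simpa using h1)]
    · right
      have hlen : C.nodes.length = C.ex.length + C.all.length + (C.gates ++ [C.out]).length := by
        simp [nodes]; omega
      refine ⟨i - (C.ex.length + C.all.length), by omega, by omega, ?_, ?_⟩
      · simp only [nodes]
        rw [List.getElem_append_right (by simp; omega), List.getElem_append_right (by simp; omega),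
          List.getElem_map]
        congr 3
        simp
        omega
      · simp only [names]
        rw [List.getElem_append_right (by simp; omega), List.getElem_map]
        congr 2
        simp

/-- Every input name occurs among the variables and the earlier gates, and `idxOf` finds its first
occurrence. This makes the translated circuit acyclic. -/
theorem idxOf_lt (j : ℕ) (h : j < (C.gates ++ [C.out]).length) (u : ν)
    (hu : u ∈ ((C.gates ++ [C.out])[j]).2.inputs) :
    C.names.idxOf u < C.ex.length + C.all.length + j := by
  have h' := C.ordered.inputs_getElem j h u hu
  have hsplit : C.names = C.ex ++ C.all ++ ((C.gates ++ [C.out]).take j).map (fun g => g.1) ++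
      ((C.gates ++ [C.out]).drop j).map (fun g => g.1) := by
    rw [names, List.append_assoc (C.ex ++ C.all), ← List.map_append, List.take_append_drop]
  have hmem : u ∈ C.ex ++ C.all ++ ((C.gates ++ [C.out]).take j).map (fun g => g.1) := by
    rw [List.mem_append]
    exact h'
  rw [hsplit, List.idxOf_append_of_mem hmem]
  refine (List.idxOf_lt_length_iff.2 hmem).trans_le ?_
  rw [List.length_append, List.length_append, List.length_map, List.length_take]
  omega

/-- The circuit without names. -/
def toCircuit : Circuit where
  nodes := C.nodes
  nonempty := by simp [nodes]
  acyclic := by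
    intro i h j hj
    rcases C.nodes_cases i h with ⟨_, e, _⟩ | ⟨m, _, _, e, _⟩ | ⟨m, hm, hi, e, _⟩ <;> rw [e] at hj
    · simp [Node.inputs] at hj
    · simp [Node.inputs] at hj
    · rw [Gate.inputs_toNode, List.mem_map] at hj
      obtain ⟨u, hu, rfl⟩ := hj
      exact (C.idxOf_lt m hm u hu).trans_eq hi.symm

theorem word_toCircuit : C.toCircuit.word = gatesWord C.ex C.all (C.gates ++ [C.out]) := by
  simp only [Circuit.word, toCircuit, nodes, gatesWord, List.flatMap_append, List.flatMap_map,
    Gate.word_toNode, names]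
  simp [Node.word, ← List.map_eq_flatMap]

theorem idxOf_getElem (i : ℕ) (h : i < C.names.length) (h' : i < C.ex.length + C.all.length) :
    C.names.idxOf C.names[i] = i := by
  have h'' : i < (C.ex ++ C.all).length := by simpa using h'
  have e : C.names[i] = (C.ex ++ C.all)[i] := by
    simp only [names]
    rw [List.getElem_append_left h'']
  rw [e, names, List.idxOf_append_of_mem (List.getElem_mem _), C.nodup.idxOf_getElem]

open Classical in
-- A predicate on names that agrees with the assignment on the variables and satisfies all gate
-- equations has to be the evaluation of the circuit. Semantic descriptions of the gates can thus
-- replace any computation with positions.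
theorem satisfies_iff (A : Finset ℕ) (p : ν → Prop) (hex : ∀ u ∈ C.ex, p u ↔ C.names.idxOf u ∈ A)
    (hall : ∀ u ∈ C.all, p u ↔ C.names.idxOf u ∈ A)
    (hg : ∀ g ∈ C.gates ++ [C.out], p g.1 ↔ g.2.Holds p) : C.toCircuit.Satisfies A ↔ p C.out.1 := by
  have hlen := C.length_nodes
  rw [C.toCircuit.satisfies_iff A (fun i => if h : i < C.names.length then decide (p C.names[i])
    else false)]
  · have : C.toCircuit.nodes.length - 1 < C.names.length := by
      have := List.length_pos_iff.2 C.toCircuit.nonempty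
      change C.nodes.length - 1 < _
      change 0 < C.nodes.length at this
      omega
    rw [dif_pos this, decide_eq_true_iff]
    have : C.names[C.toCircuit.nodes.length - 1] = C.out.1 := by
      have hl : C.names.length = (C.ex ++ C.all ++ C.gates.map fun g => g.1).length + 1 := by
        simp [names]; omega
      have e : C.names = (C.ex ++ C.all ++ C.gates.map fun g => g.1) ++ [C.out.1] := by
        simp [names]
      rw [List.getElem_of_eq e, List.getElem_concat_length]
      change C.nodes.length - 1 = _
      omega
    rw [this]
  · intro i h
    change i < C.nodes.length at h
    change _ = Node.eval _ _ C.nodes[i]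
    rw [dif_pos (by omega)]
    rcases C.nodes_cases i h with ⟨hi, e, e'⟩ | ⟨m, hm, hi, e, e'⟩ | ⟨m, hm, hi, e, e'⟩
    · have := C.idxOf_getElem i (by omega) (by omega)
      rw [e, Node.eval, decide_eq_decide, e', hex _ (List.getElem_mem _), ← e', this]
    · have := C.idxOf_getElem i (by omega) (by omega)
      rw [e, Node.eval, decide_eq_decide, e', hall _ (List.getElem_mem _), ← e', this]
    · have hv : ∀ u ∈ ((C.gates ++ [C.out])[m]).2.inputs,
          (if h : C.names.idxOf u < C.names.length then decide (p C.names[C.names.idxOf u])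
            else false) = decide (p u) := by
        intro u hu
        have := C.idxOf_lt m hm u hu
        rw [dif_pos (by omega), List.getElem_idxOf]
      rw [e, e', Gate.eval_toNode _ _ _ _ p hv, decide_eq_decide]
      exact hg _ (List.getElem_mem _)

theorem idxOf_injOn : Set.InjOn C.names.idxOf {u | u ∈ C.names} := fun _ hu _ _ h =>
  (List.idxOf_inj hu).1 h

omit [DecidableEq ν] in
theorem mem_names {u : ν} (h : u ∈ C.ex ∨ u ∈ C.all) : u ∈ C.names := by
  rw [names, List.mem_append, List.mem_append]
  exact .inl h

theorem mem_exVars (i : ℕ) : i ∈ C.toCircuit.exVars ↔ ∃ u ∈ C.ex, C.names.idxOf u = i := by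
  have hlen := C.length_nodes
  rw [Circuit.exVars, Finset.mem_filter, Finset.mem_range]
  change i < C.nodes.length ∧ C.nodes[i]? = _ ↔ _
  constructor
  · rintro ⟨h, h'⟩
    rw [List.getElem?_eq_getElem h, Option.some_inj] at h'
    rcases C.nodes_cases i h with ⟨hi, e, e'⟩ | ⟨m, hm, hi, e, e'⟩ | ⟨m, hm, hi, e, e'⟩
    · exact ⟨_, List.getElem_mem hi, by rw [← e', C.idxOf_getElem i (by omega) (by omega)]⟩
    · rw [e] at h'; cases h'
    · rw [e] at h'
      cases hh : ((C.gates ++ [C.out])[m]).2 <;> rw [hh] at h' <;> cases h'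
  · rintro ⟨u, hu, rfl⟩
    obtain ⟨i, hi, rfl⟩ := List.getElem_of_mem hu
    have hn : i < C.nodes.length := by simp [nodes]; omega
    rcases C.nodes_cases i hn with ⟨hi', e, e'⟩ | ⟨m, hm, hi', e, e'⟩ | ⟨m, hm, hi', e, e'⟩
    · rw [← e', C.idxOf_getElem i (by omega) (by omega)]
      exact ⟨hn, by rw [List.getElem?_eq_getElem hn, e]⟩
    · omega
    · omega

theorem mem_allVars (i : ℕ) : i ∈ C.toCircuit.allVars ↔ ∃ u ∈ C.all, C.names.idxOf u = i := by
  have hlen := C.length_nodes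
  rw [Circuit.allVars, Finset.mem_filter, Finset.mem_range]
  change i < C.nodes.length ∧ C.nodes[i]? = _ ↔ _
  constructor
  · rintro ⟨h, h'⟩
    rw [List.getElem?_eq_getElem h, Option.some_inj] at h'
    rcases C.nodes_cases i h with ⟨hi, e, e'⟩ | ⟨m, hm, hi, e, e'⟩ | ⟨m, hm, hi, e, e'⟩
    · rw [e] at h'; cases h'
    · exact ⟨_, List.getElem_mem hm, by rw [← e', C.idxOf_getElem i (by omega) (by omega)]⟩
    · rw [e] at h'
      cases hh : ((C.gates ++ [C.out])[m]).2 <;> rw [hh] at h' <;> cases h'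
  · rintro ⟨u, hu, rfl⟩
    obtain ⟨i, hi, rfl⟩ := List.getElem_of_mem hu
    have hn : C.ex.length + i < C.nodes.length := by simp [nodes]; omega
    rcases C.nodes_cases _ hn with ⟨hi', e, e'⟩ | ⟨m, hm, hi', e, e'⟩ | ⟨m, hm, hi', e, e'⟩
    · omega
    · obtain rfl : i = m := by omega
      rw [← e', C.idxOf_getElem _ (by omega) (by omega)]
      exact ⟨hn, by rw [List.getElem?_eq_getElem hn, e]⟩
    · omega

/-- Positions are injective on names, so assignments to positions and sets of names correspond to
each other with equal weights. Existential and universal positions are disjoint, so the two parts of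
`A ∪ B` can be recovered. -/
theorem existsForallWeight_iff (p : Finset ν → Finset ν → ν → Prop)
    (hex : ∀ S T, ∀ u ∈ C.ex, p S T u ↔ u ∈ S) (hall : ∀ S T, ∀ u ∈ C.all, p S T u ↔ u ∈ T)
    (hg : ∀ S T, ∀ g ∈ C.gates ++ [C.out], p S T g.1 ↔ g.2.Holds (p S T)) (k : ℕ) :
    C.toCircuit.ExistsForallWeight k ↔
      ∃ S ⊆ C.ex.toFinset, ∀ T ⊆ C.all.toFinset, T.card = k → p S T C.out.1 := by
  have hne : ∀ u ∈ C.ex, ∀ w ∈ C.all, C.names.idxOf u ≠ C.names.idxOf w := by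
    intro u hu w hw h
    have := C.idxOf_injOn (C.mem_names (.inl hu)) (C.mem_names (.inr hw)) h
    exact (List.nodup_append.1 C.nodup).2.2 u hu w hw this
  constructor
  · rintro ⟨A, hA, h⟩
    refine ⟨C.ex.toFinset.filter (C.names.idxOf · ∈ A), Finset.filter_subset _ _,
      fun T hT hk => ?_⟩
    have hT' : ∀ w ∈ T, w ∈ C.all := fun w hw => List.mem_toFinset.1 (hT hw)
    have hB : T.image C.names.idxOf ⊆ C.toCircuit.allVars := by
      intro i hi
      obtain ⟨u, hu, rfl⟩ := Finset.mem_image.1 hi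
      exact (C.mem_allVars _).2 ⟨u, hT' u hu, rfl⟩
    have hinj : Set.InjOn C.names.idxOf T :=
      C.idxOf_injOn.mono fun u hu => C.mem_names (.inr (hT' u hu))
    rw [← C.satisfies_iff (A ∪ T.image C.names.idxOf) (p _ T) (fun u hu => ?_) (fun u hu => ?_)
      (hg _ _)]
    · exact h _ hB (by rw [Finset.card_image_of_injOn hinj, hk])
    · rw [hex _ _ u hu, Finset.mem_filter, List.mem_toFinset, Finset.mem_union, Finset.mem_image]
      refine ⟨fun h => .inl h.2, fun h => ⟨hu, h.resolve_right ?_⟩⟩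
      rintro ⟨w, hw, e⟩
      exact hne u hu w (hT' w hw) e.symm
    · rw [hall _ _ u hu, Finset.mem_union, Finset.mem_image]
      refine ⟨fun h => .inr ⟨u, h, rfl⟩, fun h => ?_⟩
      rcases h with h | ⟨w, hw, e⟩
      · obtain ⟨w, hw, e⟩ := (C.mem_exVars _).1 (hA h)
        exact absurd e (hne w hw u hu)
      · rwa [← C.idxOf_injOn (C.mem_names (.inr (hT' w hw))) (C.mem_names (.inr hu)) e]
  · rintro ⟨S, hS, h⟩
    have hS' : ∀ w ∈ S, w ∈ C.ex := fun w hw => List.mem_toFinset.1 (hS hw)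
    refine ⟨S.image C.names.idxOf, fun i hi => ?_, fun B hB hk => ?_⟩
    · obtain ⟨u, hu, rfl⟩ := Finset.mem_image.1 hi
      exact (C.mem_exVars _).2 ⟨u, hS' u hu, rfl⟩
    · have hT' : ∀ w ∈ C.all.toFinset.filter (C.names.idxOf · ∈ B), w ∈ C.all := fun w hw =>
        List.mem_toFinset.1 (Finset.mem_filter.1 hw).1
      have hinj : Set.InjOn C.names.idxOf (C.all.toFinset.filter (C.names.idxOf · ∈ B)) :=
        C.idxOf_injOn.mono fun u hu => C.mem_names (.inr (hT' u hu))
      have himg : (C.all.toFinset.filter (C.names.idxOf · ∈ B)).image C.names.idxOf = B := by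
        ext i
        rw [Finset.mem_image]
        constructor
        · rintro ⟨u, hu, rfl⟩
          exact (Finset.mem_filter.1 hu).2
        · intro hi
          obtain ⟨u, hu, rfl⟩ := (C.mem_allVars _).1 (hB hi)
          exact ⟨u, Finset.mem_filter.2 ⟨List.mem_toFinset.2 hu, hi⟩, rfl⟩
      rw [C.satisfies_iff _ (p S (C.all.toFinset.filter (C.names.idxOf · ∈ B))) (fun u hu => ?_)
        (fun u hu => ?_) (hg _ _)]
      · refine h _ (Finset.filter_subset _ _) ?_
        rw [← Finset.card_image_of_injOn hinj, himg, hk]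
      · rw [hex _ _ u hu, Finset.mem_union, Finset.mem_image]
        refine ⟨fun h => .inl ⟨u, h, rfl⟩, fun h => ?_⟩
        rcases h with ⟨w, hw, e⟩ | h
        · rwa [← C.idxOf_injOn (C.mem_names (.inl (hS' w hw))) (C.mem_names (.inl hu)) e]
        · obtain ⟨w, hw, e⟩ := (C.mem_allVars _).1 (hB h)
          exact absurd e.symm (hne u hu w hw)
      · rw [hall _ _ u hu, Finset.mem_filter, List.mem_toFinset, Finset.mem_union, Finset.mem_image]
        refine ⟨fun h => .inr h.2, fun h => ⟨hu, h.resolve_left ?_⟩⟩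
        rintro ⟨w, hw, e⟩
        exact hne w (hS' w hw) u hu e

end NamedCircuit

theorem PolyFun.gatesWord {α ν : Type} [TreeRep α] [TreeRep ν] [DecidableEq ν]
    (ex all : α → List ν) (gates : α → List (ν × Gate ν)) (h1 : PolyFun ex) (h2 : PolyFun all)
    (h3 : PolyFun gates) : PolyFun fun x => gatesWord (ex x) (all x) (gates x) := by
  have hraw : PolyFun (Gate.raw (ν := ν)) := id.congr_rep fun _ => rfl
  have hpos : PolyFun positionWord := by unfold positionWord; fun_prop
  unfold ParamASP.gatesWord
  fun_prop

end ParamASP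

/-! ### Membership: from programs to circuits -/

namespace ParamASP

open Function Polynomial TreeRep

namespace PolyFun
variable {α β : Type} [TreeRep α] [TreeRep β]

@[fun_prop]
theorem dedup [DecidableEq β] (l : α → List β) (hl : PolyFun l) : PolyFun fun x => (l x).dedup := by
  have key : ∀ m : List β, m.foldr (fun b m => if b ∈ m then m else b :: m) [] = m.dedup := by
    intro m
    induction m with
    | nil => rfl
    | cons b m ih =>
      rw [List.foldr_cons, ih]
      split_ifs with h
      · exact (List.dedup_cons_of_mem' h).symm
      · exact (List.dedup_cons_of_notMem' h).symm
  obtain ⟨q, hq⟩ := hl.size_le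
  refine (foldr l (fun _ => []) (fun _ b m => if b ∈ m then m else b :: m) hl (by fun_prop)
    (by fun_prop) q fun x l' h => ?_).congr_rep fun x => by rw [key]
  rw [key]
  exact (size_le_of_sublist ((List.dedup_sublist l').trans h.sublist)).trans (hq x)

@[fun_prop]
theorem decide_isDisjunctive (f : α → Rule) (hf : PolyFun f) :
    PolyFun fun x => decide (f x).IsDisjunctive := by
  have : (fun x => decide (f x).IsDisjunctive) =
      fun x => ParamASP.listElim (f x).head false fun _ l => !decide (l = []) := by
    funext x
    rcases h : (f x).head with _ | ⟨a, _ | ⟨b, l⟩⟩ <;> simp [Rule.IsDisjunctive, h]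
  rw [this]
  fun_prop

end PolyFun

/-! ### A circuit for the answer sets of a program -/

/-- The names of the nodes of the circuit for a program. -/
abbrev AspNode := ℕ × ℕ × Rule × Atom

namespace AspNode

/-- The atom `a` is in the candidate `M`. -/
abbrev x (a : Atom) : AspNode := (0, 0, ⟨[], [], []⟩, a)
/-- The atom `q.2` is selected from the head of the rule `q.1`. -/
abbrev y (q : Rule × Atom) : AspNode := (1, 0, q.1, q.2)
/-- The atom `a` is not in the candidate `M`. -/
abbrev nx (a : Atom) : AspNode := (2, 0, ⟨[], [], []⟩, a)
/-- The atom `a` is derived in `t` rounds. -/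
abbrev derived (t : ℕ) (a : Atom) : AspNode := (3, t, ⟨[], [], []⟩, a)
/-- The rule `q.1` derives `q.2` after `t` rounds. -/
abbrev fires (t : ℕ) (q : Rule × Atom) : AspNode := (4, t, q.1, q.2)
/-- The candidate `M` satisfies the rule `r`. -/
abbrev sat (r : Rule) : AspNode := (5, 0, r, [])
/-- An atom is selected from the head of the rule `r`. -/
abbrev selected (r : Rule) : AspNode := (6, 0, r, [])
/-- The atom `a` is derived, and it is not in `M`. -/
abbrev extra (a : Atom) : AspNode := (7, 0, ⟨[], [], []⟩, a)
/-- The atom `a` is derived, or it is not in `M`. -/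
abbrev covered (a : Atom) : AspNode := (8, 0, ⟨[], [], []⟩, a)
/-- All atoms of `M` are derived. -/
abbrev allCovered : AspNode := (9, 0, ⟨[], [], []⟩, [])
/-- An atom is selected from the head of each disjunctive rule. -/
abbrev valid : AspNode := (10, 0, ⟨[], [], []⟩, [])
/-- The selection is not valid. -/
abbrev invalid : AspNode := (11, 0, ⟨[], [], []⟩, [])
/-- The selection does not show that `M` is not minimal. -/
abbrev minimal : AspNode := (12, 0, ⟨[], [], []⟩, [])
/-- The output. -/
abbrev out : AspNode := (13, 0, ⟨[], [], []⟩, [])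

end AspNode

/-- The atoms of a program. -/
def atomsOf (P : List Rule) : List Atom := (P.flatMap fun r => r.head ++ (r.pos ++ r.neg)).dedup

/-- The rules with a chosen disjunct of the head. -/
def choicesOf (P : List Rule) : List (Rule × Atom) :=
  (P.flatMap fun r => r.head.map fun a => (r, a)).dedup

/-- The gates for round `t + 1` of the derivation of atoms. -/
def roundGates (P : List Rule) (t : ℕ) : List (AspNode × Gate AspNode) :=
  ((choicesOf P).map fun q => (AspNode.fires t q, Gate.and (q.1.pos.map (fun b => AspNode.derived t b) ++
    (q.1.neg.map (fun c => AspNode.nx c) ++ if q.1.IsDisjunctive then [AspNode.y q] else [])))) ++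
  (atomsOf P).map fun a => (AspNode.derived (t + 1) a, Gate.or (AspNode.derived t a ::
    ((choicesOf P).filter fun q => q.2 = a).map fun q => AspNode.fires t q))

/-- The gates that evaluate the result of the derivation. -/
def resultGates (P : List Rule) : List (AspNode × Gate AspNode) :=
  (P.map fun r => (AspNode.sat r, Gate.or (r.head.map (fun a => AspNode.x a) ++
    (r.pos.map (fun b => AspNode.nx b) ++ r.neg.map fun c => AspNode.x c)))) ++
  (((P.filter fun r => r.IsDisjunctive).map fun r =>
    (AspNode.selected r, Gate.or (r.head.map fun a => AspNode.y (r, a)))) ++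
  (((atomsOf P).map fun a => (AspNode.extra a,
    Gate.and [AspNode.derived ((atomsOf P).length + 1) a, AspNode.nx a])) ++
  (((atomsOf P).map fun a => (AspNode.covered a,
    Gate.or [AspNode.derived ((atomsOf P).length + 1) a, AspNode.nx a])) ++
  [(AspNode.allCovered, Gate.and ((atomsOf P).map fun a => AspNode.covered a)),
   (AspNode.valid, Gate.and ((P.filter fun r => r.IsDisjunctive).map fun r => AspNode.selected r)),
   (AspNode.invalid, Gate.not AspNode.valid),
   (AspNode.minimal, Gate.or (AspNode.invalid :: AspNode.allCovered ::
      (atomsOf P).map fun a => AspNode.extra a))])))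

/-- The gates of the circuit for a program, without the output. -/
def aspGates (P : List Rule) : List (AspNode × Gate AspNode) :=
  ((atomsOf P).map fun a => (AspNode.nx a, Gate.not (AspNode.x a))) ++
  (((atomsOf P).map fun a => (AspNode.derived 0 a, Gate.or [])) ++
  -- One round more than there are atoms, so that the derivation has certainly become stable.
  ((List.range ((atomsOf P).length + 1)).flatMap (fun t => roundGates P t) ++ resultGates P))

theorem mem_atomsOf {P : List Rule} {a : Atom} :
    a ∈ atomsOf P ↔ ∃ r ∈ P, a ∈ r.head ∨ a ∈ r.pos ∨ a ∈ r.neg := by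
  simp [atomsOf]

theorem mem_choicesOf {P : List Rule} {q : Rule × Atom} :
    q ∈ choicesOf P ↔ q.1 ∈ P ∧ q.2 ∈ q.1.head := by
  simp only [choicesOf, List.mem_dedup, List.mem_flatMap, List.mem_map]
  constructor
  · rintro ⟨r, hr, a, ha, rfl⟩
    exact ⟨hr, ha⟩
  · rintro ⟨hr, ha⟩
    exact ⟨_, hr, _, ha, rfl⟩

theorem ordered_roundGates (P : List Rule) (s : Set AspNode) (t : ℕ)
    (hy : ∀ q ∈ choicesOf P, AspNode.y q ∈ s) (hnx : ∀ a ∈ atomsOf P, AspNode.nx a ∈ s)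
    (hd : ∀ a ∈ atomsOf P, AspNode.derived t a ∈ s) : Ordered s (roundGates P t) := by
  refine (Ordered.of_forall fun g hg u hu => ?_).append (Ordered.of_forall fun g hg u hu => ?_)
  · obtain ⟨q, hq, rfl⟩ := List.mem_map.1 hg
    have hq' := mem_choicesOf.1 hq
    rcases List.mem_append.1 hu with h | h
    · obtain ⟨b, hb, rfl⟩ := List.mem_map.1 h
      exact hd b (mem_atomsOf.2 ⟨_, hq'.1, .inr (.inl hb)⟩)
    · rcases List.mem_append.1 h with h | h
      · obtain ⟨b, hb, rfl⟩ := List.mem_map.1 h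
        exact hnx b (mem_atomsOf.2 ⟨_, hq'.1, .inr (.inr hb)⟩)
      · split_ifs at h
        · rw [List.mem_singleton] at h
          exact h ▸ hy q hq
        · simp at h
  · obtain ⟨a, ha, rfl⟩ := List.mem_map.1 hg
    rcases List.mem_cons.1 hu with rfl | h
    · exact .inl (hd a ha)
    · obtain ⟨q, hq, rfl⟩ := List.mem_map.1 h
      right
      simp only [List.map_map, Set.mem_ofPred_eq, List.mem_map]
      exact ⟨q, (List.mem_filter.1 hq).1, rfl⟩

theorem ordered_resultGates (P : List Rule) (s : Set AspNode)
    (hx : ∀ a ∈ atomsOf P, AspNode.x a ∈ s)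
    (hy : ∀ q ∈ choicesOf P, AspNode.y q ∈ s) (hnx : ∀ a ∈ atomsOf P, AspNode.nx a ∈ s)
    (hd : ∀ a ∈ atomsOf P, AspNode.derived ((atomsOf P).length + 1) a ∈ s) :
    Ordered s (resultGates P ++
      [(AspNode.out, Gate.and (AspNode.minimal :: P.map fun r => AspNode.sat r))]) := by
  simp only [resultGates, List.append_assoc]
  refine (Ordered.of_forall fun g hg u hu => ?_).append
    ((Ordered.of_forall fun g hg u hu => ?_).append
    ((Ordered.of_forall fun g hg u hu => ?_).append
    ((Ordered.of_forall fun g hg u hu => ?_).append ?_)))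
  · obtain ⟨r, hr, rfl⟩ := List.mem_map.1 hg
    rcases List.mem_append.1 hu with h | h
    · obtain ⟨b, hb, rfl⟩ := List.mem_map.1 h
      exact hx b (mem_atomsOf.2 ⟨_, hr, .inl hb⟩)
    · rcases List.mem_append.1 h with h | h
      · obtain ⟨b, hb, rfl⟩ := List.mem_map.1 h
        exact hnx b (mem_atomsOf.2 ⟨_, hr, .inr (.inl hb)⟩)
      · obtain ⟨b, hb, rfl⟩ := List.mem_map.1 h
        exact hx b (mem_atomsOf.2 ⟨_, hr, .inr (.inr hb)⟩)
  · obtain ⟨r, hr, rfl⟩ := List.mem_map.1 hg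
    obtain ⟨b, hb, rfl⟩ := List.mem_map.1 hu
    exact .inl (hy _ (mem_choicesOf.2 ⟨(List.mem_filter.1 hr).1, hb⟩))
  · obtain ⟨a, ha, rfl⟩ := List.mem_map.1 hg
    simp only [Gate.inputs, Gate.raw, List.mem_cons, List.not_mem_nil, or_false] at hu
    rcases hu with rfl | rfl
    · exact .inl (.inl (hd a ha))
    · exact .inl (.inl (hnx a ha))
  · obtain ⟨a, ha, rfl⟩ := List.mem_map.1 hg
    simp only [Gate.inputs, Gate.raw, List.mem_cons, List.not_mem_nil, or_false] at hu
    rcases hu with rfl | rfl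
    · exact .inl (.inl (.inl (hd a ha)))
    · exact .inl (.inl (.inl (hnx a ha)))
  · simp only [List.cons_append, List.nil_append, Ordered, Gate.inputs, Gate.raw, List.map_map,
      List.mem_map, List.mem_cons, Set.mem_insert_iff, Set.mem_union, Set.mem_ofPred_eq,
      List.not_mem_nil, or_false, and_true]
    refine ⟨?_, ?_, ?_, ?_, ?_⟩
    · rintro _ ⟨a, ha, rfl⟩
      exact .inr ⟨a, ha, rfl⟩
    · rintro _ ⟨r, hr, rfl⟩
      exact .inr (.inl (.inl (.inr ⟨r, hr, rfl⟩)))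
    · rintro _ rfl
      exact .inl rfl
    · rintro _ (rfl | rfl | ⟨a, ha, rfl⟩)
      · simp
      · simp
      · exact .inr (.inr (.inr (.inl (.inr ⟨a, ha, rfl⟩))))
    · rintro _ (rfl | ⟨r, hr, rfl⟩)
      · simp
      · exact .inr (.inr (.inr (.inr (.inl (.inl (.inl (.inr ⟨r, hr, rfl⟩)))))))

/-- The circuit for a program. -/
def aspCircuit (P : List Rule) : NamedCircuit AspNode where
  ex := (atomsOf P).map fun a => AspNode.x a
  all := (choicesOf P).map fun q => AspNode.y q
  gates := aspGates P
  out := (AspNode.out, Gate.and (AspNode.minimal :: P.map fun r => AspNode.sat r))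
  nodup := by
    rw [List.nodup_append]
    refine ⟨(List.nodup_dedup _).map fun a b h => by simpa using h,
      (List.nodup_dedup _).map fun a b h => by simpa [Prod.ext_iff] using h, ?_⟩
    intro u hu v hv
    obtain ⟨a, -, rfl⟩ := List.mem_map.1 hu
    obtain ⟨q, -, rfl⟩ := List.mem_map.1 hv
    simp
  ordered := by
    simp only [aspGates, List.append_assoc]
    refine (Ordered.of_forall fun g hg u hu => ?_).append
      ((Ordered.of_forall fun g hg u hu => ?_).append
      ((Ordered.flatMap_range _ fun t _ => ordered_roundGates P _ t (fun q hq => ?_)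
      (fun a ha => ?_) fun a ha => ?_).append
      (ordered_resultGates P _ (fun a ha => ?_) (fun q hq => ?_) (fun a ha => ?_)
        fun a ha => ?_)))
    · obtain ⟨a, ha, rfl⟩ := List.mem_map.1 hg
      simp only [Gate.inputs, Gate.raw, List.mem_singleton] at hu
      exact List.mem_append_left _ (List.mem_map.2 ⟨a, ha, hu.symm⟩)
    · obtain ⟨a, ha, rfl⟩ := List.mem_map.1 hg
      simp [Gate.inputs, Gate.raw] at hu
    · exact .inl (.inl (.inl (List.mem_append_right _ (List.mem_map.2 ⟨q, hq, rfl⟩))))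
    · left; left; right
      simp only [List.map_map, Set.mem_ofPred_eq, List.mem_map]
      exact ⟨a, ha, rfl⟩
    · cases t with
      | zero =>
        left; right
        simp only [List.map_map, Set.mem_ofPred_eq, List.mem_map]
        exact ⟨a, ha, rfl⟩
      | succ t =>
        right
        refine List.mem_map.2 ⟨_, List.mem_flatMap.2 ⟨t, List.mem_range.2 (by omega),
          List.mem_append_right _ (List.mem_map.2 ⟨a, ha, rfl⟩)⟩, rfl⟩
    · exact .inl (.inl (.inl (List.mem_append_left _ (List.mem_map.2 ⟨a, ha, rfl⟩))))
    · exact .inl (.inl (.inl (List.mem_append_right _ (List.mem_map.2 ⟨q, hq, rfl⟩))))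
    · left; left; right
      simp only [List.map_map, Set.mem_ofPred_eq, List.mem_map]
      exact ⟨a, ha, rfl⟩
    · right
      refine List.mem_map.2 ⟨_, List.mem_flatMap.2 ⟨(atomsOf P).length, List.mem_range.2 (by omega),
        List.mem_append_right _ (List.mem_map.2 ⟨a, ha, rfl⟩)⟩, rfl⟩

theorem polyFun_aspCircuit_word {α : Type} [TreeRep α] (P : α → List Rule) (hP : PolyFun P) :
    PolyFun fun x => (aspCircuit (P x)).toCircuit.word := by
  simp only [NamedCircuit.word_toCircuit]
  have hand : ∀ {β : Type} [TreeRep β] (l : β → List AspNode), PolyFun l →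
    PolyFun fun x => Gate.and (l x) := fun l hl =>
      (show PolyFun fun x => (CircuitSymbol.and, l x) by fun_prop).congr_rep fun _ => rfl
  have hor : ∀ {β : Type} [TreeRep β] (l : β → List AspNode), PolyFun l →
    PolyFun fun x => Gate.or (l x) := fun l hl =>
      (show PolyFun fun x => (CircuitSymbol.or, l x) by fun_prop).congr_rep fun _ => rfl
  have hnot : ∀ {β : Type} [TreeRep β] (l : β → AspNode), PolyFun l →
    PolyFun fun x => Gate.not (l x) := fun l hl =>
      (show PolyFun fun x => (CircuitSymbol.not, [l x]) by fun_prop).congr_rep fun _ => rfl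
  have hatoms : PolyFun atomsOf := by unfold atomsOf; fun_prop
  have hchoices : PolyFun choicesOf := by unfold choicesOf; fun_prop
  refine PolyFun.gatesWord _ _ _ ?_ ?_ ?_
  · simp only [aspCircuit]; fun_prop
  · simp only [aspCircuit]; fun_prop
  · simp only [aspCircuit, aspGates, resultGates, roundGates]
    fun_prop

end ParamASP

namespace ParamASP

open Function Polynomial TreeRep

/-! ### Answer sets and selections from the heads of disjunctive rules -/

theorem isModel_reduct_iff {P : List Rule} {M N : Finset Atom} :
    Program.IsModel (Program.reduct P.toFinset M) N ↔
      ∀ r ∈ P, (∀ c ∈ r.neg, c ∉ M) → (∀ b ∈ r.pos, b ∈ N) → ∃ a ∈ r.head, a ∈ N := by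
  simp only [Program.IsModel, Program.reduct, Finset.mem_image, Finset.mem_filter,
    List.mem_toFinset, forall_exists_index, and_imp, Rule.Satisfied]
  constructor
  · intro h r hr hc hb
    simpa [Rule.negationFree] using h _ r hr hc rfl (by simpa [Rule.negationFree] using hb)
      (by simp [Rule.negationFree])
  · rintro h _ r hr hc rfl hb -
    exact h r hr hc hb

/-- The rule `q.1` derives `q.2` from the atoms in `N`, where the negated atoms are evaluated in
`M`, and a disjunctive rule derives only the atoms that are selected by `Y`. -/
def Fires (M : Set Atom) (Y : Set (Rule × Atom)) (N : Set Atom) (q : Rule × Atom) : Prop :=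
  (∀ b ∈ q.1.pos, b ∈ N) ∧ (∀ c ∈ q.1.neg, c ∉ M) ∧ (q.1.IsDisjunctive → q ∈ Y)

/-- The atoms that are derived in `t` rounds. -/
def derivedIn (P : List Rule) (M : Set Atom) (Y : Set (Rule × Atom)) : ℕ → Set Atom
  | 0 => ∅
  | t + 1 => {a | a ∈ derivedIn P M Y t ∨
      ∃ q ∈ choicesOf P, q.2 = a ∧ Fires M Y (derivedIn P M Y t) q}

section derivedIn
variable {P : List Rule} {M : Set Atom} {Y : Set (Rule × Atom)}

theorem derivedIn_subset_atomsOf (t : ℕ) : derivedIn P M Y t ⊆ {a | a ∈ atomsOf P} := by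
  induction t with
  | zero => exact Set.empty_subset _
  | succ t ih =>
    rintro a (h | ⟨q, hq, rfl, -⟩)
    · exact ih h
    · have := mem_choicesOf.1 hq
      exact mem_atomsOf.2 ⟨_, this.1, .inl this.2⟩

theorem derivedIn_subset {N : Set Atom}
    (hN : ∀ q ∈ choicesOf P, Fires M Y N q → q.2 ∈ N) (t : ℕ) : derivedIn P M Y t ⊆ N := by
  induction t with
  | zero => exact Set.empty_subset _
  | succ t ih =>
    rintro a (h | ⟨q, hq, rfl, h⟩)
    · exact ih h
    · exact hN q hq ⟨fun b hb => ih (h.1 b hb), h.2⟩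

/-- Until the derivation stops, every round adds an atom of the program. After more rounds than
there are atoms it must have stopped, and then the derived set is closed under the rules. -/
theorem derivedIn_closed (q : Rule × Atom) (hq : q ∈ choicesOf P)
    (h : Fires M Y (derivedIn P M Y ((atomsOf P).length + 1)) q) :
    q.2 ∈ derivedIn P M Y ((atomsOf P).length + 1) := by
  have hfin : ∀ t, (derivedIn P M Y t).Finite := fun t =>
    ((atomsOf P).finite_toSet).subset (derivedIn_subset_atomsOf t)
  have hcard : ∀ t, t ≤ (derivedIn P M Y t).ncard ∨ derivedIn P M Y (t + 1) = derivedIn P M Y t := by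
    intro t
    induction t with
    | zero => exact .inl (Nat.zero_le _)
    | succ t ih =>
      have hsub : derivedIn P M Y t ⊆ derivedIn P M Y (t + 1) := fun a h => .inl h
      by_cases e : derivedIn P M Y (t + 1) = derivedIn P M Y t
      · right
        conv_lhs => rw [derivedIn, e]
        rfl
      · left
        exact (ih.resolve_right e).trans_lt
          (Set.ncard_lt_ncard (hsub.ssubset_of_ne (Ne.symm e)) (hfin _))
  have e := (hcard ((atomsOf P).length + 1)).resolve_left fun hlt => by
    have h1 := Set.ncard_le_ncard (derivedIn_subset_atomsOf (P := P) (M := M) (Y := Y)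
      ((atomsOf P).length + 1)) (atomsOf P).finite_toSet
    have h2 : {a | a ∈ atomsOf P}.ncard ≤ (atomsOf P).length := by
      rw [← List.coe_toFinset, Set.ncard_coe_finset]
      exact List.toFinset_card_le _
    omega
  rw [← e]
  exact .inr ⟨q, hq, rfl, h⟩

end derivedIn

/-- The atoms that are derived from a program. -/
def leastModel (P : List Rule) (M : Set Atom) (Y : Set (Rule × Atom)) : Set Atom :=
  derivedIn P M Y ((atomsOf P).length + 1)

/-- The value of a node of the circuit for a program. -/
def aspValue (P : List Rule) (M : Set Atom) (Y : Set (Rule × Atom)) : AspNode → Prop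
  | (0, _, _, a) => a ∈ M
  | (1, _, r, a) => (r, a) ∈ Y
  | (2, _, _, a) => a ∉ M
  | (3, t, _, a) => a ∈ derivedIn P M Y t
  | (4, t, r, a) => Fires M Y (derivedIn P M Y t) (r, a)
  | (5, _, r, _) => (∃ a ∈ r.head, a ∈ M) ∨ (∃ b ∈ r.pos, b ∉ M) ∨ ∃ c ∈ r.neg, c ∈ M
  | (6, _, r, _) => ∃ a ∈ r.head, (r, a) ∈ Y
  | (7, _, _, a) => a ∈ leastModel P M Y ∧ a ∉ M
  | (8, _, _, a) => a ∈ leastModel P M Y ∨ a ∉ M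
  | (9, _, _, _) => ∀ a ∈ atomsOf P, a ∈ leastModel P M Y ∨ a ∉ M
  | (10, _, _, _) => ∀ r ∈ P, r.IsDisjunctive → ∃ a ∈ r.head, (r, a) ∈ Y
  | (11, _, _, _) => ¬∀ r ∈ P, r.IsDisjunctive → ∃ a ∈ r.head, (r, a) ∈ Y
  | (12, _, _, _) => (¬∀ r ∈ P, r.IsDisjunctive → ∃ a ∈ r.head, (r, a) ∈ Y) ∨
      (∀ a ∈ atomsOf P, a ∈ leastModel P M Y ∨ a ∉ M) ∨
      ∃ a ∈ atomsOf P, a ∈ leastModel P M Y ∧ a ∉ M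
  | _ => ((¬∀ r ∈ P, r.IsDisjunctive → ∃ a ∈ r.head, (r, a) ∈ Y) ∨
      (∀ a ∈ atomsOf P, a ∈ leastModel P M Y ∨ a ∉ M) ∨
      ∃ a ∈ atomsOf P, a ∈ leastModel P M Y ∧ a ∉ M) ∧
      ∀ r ∈ P, (∃ a ∈ r.head, a ∈ M) ∨ (∃ b ∈ r.pos, b ∉ M) ∨ ∃ c ∈ r.neg, c ∈ M

theorem aspValue_gates (P : List Rule) (M : Set Atom) (Y : Set (Rule × Atom)) :
    ∀ g ∈ (aspCircuit P).gates ++ [(aspCircuit P).out],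
      aspValue P M Y g.1 ↔ g.2.Holds (aspValue P M Y) := by
  intro g hg
  simp only [aspCircuit, aspGates, resultGates, List.mem_append, List.mem_map, List.mem_flatMap,
    List.mem_cons, List.not_mem_nil, or_false] at hg
  rcases hg with (⟨a, ha, rfl⟩ | ⟨a, ha, rfl⟩ | ⟨t, ht, hg⟩ | ⟨r, hr, rfl⟩ | ⟨r, hr, rfl⟩ |
    ⟨a, ha, rfl⟩ | ⟨a, ha, rfl⟩ | rfl | rfl | rfl | rfl) | rfl
  · simp [Gate.Holds, aspValue]
  · simp [Gate.Holds, aspValue, derivedIn]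
  · rcases List.mem_append.1 hg with h | h
    · obtain ⟨q, hq, rfl⟩ := List.mem_map.1 h
      by_cases hd : q.1.IsDisjunctive <;>
        simp [Gate.Holds, aspValue, Fires, hd, or_imp, forall_and]
    · obtain ⟨a, ha, rfl⟩ := List.mem_map.1 h
      simp [Gate.Holds, aspValue, derivedIn, and_assoc]
  · simp [Gate.Holds, aspValue, or_and_right, exists_or]
  · simp [Gate.Holds, aspValue]
  · simp [Gate.Holds, aspValue, leastModel]
  · simp [Gate.Holds, aspValue, leastModel]
  · simp [Gate.Holds, aspValue]
  · simp only [Gate.Holds, List.forall_mem_map, List.mem_filter, decide_eq_true_eq, and_imp]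
    rfl
  · simp [Gate.Holds, aspValue]
  · simp [Gate.Holds, aspValue]
  · simp [Gate.Holds, aspValue]

/-- An applicable disjunctive rule is satisfied by its selected atom, and any other applicable rule
by its only head atom. That an applicable rule has a head atom at all follows from `N ⊆ M` and the
fact that `M` is a model. -/
theorem leastModel_isModel {P : List Rule} {M N : Finset Atom} {Y : Set (Rule × Atom)}
    (hM : Program.IsModel (Program.reduct P.toFinset M) M)
    (hY : ∀ r ∈ P, r.IsDisjunctive → ∃ a ∈ r.head, (r, a) ∈ Y)
    (hN : ∀ a, a ∈ N ↔ a ∈ leastModel P M Y) (hNM : N ⊆ M) :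
    Program.IsModel (Program.reduct P.toFinset M) N := by
  rw [isModel_reduct_iff] at hM ⊢
  intro r hr hc hb
  by_cases hd : r.IsDisjunctive
  · obtain ⟨a, ha, hy⟩ := hY r hr hd
    exact ⟨a, ha, (hN a).2 (derivedIn_closed (r, a) (mem_choicesOf.2 ⟨hr, ha⟩)
      ⟨fun b h => (hN b).1 (hb b h), hc, fun _ => hy⟩)⟩
  · obtain ⟨a, ha, -⟩ := hM r hr hc fun b h => hNM (hb b h)
    exact ⟨a, ha, (hN a).2 (derivedIn_closed (r, a) (mem_choicesOf.2 ⟨hr, ha⟩)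
      ⟨fun b h => (hN b).1 (hb b h), hc, fun h => absurd h hd⟩)⟩

/-- A model of the reduct contains the atoms that are derived for some selection. -/
theorem exists_selection {P : List Rule} {M N : Finset Atom}
    (hN : Program.IsModel (Program.reduct P.toFinset M) N) :
    ∃ s : Rule → Atom, (∀ r ∈ P, r.IsDisjunctive → s r ∈ r.head) ∧
      leastModel P M {q | q.1 ∈ P ∧ q.1.IsDisjunctive ∧ q.2 = s q.1} ⊆ N := by
  -- Choose a head atom in `N` if possible and otherwise any head atom; for an empty head the value
  -- `[]` is arbitrary.
  have : ∀ r : Rule, ∃ a, (r.IsDisjunctive → a ∈ r.head) ∧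
      ((∃ b ∈ r.head, b ∈ N) → a ∈ r.head ∧ a ∈ N) := by
    intro r
    by_cases h : ∃ b ∈ r.head, b ∈ N
    · obtain ⟨b, hb, hbN⟩ := h
      exact ⟨b, fun _ => hb, fun _ => ⟨hb, hbN⟩⟩
    · rcases hr : r.head with _ | ⟨a, l⟩
      · exact ⟨[], fun h' => by simp [Rule.IsDisjunctive, hr] at h', fun h' => by simp at h'⟩
      · exact ⟨a, fun _ => by simp, fun h' => absurd h' (hr ▸ h)⟩
  choose s hs hsN using this
  refine ⟨s, fun r _ => hs r, derivedIn_subset (fun q hq hf => ?_) _⟩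
  rw [isModel_reduct_iff] at hN
  obtain ⟨hr, ha⟩ := mem_choicesOf.1 hq
  have h := hN q.1 hr hf.2.1 hf.1
  by_cases hd : q.1.IsDisjunctive
  · have e : q.2 = s q.1 := (hf.2.2 hd).2.2
    rw [e]
    exact (hsN _ h).2
  · obtain ⟨b, hb, hbN⟩ := h
    have hl : q.1.head.length ≤ 1 := not_lt.1 hd
    rcases hh : q.1.head with _ | ⟨c, _ | ⟨d, l⟩⟩
    · simp [hh] at hb
    · rw [hh, List.mem_singleton] at ha hb
      rw [ha, ← hb]
      exact hbN
    · simp [hh] at hl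

/-- Existential variables describe a candidate, universal ones a selection of head atoms. The output
says that the candidate satisfies all rules and that the selection does not refute minimality: it
misses a disjunctive rule, or derives an atom outside the candidate, or derives the whole candidate.
The weight is used only from left to right, where each selection has to be realised by an assignment
of exactly this weight; from right to left the circuit accepts every selection. -/
theorem aspCircuit_iff {P : List Rule} (hP : P.Nodup) :
    (aspCircuit P).toCircuit.ExistsForallWeight (P.filter fun r => r.IsDisjunctive).length ↔
      ∃ M, Program.IsAnswerSet P.toFinset M := by
  rw [(aspCircuit P).existsForallWeight_iff
    (fun S T => aspValue P {a | AspNode.x a ∈ S} {q | AspNode.y q ∈ T})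
    (fun S T u hu => ?_) (fun S T u hu => ?_) fun S T => aspValue_gates _ _ _]
  · constructor
    · rintro ⟨S, hS, h⟩
      obtain ⟨M, hSM, hMa⟩ : ∃ M : Finset Atom, {a | AspNode.x a ∈ S} = (M : Set Atom) ∧
          ∀ a ∈ M, a ∈ atomsOf P := by
        refine ⟨(atomsOf P).toFinset.filter fun a => AspNode.x a ∈ S, ?_, fun a ha =>
          List.mem_toFinset.1 (Finset.mem_filter.1 ha).1⟩
        ext a
        simp only [Set.mem_ofPred_eq, Finset.coe_filter, List.mem_toFinset]
        refine ⟨fun h' => ⟨?_, h'⟩, fun h' => h'.2⟩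
        have := List.mem_toFinset.1 (hS h')
        simpa [aspCircuit] using this
      have hsel : ∀ s : Rule → Atom, (∀ r ∈ P, r.IsDisjunctive → s r ∈ r.head) →
          aspValue P M {q | q.1 ∈ P ∧ q.1.IsDisjunctive ∧ q.2 = s q.1} AspNode.out := by
        intro s hs
        have hT := h ((P.filter fun r => r.IsDisjunctive).map fun r =>
          AspNode.y (r, s r)).toFinset ?_ ?_
        · rw [hSM] at hT
          convert hT using 2
          swap
          · rfl
          ext ⟨r, a⟩
          simp only [List.mem_toFinset, List.mem_map, List.mem_filter,
            decide_eq_true_eq, Prod.mk.injEq, true_and]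
          constructor
          · rintro ⟨hr, hd, rfl⟩
            exact ⟨r, ⟨hr, hd⟩, rfl, rfl⟩
          · rintro ⟨r', ⟨hr, hd⟩, rfl, rfl⟩
            exact ⟨hr, hd, rfl⟩
        · intro u hu
          obtain ⟨r, hr, rfl⟩ := List.mem_map.1 (List.mem_toFinset.1 hu)
          rw [List.mem_filter, decide_eq_true_eq] at hr
          exact List.mem_toFinset.2 (List.mem_map.2
            ⟨(r, s r), mem_choicesOf.2 ⟨hr.1, hs r hr.1 hr.2⟩, rfl⟩)
        -- One selected atom for each disjunctive rule. Here it matters that no rule is listed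
        -- twice.
        · rw [List.toFinset_card_of_nodup, List.length_map]
          exact (hP.filter _).map fun r r' e => by simp at e; exact e.1
      have hM : Program.IsModel (Program.reduct P.toFinset M) M := by
        -- That the candidate satisfies the rules does not depend on the selection, so an arbitrary
        -- one will do: the first head atoms.
        have h' := (hsel (fun r => r.head.headD []) fun r _ hd => ?_).2
        · rw [isModel_reduct_iff]
          intro r hr hc hb
          rcases h' r hr with h' | ⟨b, h', h''⟩ | ⟨c, h', h''⟩
          · exact h'
          · exact absurd (hb b h') h''
          · exact absurd h'' (hc c h')
        · rcases hr : r.head with _ | ⟨a, l⟩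
          · simp [Rule.IsDisjunctive, hr] at hd
          · simp
      refine ⟨M, hM, fun N hN hNM => ?_⟩
      -- For this selection the derived atoms lie in `N`, hence in `M`. The circuit then leaves only
      -- the case that all of `M` is derived, and so `M ⊆ N`.
      obtain ⟨s, hs, hsN⟩ := exists_selection hN
      rcases (hsel s hs).1 with h' | h' | ⟨a, -, h', h''⟩
      · exact absurd (fun r hr hd => ⟨s r, hs r hr hd, hr, hd, rfl⟩) h'
      · intro a ha
        exact hsN ((h' a (hMa a ha)).resolve_right fun h => h ha)
      · exact absurd (hNM (hsN h')) h''
    · rintro ⟨M, hM⟩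
      have hMm := isModel_reduct_iff.1 hM.1
      -- By minimality an answer set contains no atoms foreign to the program, so it can be encoded
      -- by the existential variables.
      have hMa : ∀ a ∈ M, a ∈ atomsOf P := by
        have := hM.2 (y := M.filter (· ∈ atomsOf P)) (isModel_reduct_iff.2 ?_)
          (Finset.filter_subset _ _)
        · exact fun a ha => (Finset.mem_filter.1 (this ha)).2
        · intro r hr hc hb
          obtain ⟨a, ha, haM⟩ := hMm r hr hc fun b h => (Finset.mem_filter.1 (hb b h)).1
          exact ⟨a, ha, Finset.mem_filter.2 ⟨haM, mem_atomsOf.2 ⟨r, hr, .inl ha⟩⟩⟩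
      refine ⟨M.image fun a => AspNode.x a, ?_, fun T hT _ => ?_⟩
      · intro u hu
        obtain ⟨a, ha, rfl⟩ := Finset.mem_image.1 hu
        exact List.mem_toFinset.2 (List.mem_map.2 ⟨a, hMa a ha, rfl⟩)
      · have hMe : {a | AspNode.x a ∈ M.image fun a => AspNode.x a} = (M : Set Atom) := by
          ext a
          simp
        rw [hMe]
        generalize {q | AspNode.y q ∈ T} = Y
        refine ⟨?_, fun r hr => ?_⟩
        · by_contra hcon
          rw [not_or, not_or, not_not] at hcon
          obtain ⟨hY, hcov, hex⟩ := hcon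
          have hDM : ∀ a ∈ leastModel P M Y, a ∈ M := fun a ha =>
            by_contra fun h => hex ⟨a, derivedIn_subset_atomsOf _ ha, ha, h⟩
          classical
          have hN : ∀ a, a ∈ M.filter (· ∈ leastModel P M Y) ↔ a ∈ leastModel P M Y := by
            intro a
            rw [Finset.mem_filter]
            exact ⟨fun h => h.2, fun h => ⟨hDM a h, h⟩⟩
          have := hM.2 (leastModel_isModel hM.1 hY hN (Finset.filter_subset _ _))
            (Finset.filter_subset _ _)
          refine hcov fun a _ => ?_
          by_cases h : a ∈ M
          · exact .inl ((hN a).1 (this h))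
          · exact .inr h
        · by_cases hc : ∀ c ∈ r.neg, c ∉ M
          · by_cases hb : ∀ b ∈ r.pos, b ∈ M
            · exact .inl (hMm r hr hc hb)
            · push Not at hb
              exact .inr (.inl hb)
          · push Not at hc
            exact .inr (.inr hc)
  · obtain ⟨a, -, rfl⟩ := List.mem_map.1 hu
    exact Iff.rfl
  · obtain ⟨a, -, rfl⟩ := List.mem_map.1 hu
    exact Iff.rfl

/-! ### Membership -/

theorem Node.raw_injective : Injective Node.raw := by
  intro a b h
  cases a <;> cases b <;> simp_all [Node.raw]

theorem Circuit.word_injective : Injective Circuit.word := by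
  intro C D h
  have := congrArg parseCircuit h
  rw [Circuit.word, Circuit.word, parseCircuit_word, parseCircuit_word, Option.some_inj] at this
  have := (List.map_injective_iff.2 Node.raw_injective) this
  cases C; cases D
  simpa using this

theorem Circuit.word_ne_nil (C : Circuit) : C.word ≠ [] := by
  rcases h : C.nodes with _ | ⟨nd, l⟩
  · exact absurd h C.nonempty
  · cases nd <;> simp [Circuit.word, h, Node.word]

theorem word_mem_existsForallWSat (C : Circuit) (k : ℕ) :
    (C.word, k) ∈ (existsForallWSat Set.univ).yes ↔ C.ExistsForallWeight k := by
  constructor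
  · rintro ⟨D, -, h, h'⟩
    rwa [Circuit.word_injective h]
  · exact fun h => ⟨C, trivial, rfl, h⟩

/-- The reduction from ASP-consistency to the weighted satisfiability problem. -/
def aspToWSat (p : List ProgramSymbol × ℕ) : List CircuitSymbol × ℕ :=
  -- A circuit is nonempty, so `([], 0)` is a no-instance. It is the result for words that are not
  -- programs and for wrong parameters.
  (parseRules p.1).elim ([], 0) fun l =>
    -- Repeated rules are removed, since a program is a set and the weight must be the number of
    -- distinct disjunctive rules.
    if (l.dedup.filter fun r => r.IsDisjunctive).length = p.2 then
      ((aspCircuit l.dedup).toCircuit.word, p.2)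
    else ([], 0)

theorem polyFun_aspToWSat : PolyFun aspToWSat := by
  have h1 := polyFun_parseRules
  have h2 := polyFun_aspCircuit_word (fun x : (List ProgramSymbol × ℕ) × List Rule => x.2.dedup)
    (by fun_prop)
  unfold aspToWSat
  fun_prop

theorem aspToWSat_snd_le (p : List ProgramSymbol × ℕ) : (aspToWSat p).2 ≤ p.2 := by
  rcases h : parseRules p.1 with _ | l
  · simp [aspToWSat, h]
  · simp only [aspToWSat, h, Option.elim_some]
    split_ifs <;> simp

theorem mem_aspConsistency_iff (p : List ProgramSymbol × ℕ) :
    p ∈ aspConsistencyDisjRules.yes ↔ aspToWSat p ∈ (existsForallWSat Set.univ).yes := by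
  have hno : (([], 0) : List CircuitSymbol × ℕ) ∉ (existsForallWSat Set.univ).yes := by
    rintro ⟨C, -, h, -⟩
    exact C.word_ne_nil h.symm
  rcases h : parseRules p.1 with _ | l
  · simp only [aspToWSat, h, Option.elim_none, hno, iff_false]
    rintro ⟨l, hl, -⟩
    rw [hl, parseRules_rulesWord] at h
    cases h
  · have hl : l.dedup.toFinset = l.toFinset := by ext; simp
    have hnum : Program.numDisjunctive l.toFinset =
        (l.dedup.filter fun r => r.IsDisjunctive).length := by
      rw [← hl, Program.numDisjunctive, ← List.toFinset_card_of_nodup ((List.nodup_dedup l).filter _)]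
      congr 1
      ext r
      simp
    have hyes : p ∈ aspConsistencyDisjRules.yes ↔
        Program.numDisjunctive l.toFinset = p.2 ∧ ∃ M, Program.IsAnswerSet l.toFinset M := by
      constructor
      · rintro ⟨m, hm, h'⟩
        rw [hm, parseRules_rulesWord, Option.some_inj] at h
        rwa [← h]
      · exact fun h' => ⟨l, parseRules_eq_some h, h'⟩
    rw [hyes, hnum]
    simp only [aspToWSat, h, Option.elim_some]
    split_ifs with hk
    · rw [← hk, word_mem_existsForallWSat, aspCircuit_iff (List.nodup_dedup l), hl]
      simp
    · simp [hk, hno]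

theorem aspConsistencyDisjRules_mem : aspConsistencyDisjRules ∈ existsForallWP := by
  refine ⟨_, rfl, aspToWSat, mem_aspConsistency_iff, ⟨fun k => k, Computable.id, fun I k =>
    aspToWSat_snd_le (I, k)⟩, ?_⟩
  exact FptTimeComputable.comp_polyFun (S := ProgramSymbol) (U := CircuitSymbol)
    fptTimeComputable_id polyFun_aspToWSat

end ParamASP

/-! ### Hardness: from circuits to programs -/

namespace ParamASP

open Function Polynomial TreeRep

@[fun_prop]
theorem PolyFun.zipIdx {α β : Type} [TreeRep α] [TreeRep β] (l : α → List β) (hl : PolyFun l) :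
    PolyFun fun x => (l x).zipIdx := by
  have key : ∀ m : List β, m.foldl (fun acc b => acc ++ [(b, acc.length)]) [] = m.zipIdx := by
    intro m
    induction m using List.reverseRecOn with
    | nil => rfl
    | append_singleton m b ih => simp [ih, List.zipIdx_append]
  have hsize : ∀ (n : ℕ) (m : List β), m.length ≤ n → size m.zipIdx ≤ size m + m.length * (2 * n + 2) := by
    intro n m
    induction m using List.reverseRecOn with
    | nil => simp
    | append_singleton m b ih =>
      intro hm
      rw [List.length_append, List.length_singleton] at hm
      have h1 := ih (by omega)
      have h2 := size_append m.zipIdx [(b, m.length)]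
      have h3 := size_append m [b]
      rw [List.zipIdx_append]
      simp only [size_cons, size_nil, size_prod, size_nat, List.length_append,
        List.length_singleton, List.zipIdx_cons, List.zipIdx_nil, Nat.zero_add, Nat.add_mul] at *
      omega
  obtain ⟨q, hq⟩ := hl.size_le
  refine (foldl l (fun _ => []) (fun _ acc b => acc ++ [(b, acc.length)]) hl (by fun_prop)
    (by fun_prop) (q + q * (2 * q + 2)) fun x l' h => ?_).congr_rep fun x => by rw [key]
  rw [key]
  have h1 := size_le_of_sublist h.sublist
  have h2 := length_lt_size l'
  have h3 := hq x
  refine (hsize _ _ le_rfl).trans ?_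
  simp only [eval_add, eval_mul, eval_ofNat]
  gcongr <;> omega

/-! ### Programs over named atoms -/

/-- A rule over named atoms: the head, the positive body, and the negated atoms of the body. -/
abbrev NamedRule (ν : Type) := List ν × List ν × List ν

namespace NamedRule
variable {ν : Type}

/-- The rule for a rule over named atoms. -/
def toRule (name : ν → Atom) (r : NamedRule ν) : Rule :=
  ⟨r.1.map name, r.2.1.map name, r.2.2.map name⟩

/-- `q` is a model of the reduct of `R` with respect to `p`. -/
def IsReductModel (R : List (NamedRule ν)) (p q : Set ν) : Prop :=
  ∀ r ∈ R, (∀ c ∈ r.2.2, c ∉ p) → (∀ b ∈ r.2.1, b ∈ q) → ∃ a ∈ r.1, a ∈ q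

/-- Bit strings and finiteness are eliminated here. An answer set is pulled back along the injective
`name`; conversely, a minimal `p` is first restricted to the finitely many names that occur in the
rules, since only these influence the reduct and its models. -/
theorem exists_isAnswerSet_iff {name : ν → Atom} (hname : Injective name)
    (R : List (NamedRule ν)) :
    (∃ M, Program.IsAnswerSet (R.map (toRule name)).toFinset M) ↔
      ∃ p : Set ν, IsReductModel R p p ∧ ∀ q ⊆ p, IsReductModel R p q → p ⊆ q := by
  classical
  have hmodel : ∀ (M N : Finset Atom) (p q : Set ν),
      (∀ r ∈ R, ∀ u, u ∈ r.1 ∨ u ∈ r.2.1 ∨ u ∈ r.2.2 →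
        ((name u ∈ M ↔ u ∈ p) ∧ (name u ∈ N ↔ u ∈ q))) →
      (Program.IsModel (Program.reduct (R.map (toRule name)).toFinset M) N ↔
        IsReductModel R p q) := by
    intro M N p q h
    rw [isModel_reduct_iff, List.forall_mem_map]
    refine forall₂_congr fun r hr => ?_
    simp only [toRule, List.forall_mem_map]
    refine imp_congr (forall₂_congr fun c hc => by rw [(h r hr c (.inr (.inr hc))).1]) (imp_congr
      (forall₂_congr fun b hb => by rw [(h r hr b (.inr (.inl hb))).2]) ?_)
    constructor
    · rintro ⟨_, ha, ha'⟩
      obtain ⟨u, hu, rfl⟩ := List.mem_map.1 ha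
      exact ⟨u, hu, (h r hr u (.inl hu)).2.1 ha'⟩
    · rintro ⟨u, hu, hu'⟩
      exact ⟨_, List.mem_map_of_mem hu, (h r hr u (.inl hu)).2.2 hu'⟩
  constructor
  · rintro ⟨M, hM⟩
    refine ⟨{u | name u ∈ M}, (hmodel M M _ _ fun _ _ _ _ => ⟨Iff.rfl, Iff.rfl⟩).1 hM.1,
      fun q hq hmod u hu => ?_⟩
    have hN : ∀ u, name u ∈ M.filter (fun a => ∃ w ∈ q, name w = a) ↔ u ∈ q := by
      intro u
      rw [Finset.mem_filter]
      constructor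
      · rintro ⟨-, w, hw, e⟩
        exact hname e ▸ hw
      · exact fun h => ⟨hq h, u, h, rfl⟩
    exact (hN u).1 (hM.2 ((hmodel M _ _ q fun _ _ u _ => ⟨Iff.rfl, hN u⟩).2 hmod)
      (Finset.filter_subset _ _) hu)
  · rintro ⟨p, hp, hmin⟩
    have hM : ∀ u, name u ∈ (((R.flatMap fun r => r.1 ++ (r.2.1 ++ r.2.2)).filter
        (· ∈ p)).map name).toFinset ↔ (∃ r ∈ R, u ∈ r.1 ∨ u ∈ r.2.1 ∨ u ∈ r.2.2) ∧ u ∈ p := by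
      intro u
      simp [hname.eq_iff]
    generalize hMdef : (((R.flatMap fun r => r.1 ++ (r.2.1 ++ r.2.2)).filter
        (· ∈ p)).map name).toFinset = M at hM
    have hM' : ∀ r ∈ R, ∀ u, u ∈ r.1 ∨ u ∈ r.2.1 ∨ u ∈ r.2.2 → (name u ∈ M ↔ u ∈ p) :=
      fun r hr u hu => by rw [hM, and_iff_right ⟨r, hr, hu⟩]
    refine ⟨M, (hmodel M M p p fun r hr u hu => ⟨hM' r hr u hu, hM' r hr u hu⟩).2 hp,
      fun N hN hNM a ha => ?_⟩
    have := hmin {u | u ∈ p ∧ name u ∈ N} (fun u hu => hu.1)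
      ((hmodel M N p _ fun r hr u hu => ⟨hM' r hr u hu, ?_⟩).1 hN)
    · rw [← hMdef, List.mem_toFinset, List.mem_map] at ha
      obtain ⟨u, hu, rfl⟩ := ha
      exact (this (of_decide_eq_true (List.mem_filter.1 hu).2)).2
    · exact ⟨fun h => ⟨(hM' r hr u hu).1 (hNM h), h⟩, fun h => h.2⟩

end NamedRule

/-! ### A program for the weighted satisfiability problem -/

/-- The names of the atoms of the program for a circuit. -/
abbrev WSatAtom := ℕ × ℕ × ℕ

namespace WSatAtom

/-- The node `i` is true. -/
abbrev T (i : ℕ) : WSatAtom := (0, i, 0)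
/-- The node `i` is false. -/
abbrev F (i : ℕ) : WSatAtom := (1, i, 0)
/-- The universal variable `i` is the one with number `j` that is set to true. -/
abbrev Y (i j : ℕ) : WSatAtom := (2, i, j)
/-- The node `i` is not the universal variable with number `j` that is set to true. -/
abbrev N (i j : ℕ) : WSatAtom := (3, i, j)
/-- The circuit is satisfied, or the choice of universal variables is not valid. -/
abbrev W : WSatAtom := (4, 0, 0)

/-- The bit string for an atom. -/
def name (u : WSatAtom) : Atom :=
  List.replicate u.1 true ++ (false :: (List.replicate u.2.1 true ++
    (false :: List.replicate u.2.2 true)))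

theorem replicate_append_inj {m n : ℕ} {l l' : List Bool}
    (h : List.replicate m true ++ false :: l = List.replicate n true ++ false :: l') :
    m = n ∧ l = l' := by
  induction m generalizing n with
  | zero => cases n <;> simp_all [List.replicate_succ]
  | succ m ih =>
    cases n with
    | zero => simp [List.replicate_succ] at h
    | succ n => simpa using ih (n := n) (by simpa [List.replicate_succ] using h)

theorem name_injective : Injective name := by
  rintro ⟨a, b, c⟩ ⟨a', b', c'⟩ h
  obtain ⟨rfl, h⟩ := replicate_append_inj h
  obtain ⟨rfl, h⟩ := replicate_append_inj h
  have := congrArg List.length h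
  simp at this
  rw [this]

theorem polyFun_name : PolyFun name := by
  unfold name
  fun_prop

end WSatAtom

open WSatAtom

/-- The rules for the node `i` of a circuit with `n` nodes. -/
def nodeRules (n k i : ℕ) (nd : CircuitSymbol × List ℕ) : List (NamedRule WSatAtom) :=
  -- An existential variable is guessed by two rules with negation. Both values of any other node
  -- follow from `W`.
  (if nd.1 = .ex then [([T i], [], [F i]), ([F i], [], [T i])]
    else [([T i], [W], []), ([F i], [W], [])]) ++
  -- A universal variable is true if it is chosen under some number, and false if it is excluded
  -- under all numbers. Choosing any other node is not valid and yields `W`.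
  ((if nd.1 = .all then
      ([F i], (List.range k).map (fun j => N i j), []) ::
        (List.range k).map fun j => ([T i], [Y i j], [])
    else (List.range k).map fun j => ([W], [Y i j], [])) ++
  ((if nd.1 = .and then
      ([T i], nd.2.map (fun u => T u), []) :: nd.2.map fun u => ([F i], [F u], []) else []) ++
  ((if nd.1 = .or then
      ([F i], nd.2.map (fun u => F u), []) :: nd.2.map fun u => ([T i], [T u], []) else []) ++
  ((if nd.1 = .not then
      [([T i], nd.2.map (fun u => F u), []), ([F i], nd.2.map (fun u => T u), [])] else []) ++
  -- The last node is the output.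
  ((if i + 1 = n then [([W], [T i], [])] else []) ++
  -- Choosing another index under the number `j` excludes `i` under `j`, and choosing `i` under two
  -- numbers yields `W`. Thus valid choices have weight exactly `k`.
  (List.range k).flatMap fun j => ([N i j], [W], []) ::
    ((List.range (n + 1)).flatMap (fun i' => if i' = i then [] else [([N i j], [Y i' j], [])]) ++
    (List.range k).flatMap fun j' => if j' = j then [] else [([W], [Y i j, Y i j'], [])]))))))

/-- The rules that choose the universal variable with number `j` that is set to true. -/
def choiceRules (n j : ℕ) : List (NamedRule WSatAtom) :=
  -- The index `n` is not a node but a dummy choice that yields `W`. It guarantees at least two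
  -- disjuncts, so that the choice rule is disjunctive even for a circuit with a single node.
  ([W], [Y n j], []) :: (List.range (n + 1)).map fun i => ([Y i j], [W], [])

/-- The program for a circuit, where the nodes are given by a symbol and a list of inputs. -/
def wsatRules (ns : List (CircuitSymbol × List ℕ)) (k : ℕ) : List (NamedRule WSatAtom) :=
  ((List.range k).map fun j => ((List.range (ns.length + 1)).map (fun i => Y i j), [], [])) ++
  -- The rule `W ← not W` excludes every candidate without `W`, and disappears from the reduct of
  -- the others.
  (([W], [], [W]) :: ((List.range k).flatMap (fun j => choiceRules ns.length j) ++
  ns.zipIdx.flatMap fun x => nodeRules ns.length k x.2 x.1))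

theorem polyFun_wsatRules {α : Type} [TreeRep α] (ns : α → List (CircuitSymbol × List ℕ)) (k : α → ℕ)
    (hns : PolyFun ns) (hk : PolyFun k) :
    PolyFun fun x => (wsatRules (ns x) (k x)).map (NamedRule.toRule name) := by
  have := polyFun_name
  unfold wsatRules choiceRules nodeRules NamedRule.toRule
  fun_prop

end ParamASP

/-! ### Correctness of the saturation program -/

namespace ParamASP

open Function Polynomial TreeRep WSatAtom NamedRule

theorem isReductModel_append {ν : Type} {R R' : List (NamedRule ν)} {p q : Set ν} :
    IsReductModel (R ++ R') p q ↔ IsReductModel R p q ∧ IsReductModel R' p q :=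
  List.forall_mem_append

theorem isReductModel_cons {ν : Type} {r : NamedRule ν} {R : List (NamedRule ν)} {p q : Set ν} :
    IsReductModel (r :: R) p q ↔ ((∀ c ∈ r.2.2, c ∉ p) → (∀ b ∈ r.2.1, b ∈ q) → ∃ a ∈ r.1, a ∈ q) ∧
      IsReductModel R p q :=
  List.forall_mem_cons

theorem isReductModel_nil {ν : Type} {p q : Set ν} : IsReductModel [] p q := by
  simp [IsReductModel]

theorem isReductModel_flatMap {ν β : Type} {l : List β} {f : β → List (NamedRule ν)}
    {p q : Set ν} : IsReductModel (l.flatMap f) p q ↔ ∀ x ∈ l, IsReductModel (f x) p q := by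
  simp only [IsReductModel, List.mem_flatMap]
  exact ⟨fun h x hx r hr => h r ⟨x, hx, hr⟩, fun h r ⟨x, hx, hr⟩ => h x hx r hr⟩

theorem isReductModel_map {ν β : Type} {l : List β} {f : β → NamedRule ν}
    {p q : Set ν} : IsReductModel (l.map f) p q ↔
      ∀ x ∈ l, (∀ c ∈ (f x).2.2, c ∉ p) → (∀ b ∈ (f x).2.1, b ∈ q) → ∃ a ∈ (f x).1, a ∈ q :=
  List.forall_mem_map

theorem isReductModel_nodeRules {n k i : ℕ} {nd : Node} {p q : Set WSatAtom} :
    IsReductModel (nodeRules n k i nd.raw) p q ↔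
      (nd = .ex → (F i ∉ p → T i ∈ q) ∧ (T i ∉ p → F i ∈ q)) ∧
      (nd ≠ .ex → W ∈ q → T i ∈ q ∧ F i ∈ q) ∧
      (nd = .all → ((∀ j < k, N i j ∈ q) → F i ∈ q) ∧ ∀ j < k, Y i j ∈ q → T i ∈ q) ∧
      (nd ≠ .all → ∀ j < k, Y i j ∈ q → W ∈ q) ∧
      (∀ l, nd = .and l → ((∀ u ∈ l, T u ∈ q) → T i ∈ q) ∧ ∀ u ∈ l, F u ∈ q → F i ∈ q) ∧
      (∀ l, nd = .or l → ((∀ u ∈ l, F u ∈ q) → F i ∈ q) ∧ ∀ u ∈ l, T u ∈ q → T i ∈ q) ∧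
      (∀ u, nd = .not u → (F u ∈ q → T i ∈ q) ∧ (T u ∈ q → F i ∈ q)) ∧
      (i + 1 = n → T i ∈ q → W ∈ q) ∧
      ∀ j < k, (W ∈ q → N i j ∈ q) ∧ (∀ i' < n + 1, i' ≠ i → Y i' j ∈ q → N i j ∈ q) ∧
        ∀ j' < k, j' ≠ j → Y i j ∈ q → Y i j' ∈ q → W ∈ q := by
  have hlast : IsReductModel (if i + 1 = n then [([W], [T i], [])] else []) p q ↔
      (i + 1 = n → T i ∈ q → W ∈ q) := by
    split_ifs with h <;> simp [isReductModel_cons, isReductModel_nil, h]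
  have hN : ∀ j i', IsReductModel (if i' = i then [] else [([N i j], [Y i' j], [])]) p q ↔
      (i' ≠ i → Y i' j ∈ q → N i j ∈ q) := by
    intro j i'
    split_ifs with h <;> simp [isReductModel_cons, isReductModel_nil, h]
  have hd : ∀ j j', IsReductModel (if j' = j then [] else [([W], [Y i j, Y i j'], [])]) p q ↔
      (j' ≠ j → Y i j ∈ q → Y i j' ∈ q → W ∈ q) := by
    intro j j'
    split_ifs with h <;> simp [isReductModel_cons, isReductModel_nil, h]
  simp only [nodeRules, isReductModel_append, hlast, isReductModel_flatMap, isReductModel_cons, hN,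
    hd]
  cases nd <;> simp [Node.raw, isReductModel_cons, isReductModel_nil, isReductModel_map,
    imp_and, forall_and]

theorem isReductModel_wsatRules {nodes : List Node} {k : ℕ} {p q : Set WSatAtom} :
    IsReductModel (wsatRules (nodes.map Node.raw) k) p q ↔
      (∀ j < k, ∃ i < nodes.length + 1, Y i j ∈ q) ∧
      (W ∉ p → W ∈ q) ∧
      (∀ j < k, (Y nodes.length j ∈ q → W ∈ q) ∧ ∀ i < nodes.length + 1, W ∈ q → Y i j ∈ q) ∧
      ∀ (i : ℕ) (h : i < nodes.length),
        IsReductModel (nodeRules nodes.length k i nodes[i].raw) p q := by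
  have hnodes : (∀ x ∈ (nodes.map Node.raw).zipIdx,
      IsReductModel (nodeRules nodes.length k x.2 x.1) p q) ↔
      ∀ (i : ℕ) (h : i < nodes.length),
        IsReductModel (nodeRules nodes.length k i nodes[i].raw) p q := by
    constructor
    · intro h i hi
      exact h (nodes[i].raw, i) (List.mem_zipIdx_iff_getElem?.2 (by simp [hi]))
    · rintro h ⟨r, i⟩ hx
      rw [List.mem_zipIdx_iff_getElem?] at hx
      obtain ⟨hi, e⟩ := List.getElem?_eq_some_iff.1 hx
      rw [List.getElem_map] at e
      exact e ▸ h i (by simpa using hi)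
  simp only [wsatRules, List.length_map, isReductModel_append, isReductModel_cons,
    isReductModel_flatMap, isReductModel_map, choiceRules, hnodes]
  simp

/-- The answer set for an assignment to the existential variables of a circuit. -/
def answerOf (C : Circuit) (k : ℕ) (A : Finset ℕ) : Set WSatAtom
  | (0, i, 0) => i < C.nodes.length ∧ (i ∈ C.exVars → i ∈ A)
  | (1, i, 0) => i < C.nodes.length ∧ (i ∈ C.exVars → i ∉ A)
  | (2, i, j) => i < C.nodes.length + 1 ∧ j < k
  | (3, i, j) => i < C.nodes.length ∧ j < k
  | (4, 0, 0) => True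
  | _ => False

/-- The atoms that are true for given values of the nodes of the circuit and a given choice of
universal variables. -/
def valuesOf (v : ℕ → Bool) (b : ℕ → ℕ) : Set WSatAtom
  | (0, i, _) => v i = true
  | (1, i, _) => v i = false
  | (2, i, j) => i = b j
  | (3, i, j) => i ≠ b j
  | _ => False

section
variable (C : Circuit) (k : ℕ)

theorem mem_exVars_iff (i : ℕ) (h : i < C.nodes.length) : i ∈ C.exVars ↔ C.nodes[i] = .ex := by
  simp [Circuit.exVars, h]

theorem mem_allVars_iff (i : ℕ) (h : i < C.nodes.length) : i ∈ C.allVars ↔ C.nodes[i] = .all := by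
  simp [Circuit.allVars, h]

theorem lt_of_mem_allVars {i : ℕ} (h : i ∈ C.allVars) : i < C.nodes.length :=
  Finset.mem_range.1 (Finset.mem_filter.1 h).1

/-- A model of the reduct that does not contain `W` describes an assignment for which the circuit is
not satisfied. -/
theorem not_satisfies_of_isReductModel {A : Finset ℕ} (hA : A ⊆ C.exVars) {p q : Set WSatAtom}
    (hT : ∀ i ∈ C.exVars, F i ∉ p → i ∈ A) (hF : ∀ i ∈ C.exVars, T i ∉ p → i ∉ A)
    (hp : ∀ i ∈ C.exVars, F i ∉ p ∨ T i ∉ p)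
    (hq : IsReductModel (wsatRules (C.nodes.map Node.raw) k) p q) (hW : W ∉ q) :
    ∃ B ⊆ C.allVars, B.card = k ∧ ¬C.Satisfies (A ∪ B) := by
  obtain ⟨hY, -, hYn, hnode⟩ := isReductModel_wsatRules.1 hq
  have hn0 : 0 < C.nodes.length := List.length_pos_iff.2 C.nonempty
  choose! b hb hbq using hY
  have hbn : ∀ j < k, b j < C.nodes.length := by
    intro j hj
    rcases Nat.lt_succ_iff_lt_or_eq.1 (hb j hj) with h | h
    · exact h
    · exact absurd ((hYn j hj).1 (h ▸ hbq j hj)) hW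
  -- Without `W` in the model, neither the dummy nor a node that is not a universal variable can be
  -- chosen.
  have hball : ∀ j < k, b j ∈ C.allVars := by
    intro j hj
    rw [mem_allVars_iff C _ (hbn j hj)]
    by_contra h
    have := isReductModel_nodeRules.1 (hnode _ (hbn j hj))
    exact hW (this.2.2.2.1 h j hj (hbq j hj))
  -- A variable chosen under two numbers would yield `W`; hence the chosen set has exactly `k`
  -- elements.
  have hinj : Set.InjOn b (Finset.range k) := by
    intro j hj j' hj' e
    rw [Finset.mem_coe, Finset.mem_range] at hj hj'
    by_contra hne
    have := isReductModel_nodeRules.1 (hnode _ (hbn j hj))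
    exact hW ((this.2.2.2.2.2.2.2.2 j hj).2.2 j' hj' (Ne.symm hne) (hbq j hj) (e ▸ hbq j' hj'))
  refine ⟨(Finset.range k).image b, ?_, ?_, ?_⟩
  · intro i hi
    obtain ⟨j, hj, rfl⟩ := Finset.mem_image.1 hi
    exact hball j (Finset.mem_range.1 hj)
  · rw [Finset.card_image_of_injOn hinj, Finset.card_range]
  set v : ℕ → Bool := fun i =>
    (nodeValues (A ∪ (Finset.range k).image b) C.nodes).getD i false with hv
  -- By induction along the topological order, `q` contains for each node the atom for its correct
  -- value. It may contain the other atom too; this does no harm, as only the atom for a true output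
  -- is needed to derive `W`.
  have key : ∀ i < C.nodes.length, (v i = true → T i ∈ q) ∧ (v i = false → F i ∈ q) := by
    intro i
    induction i using Nat.strong_induction_on with
    | _ i ih =>
      intro hi
      have hvi : v i = (C.nodes[i]).eval _ v := getD_nodeValues _ C.nodes C.acyclic i hi
      have hac := C.acyclic i hi
      obtain ⟨h1, -, h3, -, h5, h6, h7, -, h9⟩ := isReductModel_nodeRules.1 (hnode i hi)
      have hex := mem_exVars_iff C i hi
      have hall := mem_allVars_iff C i hi
      rcases hnd : C.nodes[i] with _ | _ | l | l | u
      · have hi' := hex.2 hnd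
        have hiB : i ∉ (Finset.range k).image b := by
          intro h
          obtain ⟨j, hj, rfl⟩ := Finset.mem_image.1 h
          have := (mem_allVars_iff C _ hi).1 (hball j (Finset.mem_range.1 hj))
          rw [this] at hnd
          cases hnd
        rw [hnd, Node.eval] at hvi
        rw [hvi, decide_eq_true_iff, decide_eq_false_iff_not, Finset.mem_union,
          or_iff_left hiB]
        refine ⟨fun h => (h1 hnd).1 ?_, fun h => (h1 hnd).2 ?_⟩
        · exact (hp i hi').resolve_right fun h' => hF i hi' h' h
        · exact (hp i hi').resolve_left fun h' => h (hT i hi' h')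
      · have hiA : i ∉ A := fun h => by
          have := hex.1 (hA h)
          rw [this] at hnd
          cases hnd
        rw [hnd, Node.eval] at hvi
        rw [hvi, decide_eq_true_iff, decide_eq_false_iff_not, Finset.mem_union,
          or_iff_right hiA, Finset.mem_image]
        refine ⟨?_, fun h => (h3 hnd).1 fun j hj => ?_⟩
        · rintro ⟨j, hj, e⟩
          rw [Finset.mem_range] at hj
          exact (h3 hnd).2 j hj (e ▸ hbq j hj)
        · exact (h9 j hj).2.1 (b j) (hb j hj) (fun e => h ⟨j, Finset.mem_range.2 hj, e⟩) (hbq j hj)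
      · rw [hnd] at hac
        have hlt : ∀ u ∈ l, u < i := hac
        rw [hnd, Node.eval] at hvi
        rw [hvi, List.all_eq_true, List.all_eq_false]
        refine ⟨fun h => (h5 l hnd).1 fun u hu => (ih u (hlt u hu) ((hlt u hu).trans hi)).1 (h u hu),
          ?_⟩
        rintro ⟨u, hu, h⟩
        exact (h5 l hnd).2 u hu ((ih u (hlt u hu) ((hlt u hu).trans hi)).2 (by simpa using h))
      · rw [hnd] at hac
        have hlt : ∀ u ∈ l, u < i := hac
        rw [hnd, Node.eval] at hvi
        rw [hvi, List.any_eq_true, List.any_eq_false]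
        refine ⟨?_, fun h => (h6 l hnd).1 fun u hu =>
          (ih u (hlt u hu) ((hlt u hu).trans hi)).2 (by simpa using h u hu)⟩
        rintro ⟨u, hu, h⟩
        exact (h6 l hnd).2 u hu ((ih u (hlt u hu) ((hlt u hu).trans hi)).1 h)
      · rw [hnd] at hac
        have hlt : u < i := hac u (by simp [Node.inputs])
        have ihu := ih u hlt (hlt.trans hi)
        rw [hnd, Node.eval] at hvi
        rw [hvi]
        refine ⟨fun h => (h7 u hnd).1 (ihu.2 (by simpa using h)),
          fun h => (h7 u hnd).2 (ihu.1 (by simpa using h))⟩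
  rw [Circuit.satisfies_iff_getD]
  intro h
  have hlast : C.nodes.length - 1 < C.nodes.length := by omega
  have := isReductModel_nodeRules.1 (hnode _ hlast)
  exact hW (this.2.2.2.2.2.2.2.1 (by omega) ((key _ hlast).1 h))

/-- The answer set contains every atom in use except the wrong values of the existential variables.
A model of the reduct below it that contains `W` is everything by saturation, and one without `W`
would describe a falsifying assignment of weight `k`. -/
theorem exists_isAnswerSet_of_existsForallWeight (h : C.ExistsForallWeight k) :
    ∃ M, Program.IsAnswerSet
      ((wsatRules (C.nodes.map Node.raw) k).map (toRule name)).toFinset M := by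
  rw [exists_isAnswerSet_iff name_injective]
  obtain ⟨A, hA, h⟩ := h
  refine ⟨answerOf C k A, isReductModel_wsatRules.2 ⟨?_, ?_, ?_, ?_⟩, fun q hqp hq => ?_⟩
  · exact fun j hj => ⟨0, by omega, by omega, hj⟩
  · exact fun h => trivial
  · exact fun j hj => ⟨fun _ => trivial, fun i hi _ => ⟨hi, hj⟩⟩
  · intro i hi
    have hex := mem_exVars_iff C i hi
    have hTF : C.nodes[i] ≠ .ex → T i ∈ answerOf C k A ∧ F i ∈ answerOf C k A := fun h =>
      ⟨⟨hi, fun h' => absurd (hex.1 h') h⟩, ⟨hi, fun h' => absurd (hex.1 h') h⟩⟩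
    refine isReductModel_nodeRules.2 ⟨?_, ?_, ?_, ?_, ?_, ?_, ?_, ?_, ?_⟩
    · refine fun hnd => ⟨fun h' => ⟨hi, fun _ => ?_⟩, fun h' => ⟨hi, fun hiex hiA => ?_⟩⟩
      · by_contra hiA
        exact h' ⟨hi, fun _ => hiA⟩
      · exact h' ⟨hi, fun _ => hiA⟩
    · exact fun hnd _ => hTF hnd
    · exact fun hnd => ⟨fun _ => (hTF (by simp [hnd])).2, fun _ _ _ => (hTF (by simp [hnd])).1⟩
    · exact fun _ _ _ _ => trivial
    · exact fun l hnd => ⟨fun _ => (hTF (by simp [hnd])).1, fun _ _ _ => (hTF (by simp [hnd])).2⟩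
    · exact fun l hnd => ⟨fun _ => (hTF (by simp [hnd])).2, fun _ _ _ => (hTF (by simp [hnd])).1⟩
    · exact fun u hnd => ⟨fun _ => (hTF (by simp [hnd])).1, fun _ => (hTF (by simp [hnd])).2⟩
    · exact fun _ _ => trivial
    · exact fun j hj => ⟨fun _ => ⟨hi, hj⟩, fun _ _ _ _ => ⟨hi, hj⟩, fun _ _ _ _ _ => trivial⟩
  · have hW : W ∈ q := by
      by_contra hW
      have hT : ∀ i ∈ C.exVars, F i ∉ answerOf C k A → i ∈ A := fun i hi h' => by
        by_contra hiA
        exact h' ⟨Finset.mem_range.1 (Finset.mem_filter.1 hi).1, fun _ => hiA⟩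
      have hF : ∀ i ∈ C.exVars, T i ∉ answerOf C k A → i ∉ A := fun i hi h' hiA =>
        h' ⟨Finset.mem_range.1 (Finset.mem_filter.1 hi).1, fun _ => hiA⟩
      have hTF : ∀ i ∈ C.exVars, F i ∉ answerOf C k A ∨ T i ∉ answerOf C k A := fun i hi => by
        by_cases hiA : i ∈ A
        · exact .inl fun h' => h'.2 hi hiA
        · exact .inr fun h' => hiA (h'.2 hi)
      obtain ⟨B, hB, hk, hs⟩ := not_satisfies_of_isReductModel C k hA hT hF hTF hq hW
      exact hs (h B hB hk)
    -- From `W` all atoms are recovered by saturation, apart from the values of existential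
    -- variables. The latter are facts of the reduct, as the opposite value is not in the candidate.
    obtain ⟨-, -, hY, hnode⟩ := isReductModel_wsatRules.1 hq
    intro u hu
    have hnode' := fun i (hi : i < C.nodes.length) => isReductModel_nodeRules.1 (hnode i hi)
    match u, hu with
    | (0, i, 0), hu =>
      by_cases hex : C.nodes[i]'hu.1 = .ex
      · have hi := (mem_exVars_iff C i hu.1).2 hex
        exact ((hnode' i hu.1).1 hex).1 fun h' => h'.2 hi (hu.2 hi)
      · exact ((hnode' i hu.1).2.1 hex hW).1
    | (1, i, 0), hu =>
      by_cases hex : C.nodes[i]'hu.1 = .ex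
      · have hi := (mem_exVars_iff C i hu.1).2 hex
        exact ((hnode' i hu.1).1 hex).2 fun h' => hu.2 hi (h'.2 hi)
      · exact ((hnode' i hu.1).2.1 hex hW).2
    | (2, i, j), hu => exact (hY j hu.2).2 i hu.1 hW
    | (3, i, j), hu => exact ((hnode' i hu.1).2.2.2.2.2.2.2.2 j hu.2).1 hW
    | (4, 0, 0), hu => exact hW

/-- The values of the existential variables are read off the answer set `p`, which contains `W`. If
an assignment of weight `k` falsified the circuit, then the atoms of `p` that are true under it
would form a model of the reduct without `W`, contradicting minimality. -/
theorem existsForallWeight_of_exists_isAnswerSet (h : ∃ M, Program.IsAnswerSet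
      ((wsatRules (C.nodes.map Node.raw) k).map (toRule name)).toFinset M) :
    C.ExistsForallWeight k := by
  classical
  rw [exists_isAnswerSet_iff name_injective] at h
  obtain ⟨p, hp, hmin⟩ := h
  obtain ⟨-, hpW, hpY, hpn⟩ := isReductModel_wsatRules.1 hp
  have hW : W ∈ p := by
    by_contra hW
    exact hW (hpW hW)
  have hpn' := fun i (hi : i < C.nodes.length) => isReductModel_nodeRules.1 (hpn i hi)
  refine ⟨C.exVars.filter fun i => T i ∈ p, Finset.filter_subset _ _, fun B hB hk => ?_⟩
  set A := C.exVars.filter fun i => T i ∈ p with hA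
  by_contra hcon
  rw [Circuit.satisfies_iff_getD, Bool.not_eq_true] at hcon
  set v : ℕ → Bool := fun i => (nodeValues (A ∪ B) C.nodes).getD i false with hv
  -- The `k` true universal variables are numbered in any order; each choice rule picks the one with
  -- its number.
  obtain ⟨b, hbB, hbinj, hbsurj⟩ : ∃ b : ℕ → ℕ, (∀ j < k, b j ∈ B) ∧
      (∀ j < k, ∀ j' < k, b j = b j' → j = j') ∧ ∀ i ∈ B, ∃ j < k, b j = i := by
    let e := B.equivFinOfCardEq hk
    refine ⟨fun j => if h : j < k then (e.symm ⟨j, h⟩ : ℕ) else 0, fun j hj => ?_,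
      fun j hj j' hj' h => ?_, fun i hi => ⟨e ⟨i, hi⟩, (e ⟨i, hi⟩).2, ?_⟩⟩
    · simp [hj]
    · simp only [hj, hj', dif_pos] at h
      simpa using e.symm.injective (Subtype.ext h)
    · simp
  have hbn : ∀ j < k, b j < C.nodes.length := fun j hj => lt_of_mem_allVars C (hB (hbB j hj))
  have hq : IsReductModel (wsatRules (C.nodes.map Node.raw) k) p (p ∩ valuesOf v b) := by
    refine isReductModel_wsatRules.2 ⟨?_, ?_, ?_, ?_⟩
    · exact fun j hj => ⟨b j, (hbn j hj).trans (Nat.lt_succ_self _),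
        (hpY j hj).2 _ ((hbn j hj).trans (Nat.lt_succ_self _)) hW, rfl⟩
    · exact fun h => absurd hW h
    · refine fun j hj => ⟨fun h => ?_, fun i hi h => h.2.elim⟩
      have : C.nodes.length = b j := h.2
      have := hbn j hj
      omega
    · intro i hi
      have hvi : v i = (C.nodes[i]).eval _ v := getD_nodeValues _ C.nodes C.acyclic i hi
      have hex := mem_exVars_iff C i hi
      have hall := mem_allVars_iff C i hi
      obtain ⟨h1, h2, -, -, -, -, -, -, h9⟩ := hpn' i hi
      -- Since `W ∈ p`, saturation has put both values of the node into `p`, so the intersection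
      -- keeps the correct one.
      have hTF : C.nodes[i] ≠ .ex → (v i = true → T i ∈ p ∩ valuesOf v b) ∧
          (v i = false → F i ∈ p ∩ valuesOf v b) := fun h =>
        ⟨fun h' => ⟨(h2 h hW).1, h'⟩, fun h' => ⟨(h2 h hW).2, h'⟩⟩
      refine isReductModel_nodeRules.2 ⟨?_, ?_, ?_, ?_, ?_, ?_, ?_, ?_, ?_⟩
      · intro hnd
        have hiB : i ∉ B := fun h => by
          have := hall.1 (hB h)
          rw [this] at hnd
          cases hnd
        have hviA : v i = true ↔ T i ∈ p := by
          rw [hvi, hnd, Node.eval, decide_eq_true_iff, Finset.mem_union, or_iff_left hiB, hA,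
            Finset.mem_filter, and_iff_right (hex.2 hnd)]
        refine ⟨fun h => ?_, fun h => ?_⟩
        · have := (h1 hnd).1 h
          exact ⟨this, hviA.2 this⟩
        · exact ⟨(h1 hnd).2 h, Bool.eq_false_iff.2 fun h' => h (hviA.1 h')⟩
      · exact fun _ h => h.2.elim
      · intro hnd
        have hiA : i ∉ A := fun h => by
          have := hex.1 (Finset.mem_filter.1 h).1
          rw [this] at hnd
          cases hnd
        have hviB : v i = true ↔ i ∈ B := by
          rw [hvi, hnd, Node.eval, decide_eq_true_iff, Finset.mem_union, or_iff_right hiA]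
        refine ⟨fun h => (hTF (by simp [hnd])).2 (Bool.eq_false_iff.2 fun h' => ?_),
          fun j hj h => (hTF (by simp [hnd])).1 (hviB.2 ?_)⟩
        · obtain ⟨j, hj, e⟩ := hbsurj i (hviB.1 h')
          exact (h j hj).2 e.symm
        · have : i = b j := h.2
          exact this ▸ hbB j hj
      · intro hnd j hj h
        have : i = b j := h.2
        exact absurd (hall.1 (this ▸ hB (hbB j hj))) hnd
      · intro l hnd
        rw [hnd, Node.eval] at hvi
        refine ⟨fun h => (hTF (by simp [hnd])).1 ?_, fun u hu h => (hTF (by simp [hnd])).2 ?_⟩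
        · rw [hvi, List.all_eq_true]
          exact fun u hu => (h u hu).2
        · rw [hvi, List.all_eq_false]
          have : v u = false := h.2
          exact ⟨u, hu, by simp [this]⟩
      · intro l hnd
        rw [hnd, Node.eval] at hvi
        refine ⟨fun h => (hTF (by simp [hnd])).2 ?_, fun u hu h => (hTF (by simp [hnd])).1 ?_⟩
        · rw [hvi, List.any_eq_false]
          intro u hu
          have : v u = false := (h u hu).2
          simp [this]
        · rw [hvi, List.any_eq_true]
          exact ⟨u, hu, h.2⟩
      · intro u hnd
        rw [hnd, Node.eval] at hvi
        refine ⟨fun h => (hTF (by simp [hnd])).1 ?_, fun h => (hTF (by simp [hnd])).2 ?_⟩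
        · have : v u = false := h.2
          rw [hvi, this]; rfl
        · have : v u = true := h.2
          rw [hvi, this]; rfl
      · intro hlast h
        obtain rfl : i = C.nodes.length - 1 := by omega
        have h' : v (C.nodes.length - 1) = true := h.2
        rw [hv] at h'
        simp only [hcon] at h'
        cases h'
      · refine fun j hj => ⟨fun h => h.2.elim, fun i' hi' hne h => ?_, fun j' hj' hne h h' => ?_⟩
        · have e : i' = b j := h.2
          exact ⟨(h9 j hj).1 hW, fun h => hne (e.trans h.symm)⟩
        · have e : i = b j := h.2
          have e' : i = b j' := h'.2
          exact absurd (hbinj j' hj' j hj (e'.symm.trans e)) hne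
  -- Minimality would put `W` into `valuesOf v b`, where it is false by definition.
  exact (hmin _ Set.inter_subset_left hq hW).2

end

end ParamASP

/-! ### The parameter of the constructed program and the hardness reduction -/

namespace ParamASP

open Function Polynomial TreeRep WSatAtom NamedRule

theorem length_head_nodeRules (n k i : ℕ) (nd : CircuitSymbol × List ℕ) :
    ∀ r ∈ nodeRules n k i nd, r.1.length = 1 := by
  simp only [nodeRules, List.forall_mem_append]
  refine ⟨?_, ?_, ?_, ?_, ?_, ?_, ?_⟩
  iterate 6 split_ifs <;> simp
  intro r hr
  obtain ⟨j, -, hr⟩ := List.mem_flatMap.1 hr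
  rcases List.mem_cons.1 hr with rfl | hr
  · rfl
  · rcases List.mem_append.1 hr with hr | hr
    all_goals
      obtain ⟨j', -, hr⟩ := List.mem_flatMap.1 hr
      split_ifs at hr
      · simp at hr
      · rw [List.mem_singleton.1 hr]; rfl

/-- Only the choice rules have more than one head atom. Each has `ns.length + 1` disjuncts, which is
at least two because of the dummy index, and different numbers give different rules. -/
theorem numDisjunctive_wsatRules (ns : List (CircuitSymbol × List ℕ)) (hns : ns ≠ []) (k : ℕ) :
    Program.numDisjunctive ((wsatRules ns k).map (toRule name)).toFinset = k := by
  have hn : 0 < ns.length := List.length_pos_iff.2 hns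
  let D : ℕ → NamedRule WSatAtom := fun j =>
    ((List.range (ns.length + 1)).map (fun i => Y i j), [], [])
  have hrest : ∀ r ∈ ([W], [], [W]) :: ((List.range k).flatMap (fun j => choiceRules ns.length j) ++
      ns.zipIdx.flatMap fun x => nodeRules ns.length k x.2 x.1), r.1.length = 1 := by
    intro r hr
    rcases List.mem_cons.1 hr with rfl | hr
    · rfl
    rcases List.mem_append.1 hr with hr | hr
    · obtain ⟨j, -, hr⟩ := List.mem_flatMap.1 hr
      rcases List.mem_cons.1 hr with rfl | hr
      · rfl
      · obtain ⟨i, -, rfl⟩ := List.mem_map.1 hr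
        rfl
    · obtain ⟨x, -, hr⟩ := List.mem_flatMap.1 hr
      exact length_head_nodeRules _ _ _ _ r hr
  have hinj : Injective fun j => toRule name (D j) := by
    intro j j' h
    -- The first disjunct, which names `Y 0 j`, already determines `j`.
    have h' := congrArg (fun r : Rule => r.head[0]?) h
    simp only [toRule, D, List.map_map, List.getElem?_map, List.getElem?_range (Nat.succ_pos _),
      Option.map_some, Option.some_inj, comp_apply] at h'
    simpa using name_injective h'
  have : ((wsatRules ns k).map (toRule name)).toFinset.filter Rule.IsDisjunctive =
      (Finset.range k).image fun j => toRule name (D j) := by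
    ext r
    simp only [Finset.mem_filter, List.mem_toFinset, Finset.mem_image, Finset.mem_range]
    constructor
    · rintro ⟨hr, hd⟩
      obtain ⟨s, hs, rfl⟩ := List.mem_map.1 hr
      rcases List.mem_append.1 hs with hs | hs
      · obtain ⟨j, hj, rfl⟩ := List.mem_map.1 hs
        exact ⟨j, List.mem_range.1 hj, rfl⟩
      · have := hrest s hs
        simp [Rule.IsDisjunctive, toRule, this] at hd
    · rintro ⟨j, hj, rfl⟩
      refine ⟨List.mem_map_of_mem (List.mem_append_left _ (List.mem_map.2
        ⟨j, List.mem_range.2 hj, rfl⟩)), ?_⟩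
      simp only [Rule.IsDisjunctive, toRule, D, List.length_map, List.length_range]
      omega
  rw [Program.numDisjunctive, this, Finset.card_image_of_injective _ hinj, Finset.card_range]

/-- All inputs of nodes are earlier nodes. -/
def isTopological (ns : List (CircuitSymbol × List ℕ)) : Bool :=
  ns.zipIdx.all fun x => x.1.2.all fun j => decide (j ∈ List.range x.2)

theorem isTopological_iff (nodes : List Node) : isTopological (nodes.map Node.raw) = true ↔
    ∀ (i : ℕ) (h : i < nodes.length), ∀ j ∈ (nodes[i]).inputs, j < i := by
  have hin : ∀ nd : Node, nd.raw.2 = nd.inputs := by intro nd; cases nd <;> rfl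
  simp only [isTopological, List.all_eq_true, decide_eq_true_iff, List.mem_range]
  constructor
  · intro h i hi j hj
    exact h (nodes[i].raw, i) (List.mem_zipIdx_iff_getElem?.2 (by simp [hi])) j (by rwa [hin])
  · rintro h ⟨r, i⟩ hx j hj
    rw [List.mem_zipIdx_iff_getElem?] at hx
    dsimp only at hx hj ⊢
    obtain ⟨hi, e⟩ := List.getElem?_eq_some_iff.1 hx
    rw [List.getElem_map] at e
    subst e
    exact h i (by simpa using hi) j (by rwa [← hin])

/-- The reduction from the weighted satisfiability problem to ASP-consistency. -/
def wsatToAsp (p : List CircuitSymbol × ℕ) : List ProgramSymbol × ℕ :=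
  -- A lone bit is not the word of a program, so this is a no-instance. The empty word would not do:
  -- it is the empty program, which is consistent and has parameter 0.
  (parseCircuit p.1).elim ([.bit true], 0) fun ns =>
    if ns ≠ [] ∧ isTopological ns = true then
      (rulesWord ((wsatRules ns p.2).map (toRule name)), p.2)
    else ([.bit true], 0)

theorem polyFun_wsatToAsp : PolyFun wsatToAsp := by
  have h1 := polyFun_parseCircuit
  have h2 := polyFun_wsatRules
    (fun x : (List CircuitSymbol × ℕ) × List (CircuitSymbol × List ℕ) => x.2) (fun x => x.1.2)
    (by fun_prop) (by fun_prop)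
  have h3 : PolyFun ProgramSymbol.bit := PolyFun.of_finite _
  have h4 : PolyFun rulesWord := by
    unfold rulesWord Rule.word atomWord
    fun_prop
  have h5 : PolyFun isTopological := by
    unfold isTopological
    fun_prop
  unfold wsatToAsp
  fun_prop

theorem wsatToAsp_snd_le (p : List CircuitSymbol × ℕ) : (wsatToAsp p).2 ≤ p.2 := by
  rcases h : parseCircuit p.1 with _ | l
  · simp [wsatToAsp, h]
  · simp only [wsatToAsp, h, Option.elim_some]
    split_ifs <;> simp

theorem mem_existsForallWSat_iff (p : List CircuitSymbol × ℕ) :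
    p ∈ (existsForallWSat Set.univ).yes ↔ wsatToAsp p ∈ aspConsistencyDisjRules.yes := by
  have hno : (([.bit true], 0) : List ProgramSymbol × ℕ) ∉ aspConsistencyDisjRules.yes := by
    rintro ⟨l, h, -⟩
    have := parseRules_rulesWord l
    rw [← h] at this
    cases this
  rcases h : parseCircuit p.1 with _ | ns
  · simp only [wsatToAsp, h, Option.elim_none, hno, iff_false]
    rintro ⟨C, -, hC, -⟩
    rw [hC, Circuit.word, parseCircuit_word] at h
    cases h
  · obtain ⟨nodes, rfl, hw⟩ := parseCircuit_eq_some h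
    simp only [wsatToAsp, h, Option.elim_some]
    split_ifs with hc
    · have hne : nodes ≠ [] := by simpa using hc.1
      let C : Circuit := ⟨nodes, hne, (isTopological_iff nodes).1 hc.2⟩
      have hp : p = (C.word, p.2) := Prod.ext hw rfl
      have hyes : (rulesWord ((wsatRules (nodes.map Node.raw) p.2).map (toRule name)), p.2) ∈
          aspConsistencyDisjRules.yes ↔ ∃ M, Program.IsAnswerSet
            ((wsatRules (nodes.map Node.raw) p.2).map (toRule name)).toFinset M := by
        constructor
        · rintro ⟨l, hl, -, h'⟩
          have := congrArg parseRules hl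
          rw [parseRules_rulesWord, parseRules_rulesWord, Option.some_inj] at this
          rwa [this]
        · exact fun h' => ⟨_, rfl, numDisjunctive_wsatRules _ hc.1 _, h'⟩
      rw [hyes, hp, word_mem_existsForallWSat]
      exact ⟨exists_isAnswerSet_of_existsForallWeight C p.2,
        existsForallWeight_of_exists_isAnswerSet C p.2⟩
    · refine iff_of_false ?_ hno
      rintro ⟨C, -, hC, -⟩
      rw [hC, Circuit.word, parseCircuit_word, Option.some_inj] at h
      rw [← h] at hc
      exact hc ⟨by simpa using C.nonempty, (isTopological_iff _).2 C.acyclic⟩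

/-- The class consists of the problems that reduce to weighted satisfiability, so `wsatToAsp` is
applied after the given reduction. As it does not increase the parameter, the bound `g` of that
reduction is still valid. -/
theorem aspConsistencyDisjRules_hard : IsHardFor existsForallWP aspConsistencyDisjRules := by
  rintro L ⟨_, rfl, R, hR, ⟨g, hg, hRg⟩, hfpt⟩
  refine ⟨fun p => wsatToAsp (R p), fun p => (hR p).trans (mem_existsForallWSat_iff (R p)),
    ⟨g, hg, fun I k => (wsatToAsp_snd_le _).trans (hRg I k)⟩, ?_⟩
  exact FptTimeComputable.comp_polyFun (T := CircuitSymbol) (U := ProgramSymbol) hfpt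
    polyFun_wsatToAsp

end ParamASP

theorem mainTheorem3 :
    ParamASP.IsCompleteFor ParamASP.existsForallWP ParamASP.aspConsistencyDisjRules :=
  ⟨ParamASP.aspConsistencyDisjRules_mem, ParamASP.aspConsistencyDisjRules_hard⟩
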